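/- Let $H\in(0,\tfrac13)$ and $T>0$. There is a constant $C>0$, depending only on $H$ and $T$, such that the following holds. Let $B=(B_s)_{s\in[0,T]}$ be a fractional Brownian motion with Hurst parameter $H$ on a probability space $(\Omega,\mathcal F,P)$, that is, a centered Gaussian process with covariance $E[B_tB_s]=\tfrac12\left(t^{2H}+s^{2H}-|t-s|^{2H}\right)$ and almost surely continuous paths. Let $b:[0,T]\times\mathbb R\to\mathbb R$ be measurable and bounded, with $\|b\|_\infty=\operatorname{ess\,sup}_{s\in[0,T]}\sup_{y\in\mathbb R}|b(s,y)|$ (it suffices that this is finite), and let $t\in[0,T]$. Then the random field $$\Lambda^b(t,y)=\frac1{2\pi}\int_{\mathbb R}\int_0^t b(s,y)\,iu\,e^{-iu(B_s-y)}\,ds\,du,\qquad y\in\mathbb R,$$ where the outer integral is understood for each $y$ as the limit in $L^2(\Omega)$, as $K\to\infty$, of the integrals over $u\in[-K,K]$, exists and has a version jointly measurable in $(\omega,y)$; and for every such version and every integer $m\ge 0$, $$E\left[\left(\int_{\mathbb R}|\Lambda^b(t,y)|\,dy\right)^m\right]\le \frac{C^m\,\|b\|_\infty^m\,\sqrt{(2m)!}}{\sqrt{\Gamma(m(1-3H)+1)}}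 .$$ -/

import Mathlib

open MeasureTheory ProbabilityTheory Filter Set
open scoped Topology

/-- `B` is a fractional Brownian motion with Hurst parameter `H` on `[0, T]`: a centered Gaussian
process indexed by `[0, T]` with covariance `(t ^ (2H) + s ^ (2H) - |t - s| ^ (2H)) / 2` and almost
surely continuous trajectories. Values of `B` at times outside `[0, T]` play no role. -/
structure IsFractionalBM {Ω : Type*} [MeasurableSpace Ω] (H T : ℝ) (B : ℝ → Ω → ℝ)
    (P : Measure Ω) : Prop where
  gaussian : IsGaussianProcess (fun s : Icc (0 : ℝ) T => B s) P
  centered : ∀ t ∈ Icc (0 : ℝ) T, ∫ ω, B t ω ∂P = 0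
  covariance : ∀ t ∈ Icc (0 : ℝ) T, ∀ s ∈ Icc (0 : ℝ) T,
    ∫ ω, B t ω * B s ω ∂P = (t ^ (2 * H) + s ^ (2 * H) - |t - s| ^ (2 * H)) / 2
  continuous_paths : ∀ᵐ ω ∂P, ContinuousOn (fun t => B t ω) (Icc 0 T)

/-- `M` is an essential bound of `b` on `[0, T] × ℝ`: for almost every time `s ∈ [0, T]`,
`|b(s, y)| ≤ M` for all `y`. -/
def IsDriftBound (b : ℝ → ℝ → ℝ) (T M : ℝ) : Prop :=
  0 ≤ M ∧ ∀ᵐ s ∂(volume.restrict (Icc 0 T)), ∀ y, |b s y| ≤ M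

/-- A bounded measurable `b : [0, T] × ℝ → ℝ`, given by any measurable extension to `ℝ × ℝ`. -/
def IsBoundedDrift (b : ℝ → ℝ → ℝ) (T : ℝ) : Prop :=
  Measurable (Function.uncurry b) ∧ ∃ M, IsDriftBound b T M

/-- `‖b‖_∞ = ess sup_{s ∈ [0, T]} sup_y |b(s, y)|`, for a bounded `b`. It is at most the supremum
of `|b|` over `[0, T] × ℝ`. -/
noncomputable def driftNorm (b : ℝ → ℝ → ℝ) (T : ℝ) : ℝ :=
  sInf {M | IsDriftBound b T M}

/-- The truncation
`Λ_K(t, y) = (2π)⁻¹ ∫_{-K}^K ∫_0^t b(s, y) i u exp(-i u (B_s - y)) ds du`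
of the integral that represents `Λ^b(t, y)`. -/
noncomputable def truncLambda {Ω : Type*} (B : ℝ → Ω → ℝ) (b : ℝ → ℝ → ℝ) (t K : ℝ)
    (ω : Ω) (y : ℝ) : ℂ :=
  (2 * (Real.pi : ℂ))⁻¹ * ∫ u in (-K)..K, ∫ s in (0 : ℝ)..t,
    (b s y : ℂ) * (Complex.I * (u : ℂ)) *
      Complex.exp (-(Complex.I * (u : ℂ) * ((B s ω : ℂ) - (y : ℂ))))

/-- `L` is (a jointly measurable version of) the random field `y ↦ Λ^b(t, y)`,
`Λ^b(t, y) = (2π)⁻¹ ∫_ℝ ∫_0^t b(s, y) i u exp(-i u (B_s - y)) ds du`,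
where the outer integral over `ℝ` is the limit in `L²(Ω)` of the integrals over `[-K, K]`
as `K → ∞`. For every `y` this determines `L · y` up to a `P`-null set. -/
structure IsLambda {Ω : Type*} [MeasurableSpace Ω] (P : Measure Ω) (B : ℝ → Ω → ℝ)
    (b : ℝ → ℝ → ℝ) (t : ℝ) (L : Ω → ℝ → ℂ) : Prop where
  measurable : Measurable (Function.uncurry L)
  tendsto : ∀ y : ℝ, Tendsto
    (fun K : ℝ => eLpNorm (fun ω => truncLambda B b t K ω y - L ω y) 2 P) atTop (𝓝 0)

/-!
# Moments of the `L¹` norm of the field `Λ^b(t, ·)` of a fractional Brownian motion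

Formally `Λ^b(t, y) = -∫_0^t b(s, y) δ_y'(B_s) ds`. The proof replaces the Dirac mass by the
Gaussian density of variance `ε` (`mollLambda`) and bounds `E [(∫ (1 + y²) Λ_ε(y)² dy) ^ m]`
uniformly in `ε`. The weight gives `(∫ |Λ|)² ≤ π ∫ (1 + y²) |Λ|²` by Cauchy's inequality
(`sq_lintegral_le_weighted`), so that the `m`-th moment of `∫ |Λ|` is at most `π ^ (m/2)` times
the square root of the `m`-th moment of the weighted square integral; this is where the square
roots in the bound come from.

The `m`-th power of the weighted square integral is an integral over `m` space variables and `2m`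
times of the expectation of `∏_j ∂_y p_ε(B_{s_j} - y_j)`. The essential input is strong local
nondeterminism with a constant that does not depend on the number of times, `fbmVar_lower_bound`:
the covariance matrix of `(B_{s_j})` minus the diagonal matrix with entries `δ_j ^ (2H) / 4` is
positive semidefinite, where `δ_j` (`timeGap`) is the distance of `s_j` to `0` and to the other
times. The reason is that `x ^ (2H)` is a mixture of `1 - exp (-l x)`, so that the covariance is
a mixture of Ornstein-Uhlenbeck covariances, for which the bound is elementary
(`ornsteinUhlenbeck_lower_bound`). Hence `(B_{s_j})` has the law of a sum of a Gaussian vector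
and of an independent one with independent coordinates of variances `δ_j ^ (2H) / 4`. Averaging
over the latter turns the factors into derivatives of Gaussian densities of variance at least
`δ_j ^ (2H) / 4` (`exists_integral_prod_gaussDeriv_eq`). Each space variable occurs twice, so the
Cauchy-Schwarz inequality in space leaves, up to `K ^ m m!`, the product of `δ_j ^ (-3H/2)`
(`exists_lintegral_weight_mul_prod_gaussDeriv_le`); the gap `δ_j` is one of the two gaps next to
`s_j`, and so each gap occurs with exponent at worst `-3H`, which is integrable. The integral
over the times is `exists_lintegral_prod_timeGap_le`.

The convergence of the truncated integrals is treated by Fourier multipliers (`multLambda`): the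
second moment of the field with multiplier `φ` is bounded by the integral of `|φ(u) φ(v)|`
against the kernel `|u v| exp (-Var(u B_s - v B_r) / 2)`, which is integrable because `3H < 1`
(`lintegral_pairKernel_lt_top`). By dominated convergence the truncated fields converge in
`L²(Ω)`, and so do the mollified fields, to the same limit
(`exists_isLambda_tendsto_mollLambda`). Along a sequence the latter converge almost surely, and
Fatou's lemma transfers the moment bound to the limit (`sq_lintegral_pow_le_of_tendsto`).
-/

/-! ### Strong local nondeterminism -/

lemma integral_exp_tail_mul_exp_tail {l : ℝ} (hl : 0 < l) (a b : ℝ) :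
    Integrable (fun z : ℝ => (if z ≤ a then Real.exp (-l * (a - z)) else 0) *
      (if z ≤ b then Real.exp (-l * (b - z)) else 0)) ∧
    ∫ z : ℝ, (if z ≤ a then Real.exp (-l * (a - z)) else 0) *
      (if z ≤ b then Real.exp (-l * (b - z)) else 0) = Real.exp (-l * |a - b|) / (2 * l) := by
  have hfun : (fun z : ℝ => (if z ≤ a then Real.exp (-l * (a - z)) else 0) *
      (if z ≤ b then Real.exp (-l * (b - z)) else 0)) =
      (Iic (min a b)).indicator
        (fun z => Real.exp (-l * (a + b)) * Real.exp ((2 * l) * z)) := by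
    ext z
    by_cases ha : z ≤ a <;> by_cases hb : z ≤ b <;>
      simp [ha, hb, indicator, ← Real.exp_add]
    ring
  have h2l : 0 < 2 * l := by positivity
  rw [hfun]
  refine ⟨(integrable_indicator_iff measurableSet_Iic).2
    ((integrableOn_exp_mul_Iic h2l _).const_mul _), ?_⟩
  rw [integral_indicator measurableSet_Iic, integral_const_mul, integral_exp_mul_Iic h2l,
    mul_div_assoc', ← Real.exp_add]
  congr 2
  rcases le_total a b with h | h
  · rw [min_eq_left h, abs_of_nonpos (by linarith)]; ring
  · rw [min_eq_right h, abs_of_nonneg (by linarith)]; ring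

/-- The covariance matrix `exp (-l |s_j - s_k|)` of the stationary Ornstein-Uhlenbeck process
dominates a diagonal matrix. It is, up to a factor, the Gram matrix in `L²(ℝ)` of the functions
`z ↦ 1_{z ≤ s_j} exp (-l (s_j - z))`; a linear combination of these jumps by `u_j` at `s_j` and is
exponential on either side of it, which bounds its mass near `s_j` from below. -/
lemma ornsteinUhlenbeck_lower_bound {κ : Type*} [Fintype κ] {l : ℝ} (hl : 0 < l)
    (s u δ : κ → ℝ) (hδ0 : ∀ j, 0 ≤ δ j) (hδ : ∀ j k, j ≠ k → δ j ≤ |s j - s k|) :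
    (1 / 2) * ∑ j, (1 - Real.exp (-l * δ j)) * u j ^ 2 ≤
      ∑ j, ∑ k, u j * u k * Real.exp (-l * |s j - s k|) := by
  classical
  set e : κ → ℝ → ℝ := fun j z => if z ≤ s j then Real.exp (-l * (s j - z)) else 0 with he
  set F : ℝ → ℝ := fun z => ∑ j, u j * e j z with hF
  have hsq : ∀ z, F z ^ 2 = ∑ j, ∑ k, u j * u k * (e j z * e k z) := by
    intro z
    simp only [hF, sq, Finset.sum_mul_sum]
    exact Finset.sum_congr rfl fun j _ => Finset.sum_congr rfl fun k _ => by ring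
  have hint : Integrable (fun z => F z ^ 2) := by
    simp only [hsq]
    exact integrable_finsetSum _ fun j _ => integrable_finsetSum _ fun k _ =>
      (integral_exp_tail_mul_exp_tail hl (s j) (s k)).1.const_mul _
  have htot : ∫ z, F z ^ 2 = (∑ j, ∑ k, u j * u k * Real.exp (-l * |s j - s k|)) / (2 * l) := by
    simp only [hsq]
    rw [integral_finsetSum _ fun j _ => integrable_finsetSum _ fun k _ =>
      (integral_exp_tail_mul_exp_tail hl (s j) (s k)).1.const_mul _, Finset.sum_div]
    refine Finset.sum_congr rfl fun j _ => ?_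
    rw [integral_finsetSum _ fun k _ =>
      (integral_exp_tail_mul_exp_tail hl (s j) (s k)).1.const_mul _, Finset.sum_div]
    refine Finset.sum_congr rfl fun k _ => ?_
    rw [integral_const_mul, (integral_exp_tail_mul_exp_tail hl (s j) (s k)).2, mul_div_assoc]
  -- the mass of `F ^ 2` near `s j`
  have hloc : ∀ j, (1 - Real.exp (-l * δ j)) * u j ^ 2 / (4 * l) ≤
      ∫ z in Ioo (s j - δ j / 2) (s j + δ j / 2), F z ^ 2 := by
    intro j
    -- `p` is the value of `F` just to the right of `s j`, and `p + u j` the one at `s j`; the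
    -- squares of the two add up to at least `u j ^ 2 / 2`
    set p : ℝ := ∑ k, if s j < s k then u k * Real.exp (-l * (s k - s j)) else 0 with hp
    have hright : ∀ τ ∈ Ioo 0 (δ j / 2), F (s j + τ) = Real.exp (l * τ) * p := by
      intro τ hτ
      simp only [hF, hp, he, Finset.mul_sum]
      refine Finset.sum_congr rfl fun k _ => ?_
      by_cases hk : s j < s k
      · have h1 := hδ j k (by rintro rfl; exact lt_irrefl _ hk)
        rw [abs_of_neg (by linarith)] at h1
        rw [if_pos (by linarith [hτ.1, hτ.2]), if_pos hk, mul_left_comm, ← Real.exp_add]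
        ring_nf
      · rw [if_neg (by linarith [hτ.1, hτ.2]), if_neg hk]; simp
    have hleft : ∀ τ ∈ Ioo 0 (δ j / 2), F (s j - τ) = Real.exp (-(l * τ)) * (p + u j) := by
      intro τ hτ
      have : p + u j = ∑ k, if s j ≤ s k then u k * Real.exp (-l * (s k - s j)) else 0 := by
        rw [hp, ← Finset.add_sum_erase _ _ (Finset.mem_univ j),
          ← Finset.add_sum_erase _ (fun k => if s j ≤ s k then _ else (0 : ℝ)) (Finset.mem_univ j)]
        simp only [lt_irrefl, if_false, le_refl, if_true, sub_self, mul_zero, Real.exp_zero,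
          mul_one, zero_add]
        rw [add_comm]
        congr 1
        refine Finset.sum_congr rfl fun k hk => ?_
        have h1 := hδ j k (Finset.ne_of_mem_erase hk).symm
        have h2 : 0 < |s j - s k| := by linarith [hτ.1, hτ.2]
        have h3 : s j ≠ s k := by
          intro h; rw [h] at h2; simp at h2
        by_cases h : s j ≤ s k
        · rw [if_pos h, if_pos (lt_of_le_of_ne h h3)]
        · rw [if_neg h, if_neg (fun h' => h h'.le)]
      rw [this]
      simp only [hF, he, Finset.mul_sum]
      refine Finset.sum_congr rfl fun k _ => ?_
      by_cases hk : s j ≤ s k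
      · rw [if_pos (by linarith [hτ.1]), if_pos hk, mul_left_comm, ← Real.exp_add]
        ring_nf
      · have h1 := hδ j k (by rintro rfl; exact hk le_rfl)
        rw [abs_of_pos (by linarith)] at h1
        rw [if_neg (by linarith [hτ.1, hτ.2]), if_neg hk]; simp
    have h0 : (0 : ℝ) ≤ δ j / 2 := by linarith [hδ0 j]
    have hii : ∀ a b, IntervalIntegrable (fun z => F z ^ 2) volume a b :=
      fun a b => hint.intervalIntegrable
    have hiR : IntervalIntegrable (fun τ => F (s j + τ) ^ 2) volume 0 (δ j / 2) :=
      (hint.comp_add_left (s j)).intervalIntegrable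
    have hiL : IntervalIntegrable (fun τ => F (s j - τ) ^ 2) volume 0 (δ j / 2) :=
      (hint.comp_sub_left (s j)).intervalIntegrable
    have hsplit : ∫ z in Ioo (s j - δ j / 2) (s j + δ j / 2), F z ^ 2 =
        ∫ τ in (0 : ℝ)..(δ j / 2), (F (s j + τ) ^ 2 + F (s j - τ) ^ 2) := by
      rw [← integral_Ioc_eq_integral_Ioo, ← intervalIntegral.integral_of_le (by linarith),
        intervalIntegral.integral_add hiR hiL,
        intervalIntegral.integral_comp_sub_left (fun z => F z ^ 2),
        intervalIntegral.integral_comp_add_left (fun z => F z ^ 2),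
        ← intervalIntegral.integral_add_adjacent_intervals (hii _ (s j)) (hii _ _)]
      simp [add_comm]
    have hexp : ∫ τ in (0 : ℝ)..(δ j / 2), (u j ^ 2 / 2) * Real.exp (-(2 * l) * τ) =
        (1 - Real.exp (-l * δ j)) * u j ^ 2 / (4 * l) := by
      rw [intervalIntegral.integral_const_mul, intervalIntegral.integral_comp_mul_left _ (by
        linarith : -(2 * l) ≠ 0), integral_exp]
      simp only [mul_zero, Real.exp_zero, smul_eq_mul]
      rw [show -(2 * l) * (δ j / 2) = -l * δ j by ring]
      field_simp
      ring
    rw [hsplit, ← hexp]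
    refine intervalIntegral.integral_mono_on_of_le_Ioo h0
      (Continuous.intervalIntegrable (by fun_prop) _ _) (hiR.add hiL) fun τ hτ => ?_
    rw [hright τ hτ, hleft τ hτ, mul_pow, mul_pow, ← Real.exp_nat_mul, ← Real.exp_nat_mul]
    have h1 : Real.exp (-(2 * l) * τ) ≤ Real.exp ((2 : ℕ) * (l * τ)) :=
      Real.exp_le_exp.2 (by push_cast; nlinarith [hτ.1])
    have h2 : Real.exp ((2 : ℕ) * -(l * τ)) = Real.exp (-(2 * l) * τ) := by
      congr 1; push_cast; ring
    rw [h2]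
    have h3 := mul_le_mul_of_nonneg_right h1 (sq_nonneg p)
    have h4 := mul_nonneg (Real.exp_pos (-(2 * l) * τ)).le (sq_nonneg (p + p + u j))
    generalize Real.exp (-(2 * l) * τ) = E at *
    generalize Real.exp ((2 : ℕ) * (l * τ)) = E' at *
    linarith
  have hdisj : Pairwise (Function.onFun Disjoint
      fun j => Ioo (s j - δ j / 2) (s j + δ j / 2)) := by
    intro j k hjk
    refine Set.disjoint_left.2 fun z hz hz' => ?_
    have h1 := hδ j k hjk
    have h2 := hδ k j hjk.symm
    rw [abs_sub_comm] at h2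
    rcases abs_cases (s j - s k) with h | h <;> linarith [hz.1, hz.2, hz'.1, hz'.2]
  have hsum : ∑ j, (1 - Real.exp (-l * δ j)) * u j ^ 2 / (4 * l) ≤ ∫ z, F z ^ 2 := by
    refine (Finset.sum_le_sum fun j _ => hloc j).trans ?_
    rw [← integral_iUnion_fintype (fun j => measurableSet_Ioo) hdisj
      (fun j => hint.integrableOn)]
    exact setIntegral_le_integral hint (Eventually.of_forall fun z => sq_nonneg _)
  rw [htot, ← Finset.sum_div, div_le_div_iff₀ (by positivity) (by positivity)] at hsum
  nlinarith

/-- Near `0` the integrand is of the order of `l ^ (-2H)`, and near `∞` of `l ^ (-1 - 2H)`. -/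
lemma integrableOn_one_sub_exp_mul_rpow {H : ℝ} (hH0 : 0 < H) (hH1 : 2 * H < 1) {x : ℝ}
    (hx : 0 ≤ x) :
    IntegrableOn (fun l : ℝ => (1 - Real.exp (-l * x)) * l ^ (-1 - 2 * H)) (Ioi 0) := by
  have hmeas : Measurable (fun l : ℝ => (1 - Real.exp (-l * x)) * l ^ (-1 - 2 * H)) := by
    fun_prop
  rw [← Ioc_union_Ioi_eq_Ioi zero_le_one]
  refine IntegrableOn.union ?_ ?_
  · have h1 : IntegrableOn (fun l : ℝ => x * l ^ (-2 * H)) (Ioc 0 1) := by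
      have := intervalIntegral.intervalIntegrable_rpow' (a := 0) (b := 1)
        (r := -2 * H) (by linarith)
      rw [intervalIntegrable_iff_integrableOn_Ioc_of_le zero_le_one] at this
      exact this.const_mul x
    refine h1.mono' hmeas.aestronglyMeasurable ?_
    filter_upwards [ae_restrict_mem measurableSet_Ioc] with l hl
    have h2 : 0 ≤ 1 - Real.exp (-l * x) := by
      have : Real.exp (-l * x) ≤ 1 := Real.exp_le_one_iff.2 (by nlinarith [hl.1])
      linarith
    have h3 : 1 - Real.exp (-l * x) ≤ l * x := by
      have := Real.add_one_le_exp (-l * x); linarith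
    have h4 : l ^ (-2 * H) = l * l ^ (-1 - 2 * H) := by
      rw [← Real.rpow_one_add' hl.1.le (by linarith)]; congr 1; ring
    rw [Real.norm_of_nonneg (mul_nonneg h2 (Real.rpow_nonneg hl.1.le _)), h4]
    nlinarith [Real.rpow_nonneg hl.1.le (-1 - 2 * H)]
  · have h1 : IntegrableOn (fun l : ℝ => l ^ (-1 - 2 * H)) (Ioi 1) :=
      integrableOn_Ioi_rpow_of_lt (by linarith) one_pos
    refine h1.mono' hmeas.aestronglyMeasurable ?_
    filter_upwards [ae_restrict_mem measurableSet_Ioi] with l hl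
    have hl0 : (0 : ℝ) < l := lt_trans one_pos hl
    have h2 : 0 ≤ 1 - Real.exp (-l * x) := by
      have : Real.exp (-l * x) ≤ 1 := Real.exp_le_one_iff.2 (by nlinarith)
      linarith
    rw [Real.norm_of_nonneg (mul_nonneg h2 (Real.rpow_nonneg hl0.le _))]
    nlinarith [Real.rpow_nonneg hl0.le (-1 - 2 * H), Real.exp_pos (-l * x)]

/-- For `0 < 2H < 1` the function `x ↦ x ^ (2H)` is a mixture of the functions
`x ↦ 1 - exp (-l x)`. -/
lemma integral_one_sub_exp_mul_rpow {H : ℝ} (hH0 : 0 < H) {x : ℝ} (hx : 0 ≤ x) :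
    ∫ l in Ioi (0 : ℝ), (1 - Real.exp (-l * x)) * l ^ (-1 - 2 * H) =
      x ^ (2 * H) * ∫ l in Ioi (0 : ℝ), (1 - Real.exp (-l * 1)) * l ^ (-1 - 2 * H) := by
  rcases hx.eq_or_lt with rfl | hx
  · rw [Real.zero_rpow (by positivity)]; simp
  have h := integral_comp_mul_right_Ioi
    (fun l : ℝ => (1 - Real.exp (-l * 1)) * l ^ (-1 - 2 * H)) 0 hx
  rw [zero_mul, smul_eq_mul] at h
  rw [show (∫ l in Ioi (0 : ℝ), (1 - Real.exp (-l * 1)) * l ^ (-1 - 2 * H)) =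
    x * ∫ l in Ioi (0 : ℝ), (1 - Real.exp (-(l * x) * 1)) * (l * x) ^ (-1 - 2 * H) by
      rw [h]; field_simp, ← mul_assoc, ← integral_const_mul]
  refine setIntegral_congr_fun measurableSet_Ioi fun l hl => ?_
  have hx1 : x ^ (2 * H) * x * x ^ (-1 - 2 * H) = 1 := by
    rw [← Real.rpow_add_one hx.ne', ← Real.rpow_add hx]
    ring_nf; simp
  rw [Real.mul_rpow (le_of_lt hl) hx.le, mul_one, neg_mul]
  linear_combination (-(1 - Real.exp (-(l * x))) * l ^ (-1 - 2 * H)) * hx1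

lemma integral_one_sub_exp_mul_rpow_pos {H : ℝ} (hH0 : 0 < H) (hH1 : 2 * H < 1) :
    0 < ∫ l in Ioi (0 : ℝ), (1 - Real.exp (-l * 1)) * l ^ (-1 - 2 * H) := by
  have hpos : ∀ l ∈ Ioi (0 : ℝ), 0 < (1 - Real.exp (-l * 1)) * l ^ (-1 - 2 * H) := by
    intro l hl
    have : Real.exp (-l * 1) < 1 := by
      rw [← Real.exp_zero]; exact Real.exp_lt_exp.2 (by simpa using hl)
    exact mul_pos (by linarith) (Real.rpow_pos_of_pos hl _)
  rw [setIntegral_pos_iff_support_of_nonneg_ae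
    ((ae_restrict_mem measurableSet_Ioi).mono fun l hl => (hpos l hl).le)
    (integrableOn_one_sub_exp_mul_rpow hH0 hH1 zero_le_one)]
  rw [inter_eq_right.2 (show Ioi (0 : ℝ) ⊆ Function.support _ from fun l hl => (hpos l hl).ne')]
  simp

/-- The covariance function of fractional Brownian motion. -/
noncomputable def fbmCov (H t s : ℝ) : ℝ := (t ^ (2 * H) + s ^ (2 * H) - |t - s| ^ (2 * H)) / 2

lemma fbmCov_comm (H t s : ℝ) : fbmCov H t s = fbmCov H s t := by
  rw [fbmCov, fbmCov, abs_sub_comm, add_comm (t ^ (2 * H))]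

/-- The variance of `∑ j, u j * B_{s j}` for a fractional Brownian motion `B`. -/
noncomputable def fbmVar {ι : Type*} [Fintype ι] (H : ℝ) (s u : ι → ℝ) : ℝ :=
  ∑ j, ∑ k, u j * u k * fbmCov H (s j) (s k)

/-- Strong local nondeterminism with a constant that does not depend on the number of times:
if `δ j` is at most the distance of `s j` to `0` and to the other times, then
`Var (∑ u_j B_{s_j}) ≥ ∑ δ_j ^ (2H) u_j ^ 2 / 4`. Up to a constant the covariance is a mixture of
those of Ornstein-Uhlenbeck processes, to which `ornsteinUhlenbeck_lower_bound` applies; the time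
`0` is added with the weight that makes the weights sum to zero. -/
lemma fbmVar_lower_bound {ι : Type*} [Fintype ι] {H : ℝ} (hH0 : 0 < H) (hH1 : 2 * H < 1)
    (s u δ : ι → ℝ) (hs : ∀ j, 0 ≤ s j) (hδ0 : ∀ j, 0 ≤ δ j) (hδs : ∀ j, δ j ≤ s j)
    (hδ : ∀ j k, j ≠ k → δ j ≤ |s j - s k|) :
    ∑ j, δ j ^ (2 * H) / 4 * u j ^ 2 ≤ fbmVar H s u := by
  set s' : Option ι → ℝ := fun o => o.elim 0 s with hs'
  set u' : Option ι → ℝ := fun o => o.elim (-∑ j, u j) u with hu'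
  set δ' : Option ι → ℝ := fun o => o.elim 0 δ with hδ'
  set c := ∫ l in Ioi (0 : ℝ), (1 - Real.exp (-l * 1)) * l ^ (-1 - 2 * H) with hc
  have hcpos : 0 < c := integral_one_sub_exp_mul_rpow_pos hH0 hH1
  have hu0 : ∑ j, u' j = 0 := by simp [hu', Fintype.sum_option]
  have hδ'0 : ∀ j, 0 ≤ δ' j := by rintro (_ | j); exacts [le_rfl, hδ0 j]
  have hδ'1 : ∀ j k, j ≠ k → δ' j ≤ |s' j - s' k| := by
    rintro (_ | j) (_ | k) hjk
    · exact absurd rfl hjk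
    · exact abs_nonneg _
    · simpa [hs', hδ', abs_of_nonneg (hs j)] using hδs j
    · exact hδ j k fun h => hjk (by rw [h])
  have hI : ∀ x : ℝ, 0 ≤ x →
      IntegrableOn (fun l : ℝ => (1 - Real.exp (-l * x)) * l ^ (-1 - 2 * H)) (Ioi 0) :=
    fun x hx => integrableOn_one_sub_exp_mul_rpow hH0 hH1 hx
  have hmain : ∫ l in Ioi (0 : ℝ), ∑ j, (u' j ^ 2 / 2) *
        ((1 - Real.exp (-l * δ' j)) * l ^ (-1 - 2 * H)) ≤
      ∫ l in Ioi (0 : ℝ), ∑ j, ∑ k, (-(u' j * u' k)) *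
        ((1 - Real.exp (-l * |s' j - s' k|)) * l ^ (-1 - 2 * H)) := by
    refine setIntegral_mono_on
      (integrable_finsetSum _ fun j _ => (hI _ (hδ'0 j)).const_mul _)
      (integrable_finsetSum _ fun j _ => integrable_finsetSum _ fun k _ =>
        (hI _ (abs_nonneg _)).const_mul _) measurableSet_Ioi fun l hl => ?_
    have h := ornsteinUhlenbeck_lower_bound hl s' u' δ' hδ'0 hδ'1
    have h0 : ∑ j, ∑ k, u' j * u' k = 0 := by
      rw [← Finset.sum_mul_sum, hu0, zero_mul]
    have hr : ∑ j, ∑ k, (-(u' j * u' k)) *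
        ((1 - Real.exp (-l * |s' j - s' k|)) * l ^ (-1 - 2 * H)) =
        (∑ j, ∑ k, u' j * u' k * Real.exp (-l * |s' j - s' k|)) * l ^ (-1 - 2 * H) -
        (∑ j, ∑ k, u' j * u' k) * l ^ (-1 - 2 * H) := by
      simp only [Finset.sum_mul, ← Finset.sum_sub_distrib]
      exact Finset.sum_congr rfl fun j _ => Finset.sum_congr rfl fun k _ => by ring
    rw [hr, h0, zero_mul, sub_zero]
    refine le_trans (le_of_eq ?_) (mul_le_mul_of_nonneg_right h
      (Real.rpow_nonneg (le_of_lt hl) _))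
    rw [Finset.mul_sum, Finset.sum_mul]
    exact Finset.sum_congr rfl fun j _ => by ring
  rw [integral_finsetSum _ fun j _ => (hI _ (hδ'0 j)).const_mul _,
    integral_finsetSum _ fun j _ => integrable_finsetSum _ fun k _ =>
      (hI _ (abs_nonneg _)).const_mul _] at hmain
  simp only [integral_finsetSum _ fun k _ => (hI _ (abs_nonneg _)).const_mul _,
    integral_const_mul, integral_one_sub_exp_mul_rpow hH0 (hδ'0 _),
    integral_one_sub_exp_mul_rpow hH0 (abs_nonneg _), ← hc] at hmain
  have hL : ∑ j, u' j ^ 2 / 2 * (δ' j ^ (2 * H) * c) =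
      2 * c * ∑ j, δ j ^ (2 * H) / 4 * u j ^ 2 := by
    rw [Fintype.sum_option, Finset.mul_sum]
    simp only [hu', hδ', Option.elim, Real.zero_rpow (show 2 * H ≠ 0 by positivity)]
    rw [zero_mul, mul_zero, zero_add]
    exact Finset.sum_congr rfl fun j _ => by ring
  have hz : (0 : ℝ) ^ (2 * H) = 0 := Real.zero_rpow (by positivity)
  have hR : ∑ j, ∑ k, -(u' j * u' k) * (|s' j - s' k| ^ (2 * H) * c) =
      2 * c * fbmVar H s u := by
    simp only [Fintype.sum_option, fbmVar, fbmCov, hu', hs', Option.elim, abs_zero, hz,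
      zero_sub, sub_zero, abs_neg, abs_of_nonneg (hs _), Finset.sum_add_distrib]
    have e1 : ∑ k, -(-(∑ j, u j) * u k) * (s k ^ (2 * H) * c) =
        c * ∑ j, ∑ k, u j * u k * s k ^ (2 * H) := by
      rw [Finset.sum_comm, Finset.mul_sum]
      refine Finset.sum_congr rfl fun k _ => ?_
      rw [← Finset.sum_mul, ← Finset.sum_mul]; ring
    have e2 : ∑ k, -(u k * -(∑ j, u j)) * (s k ^ (2 * H) * c) =
        c * ∑ j, ∑ k, u j * u k * s j ^ (2 * H) := by
      rw [Finset.mul_sum]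
      refine Finset.sum_congr rfl fun k _ => ?_
      rw [← Finset.sum_mul, ← Finset.mul_sum]; ring
    rw [e1, e2, zero_mul, mul_zero, zero_add]
    simp only [Finset.mul_sum, ← Finset.sum_add_distrib]
    exact Finset.sum_congr rfl fun j _ => Finset.sum_congr rfl fun k _ => by ring
  rw [hL, hR] at hmain
  exact le_of_mul_le_mul_left hmain (by positivity)

/-! ### Integrals of powers of gaps between times -/

/-- The distance of the time `s j` to `0` and to the other times. -/
noncomputable def timeGap {ι : Type*} [Fintype ι] [DecidableEq ι] (s : ι → ℝ) (j : ι) : ℝ :=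
  Finset.univ.inf' ⟨j, Finset.mem_univ j⟩ fun k => if k = j then s j else |s j - s k|

section timeGap

variable {ι : Type*} [Fintype ι] [DecidableEq ι]

lemma timeGap_le_self (s : ι → ℝ) (j : ι) : timeGap s j ≤ s j :=
  (Finset.inf'_le _ (Finset.mem_univ j)).trans (by simp)

lemma timeGap_le_abs_sub (s : ι → ℝ) {j k : ι} (h : j ≠ k) : timeGap s j ≤ |s j - s k| :=
  (Finset.inf'_le _ (Finset.mem_univ k)).trans (by simp [h.symm])

lemma le_timeGap {s : ι → ℝ} {j : ι} {c : ℝ} (h0 : c ≤ s j)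
    (h : ∀ k, k ≠ j → c ≤ |s j - s k|) : c ≤ timeGap s j := by
  refine Finset.le_inf' _ _ fun k _ => ?_
  by_cases hk : k = j
  · simpa [hk] using h0
  · simpa [hk] using h k hk

lemma timeGap_nonneg {s : ι → ℝ} (hs : ∀ j, 0 ≤ s j) (j : ι) : 0 ≤ timeGap s j :=
  le_timeGap (hs j) fun _ _ => abs_nonneg _

lemma timeGap_pos {s : ι → ℝ} (hs : ∀ j, 0 < s j) (hinj : Function.Injective s) (j : ι) :
    0 < timeGap s j := by
  refine (Finset.lt_inf'_iff _).2 fun k _ => ?_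
  by_cases hk : k = j
  · simpa [hk] using hs j
  · simpa [hk, sub_eq_zero] using fun h => hk (hinj h).symm

end timeGap

/-- Integrating out the last of finitely many successive times first, each gap contributes the
same factor. -/
lemma lintegral_prod_gaps {f : ℝ → ENNReal} (hf : Measurable f) (n : ℕ) (c : ℝ) :
    ∫⁻ x : Fin n → ℝ, ∏ k : Fin n, f (x k - (Fin.cons c x : Fin (n + 1) → ℝ) k.castSucc) =
      (∫⁻ z, f z) ^ n := by
  induction n generalizing c with
  | zero => simp [volume_pi]
  | succ n ih =>
    have hm : ∀ m : ℕ, Measurable fun p : ℝ × (Fin m → ℝ) =>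
        ∏ k : Fin m, f (p.2 k - (Fin.cons p.1 p.2 : Fin (m + 1) → ℝ) k.castSucc) := by
      intro m
      refine Finset.measurable_prod _ fun k _ => hf.comp (Measurable.sub (by fun_prop) ?_)
      induction k.castSucc using Fin.cases with
      | zero => simpa using measurable_fst
      | succ i => simp only [Fin.cons_succ]; fun_prop
    have e := (volume_preserving_piFinSuccAbove (fun _ : Fin (n + 1) => ℝ) 0).symm
    rw [← e.lintegral_comp_emb (MeasurableEquiv.measurableEmbedding _)]
    simp only [MeasurableEquiv.piFinSuccAbove_symm_apply, Fin.insertNthEquiv_zero,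
      Fin.consEquiv_apply, Fin.prod_univ_succ, Fin.cons_zero, Fin.cons_succ, Fin.castSucc_zero,
      ← Fin.succ_castSucc]
    rw [Measure.volume_eq_prod, lintegral_prod _ (by
      refine Measurable.aemeasurable ?_
      exact (hf.comp (measurable_fst.sub_const c)).mul (hm n))]
    have h1 : ∀ x : ℝ, ∫⁻ y : Fin n → ℝ, f (x - c) *
        ∏ k : Fin n, f (y k - (Fin.cons x y : Fin (n + 1) → ℝ) k.castSucc) =
        f (x - c) * (∫⁻ z, f z) ^ n := by
      intro x
      have h2 : Measurable fun y : Fin n → ℝ =>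
          ∏ k : Fin n, f (y k - (Fin.cons x y : Fin (n + 1) → ℝ) k.castSucc) :=
        (hm n).comp (measurable_const.prodMk measurable_id)
      rw [lintegral_const_mul _ h2, ih x]
    rw [lintegral_congr h1, lintegral_mul_const _ (by fun_prop),
      lintegral_sub_right_eq_self f c, pow_succ']

/-- The bound on the product of the powers of the gaps between ordered times, by a function whose
integral is a product. The successive gaps `g_k` sum to at most `T`, so that
`exp (l T) ∏ exp (-l g_k)` is at least one; this factor allows for the integration of each gap over
all of `(0, ∞)`. -/
lemma prod_timeGap_rpow_le {n : ℕ} {a l T : ℝ} (ha : 0 ≤ a) (hl : 0 < l) {x : Fin n → ℝ}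
    (hpos : ∀ k, 0 < x k) (hmono : StrictMono x) (hT : ∀ k, x k ≤ T) (hT0 : 0 ≤ T) :
    ∏ k, timeGap x k ^ (-a) ≤ Real.exp (l * T) * l ^ (a * n) *
      ∏ k : Fin n, ((1 + (l * (x k - (Fin.cons 0 x : Fin (n + 1) → ℝ) k.castSucc)) ^ (-a)) ^ 2 *
        Real.exp (-(l * (x k - (Fin.cons 0 x : Fin (n + 1) → ℝ) k.castSucc)))) := by
  set v : Fin (n + 1) → ℝ := Fin.cons 0 x with hv
  have hvs : ∀ k : Fin n, v k.succ = x k := fun k => by simp [hv]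
  have hv0 : v 0 = 0 := by simp [hv]
  have hvm : StrictMono v := by
    rw [Fin.strictMono_iff_lt_succ]
    intro i
    rw [hvs]
    rcases Fin.eq_zero_or_eq_succ (n := n) i.castSucc with h | ⟨j, hj⟩
    · rw [h, hv0]; exact hpos i
    · rw [hj, hvs]
      apply hmono
      have := congrArg Fin.val hj
      simp at this
      exact Fin.lt_def.2 (by omega)
  set g : Fin n → ℝ := fun k => x k - v k.castSucc with hg
  have hgpos : ∀ k, 0 < g k := fun k => by
    have := hvm (Fin.castSucc_lt_succ (i := k)); rw [hvs] at this; simp only [hg]; linarith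
  set A : Fin n → ℝ := fun k => 1 + (l * g k) ^ (-a) with hA
  have hA1 : ∀ k, 1 ≤ A k := fun k => by
    have := Real.rpow_nonneg (mul_pos hl (hgpos k)).le (-a); simp only [hA]; linarith
  set G : Fin (n + 1) → ℝ := Fin.snoc (α := fun _ => ℝ) A 1 with hG
  have hGc : ∀ k : Fin n, G k.castSucc = A k := fun k => by simp [hG]
  have hGl : G (Fin.last n) = 1 := by simp [hG]
  have hG1 : ∀ k, 1 ≤ G k := by
    intro k
    induction k using Fin.lastCases with
    | last => rw [hGl]
    | cast k => rw [hGc]; exact hA1 k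
  have hpow : ∀ k, g k ^ (-a) = l ^ a * (l * g k) ^ (-a) := fun k => by
    rw [Real.mul_rpow hl.le (hgpos k).le, ← mul_assoc, ← Real.rpow_add hl]; simp
  have hla : 0 ≤ l ^ a := Real.rpow_nonneg hl.le _
  -- a gap to the nearest time is one of the two neighbouring gaps
  have hstep : ∀ k : Fin n, timeGap x k ^ (-a) ≤ l ^ a * (G k.castSucc * G k.succ) := by
    intro k
    have hleft : ∀ j : Fin n, j < k → g k ≤ |x k - x j| := fun j hj => by
      have : v j.succ ≤ v k.castSucc := hvm.monotone (Fin.le_def.2 (by simpa using hj))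
      rw [hvs] at this
      exact le_trans (by simp only [hg]; linarith) (le_abs_self _)
    have hzero : g k ≤ x k := by
      have : v 0 ≤ v k.castSucc := hvm.monotone (Fin.zero_le _)
      simp only [hg]; linarith
    have hbound : ∀ m : ℝ, 0 < m → m ≤ timeGap x k → timeGap x k ^ (-a) ≤ m ^ (-a) :=
      fun m hm h => Real.rpow_le_rpow_of_nonpos hm h (by linarith)
    have hAk : g k ^ (-a) ≤ l ^ a * A k := by
      rw [hpow]; exact mul_le_mul_of_nonneg_left (by simp [hA]) hla
    by_cases hk : k.succ = Fin.last n
    · rw [hk, hGl, mul_one, hGc]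
      refine (hbound (g k) (hgpos k) (le_timeGap hzero fun j hj => hleft j ?_)).trans hAk
      have := congrArg Fin.val hk
      simp at this
      exact lt_of_le_of_ne (Fin.le_def.2 (by omega)) hj
    · obtain ⟨k', hk'⟩ := Fin.exists_castSucc_eq.2 hk
      have hk'v : (k' : ℕ) = k + 1 := by simpa using congrArg Fin.val hk'
      have hright : ∀ j : Fin n, k < j → g k' ≤ |x k - x j| := fun j hj => by
        have h1 : x k' ≤ x j := hmono.monotone (Fin.le_def.2 (by
          have := Fin.lt_def.1 hj; omega))
        have h2 : v k'.castSucc = x k := by rw [hk', hvs]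
        rw [abs_sub_comm]
        exact le_trans (by simp only [hg]; linarith) (le_abs_self _)
      have hmin : min (g k) (g k') ≤ timeGap x k := by
        refine le_timeGap ((min_le_left _ _).trans hzero) fun j hj => ?_
        rcases lt_or_gt_of_ne hj with h | h
        · exact (min_le_left _ _).trans (hleft j h)
        · exact (min_le_right _ _).trans (hright j h)
      rw [hGc, ← hk', hGc]
      rcases min_cases (g k) (g k') with ⟨h, _⟩ | ⟨h, _⟩ <;> rw [h] at hmin
      · refine (hbound _ (hgpos k) hmin).trans (hAk.trans ?_)
        exact mul_le_mul_of_nonneg_left (le_mul_of_one_le_right (by linarith [hA1 k]) (hA1 k')) hla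
      · refine (hbound _ (hgpos k') hmin).trans ?_
        rw [hpow]
        refine mul_le_mul_of_nonneg_left (le_trans (b := A k') (by simp [hA]) ?_) hla
        exact le_mul_of_one_le_left (by linarith [hA1 k']) (hA1 k)
  have hprodG : ∏ k : Fin n, G k.succ ≤ ∏ k, A k := by
    have h1 : ∏ k, G k = ∏ k, A k := by simp [Fin.prod_univ_castSucc, hGc, hGl]
    rw [← h1, Fin.prod_univ_succ]
    exact le_mul_of_one_le_left (Finset.prod_nonneg fun k _ => by linarith [hG1 k.succ]) (hG1 0)
  have htel : ∑ k, g k = v (Fin.last n) := by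
    have h1 := Fin.sum_univ_succ v
    rw [Fin.sum_univ_castSucc, hv0] at h1
    simp only [hg, Finset.sum_sub_distrib, ← hvs]
    linarith
  have hlast : v (Fin.last n) ≤ T := by
    rcases Fin.eq_zero_or_eq_succ (Fin.last n) with h | ⟨j, hj⟩
    · rw [h, hv0]; exact hT0
    · rw [hj, hvs]; exact hT j
  calc ∏ k, timeGap x k ^ (-a) ≤ ∏ k : Fin n, l ^ a * (G k.castSucc * G k.succ) :=
        Finset.prod_le_prod (fun k _ => Real.rpow_nonneg
          (timeGap_nonneg (fun j => (hpos j).le) k) _) fun k _ => hstep k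
    _ = l ^ (a * n) * ((∏ k, A k) * ∏ k : Fin n, G k.succ) := by
        rw [Finset.prod_mul_distrib, Finset.prod_mul_distrib, Finset.prod_const,
          Finset.card_univ, Fintype.card_fin, Real.rpow_mul hl.le, Real.rpow_natCast]
        simp only [hGc]
    _ ≤ l ^ (a * n) * ((∏ k, A k) * ∏ k, A k) := by
        have : 0 ≤ ∏ k, A k := Finset.prod_nonneg fun k _ => by linarith [hA1 k]
        gcongr
    _ = 1 * (l ^ (a * n) * ∏ k, A k ^ 2) := by
        rw [one_mul, Finset.prod_pow, sq]
    _ ≤ (Real.exp (l * T) * ∏ k, Real.exp (-(l * g k))) * (l ^ (a * n) * ∏ k, A k ^ 2) := by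
        refine mul_le_mul_of_nonneg_right ?_ (mul_nonneg (Real.rpow_nonneg hl.le _)
          (Finset.prod_nonneg fun k _ => sq_nonneg _))
        rw [← Real.exp_sum, ← Real.exp_add, Finset.sum_neg_distrib, ← Finset.mul_sum, htel]
        exact Real.one_le_exp (by nlinarith)
    _ = _ := by
        rw [Finset.prod_mul_distrib]; ring

lemma exists_equiv_strictMono {ι : Type*} [Fintype ι] {n : ℕ} (hn : Fintype.card ι = n)
    {s : ι → ℝ} (hs : Function.Injective s) : ∃ σ : Fin n ≃ ι, StrictMono (s ∘ σ) := by
  let e : Fin n ≃ ι := (Fintype.equivFinOfCardEq hn).symm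
  refine ⟨(Tuple.sort (s ∘ e)).trans e, ?_⟩
  have h := Tuple.monotone_sort (s ∘ e)
  refine h.strictMono_of_injective ?_
  exact (hs.comp e.injective).comp (Equiv.injective _)

lemma ae_injective {ι : Type*} [Fintype ι] :
    ∀ᵐ s : ι → ℝ, Function.Injective s := by
  classical
  have h : ∀ i j : ι, i ≠ j → ∀ᵐ s : ι → ℝ, s i ≠ s j := by
    intro i j hij
    let p : Submodule ℝ (ι → ℝ) := LinearMap.ker
      ((LinearMap.proj i : (ι → ℝ) →ₗ[ℝ] ℝ) - LinearMap.proj j)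
    have hp : p ≠ ⊤ := by
      intro h
      have : Pi.single i (1 : ℝ) ∈ p := by rw [h]; trivial
      simp [p, hij.symm] at this
    have := Measure.addHaar_submodule volume p hp
    refine measure_mono_null (fun s hs => ?_) this
    simpa [p, sub_eq_zero] using hs
  have h' : ∀ᵐ s : ι → ℝ, ∀ i j : ι, i ≠ j → s i ≠ s j := by
    simp only [ae_all_iff]; exact h
  filter_upwards [h'] with s hs i j hij
  by_contra hne
  exact hs i j hne hij

lemma timeGap_comp_equiv {ι κ : Type*} [Fintype ι] [DecidableEq ι] [Fintype κ] [DecidableEq κ]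
    (s : ι → ℝ) (σ : κ ≃ ι) (k : κ) : timeGap (s ∘ σ) k = timeGap s (σ k) := by
  refine le_antisymm (le_timeGap (timeGap_le_self (s ∘ σ) k) fun j hj => ?_)
    (le_timeGap (timeGap_le_self s (σ k)) fun j hj =>
      timeGap_le_abs_sub s fun h => hj (σ.injective h).symm)
  have := timeGap_le_abs_sub (s ∘ σ) (j := k) (k := σ.symm j)
    fun h => hj (by rw [h, Equiv.apply_symm_apply])
  simpa using this

lemma integrableOn_one_add_rpow_sq_mul_exp {a : ℝ} (ha1 : 2 * a < 1) :
    IntegrableOn (fun z : ℝ => (1 + z ^ (-a)) ^ 2 * Real.exp (-z)) (Ioi 0) := by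
  have h := ((Real.GammaIntegral_convergent one_pos).add
    ((Real.GammaIntegral_convergent (s := 1 - a) (by linarith)).const_mul 2)).add
    (Real.GammaIntegral_convergent (s := 1 - 2 * a) (by linarith))
  refine h.congr_fun (fun z (hz : 0 < z) => ?_) measurableSet_Ioi
  simp only [Pi.add_apply, sub_self, Real.rpow_zero]
  rw [show 1 - a - 1 = -a by ring, show 1 - 2 * a - 1 = -a + -a by ring, Real.rpow_add hz]
  ring

/-- The integral of the product of the powers `-a` of the gaps, over all families of times in
`(0, T]`. The parameter `l` is free and is to be chosen of the order of the number of times. -/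
lemma exists_lintegral_prod_timeGap_le {a : ℝ} (ha : 0 ≤ a) (ha1 : 2 * a < 1) :
    ∃ C : ℝ, 0 < C ∧ ∀ (ι : Type) [Fintype ι] [DecidableEq ι] (n : ℕ), Fintype.card ι = n →
      ∀ (T l : ℝ), 0 ≤ T → 0 < l →
      ∫⁻ s in Set.pi univ fun _ : ι => Ioc 0 T, ENNReal.ofReal (∏ j, timeGap s j ^ (-a)) ≤
        ENNReal.ofReal (n.factorial * (Real.exp (l * T) * l ^ (a * n) * (C / l) ^ n)) := by
  set C := ∫ z in Ioi (0 : ℝ), (1 + z ^ (-a)) ^ 2 * Real.exp (-z) with hC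
  have hCpos : 0 < C := by
    have hpos : ∀ z ∈ Ioi (0 : ℝ), 0 < (1 + z ^ (-a)) ^ 2 * Real.exp (-z) := fun z hz => by
      have := Real.rpow_nonneg (le_of_lt (mem_Ioi.1 hz)) (-a)
      positivity
    rw [hC, setIntegral_pos_iff_support_of_nonneg_ae
      ((ae_restrict_mem measurableSet_Ioi).mono fun l hl => (hpos l hl).le)
      (integrableOn_one_add_rpow_sq_mul_exp ha1),
      inter_eq_right.2 (show Ioi (0 : ℝ) ⊆ Function.support _ from fun l hl => (hpos l hl).ne')]
    simp
  refine ⟨C, hCpos, fun ι _ _ n hn T l hT hl => ?_⟩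
  set φ : ℝ → ℝ := fun z => (1 + (l * z) ^ (-a)) ^ 2 * Real.exp (-(l * z)) with hφ
  have hφ0 : ∀ z, 0 ≤ φ z := fun z => by simp only [hφ]; positivity
  set f : ℝ → ENNReal := (Ioi 0).indicator fun z => ENNReal.ofReal (φ z) with hf
  have hfm : Measurable f := by
    refine Measurable.indicator ?_ measurableSet_Ioi
    simp only [hφ]; fun_prop
  have hfint : ∫⁻ z, f z = ENNReal.ofReal (C / l) := by
    rw [hf, lintegral_indicator measurableSet_Ioi]
    have h1 : IntegrableOn φ (Ioi 0) := by
      have := (integrableOn_Ioi_comp_mul_left_iff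
        (fun z : ℝ => (1 + z ^ (-a)) ^ 2 * Real.exp (-z)) 0 hl).2
        (by simpa using integrableOn_one_add_rpow_sq_mul_exp ha1)
      exact this
    rw [← ofReal_integral_eq_lintegral_ofReal h1 (Eventually.of_forall hφ0)]
    congr 1
    have := integral_comp_mul_left_Ioi
      (fun z : ℝ => (1 + z ^ (-a)) ^ 2 * Real.exp (-z)) 0 hl
    simp only [mul_zero, smul_eq_mul] at this
    rw [hC, div_eq_inv_mul, ← this]
  set K := Real.exp (l * T) * l ^ (a * n) with hK
  have hK0 : 0 ≤ K := by simp only [hK]; positivity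
  set Φ : (Fin n → ℝ) → ENNReal := fun x =>
    ∏ k : Fin n, f (x k - (Fin.cons 0 x : Fin (n + 1) → ℝ) k.castSucc) with hΦ
  have hΦm : Measurable Φ := by
    refine Finset.measurable_prod _ fun k _ => hfm.comp (Measurable.sub (by fun_prop) ?_)
    induction k.castSucc using Fin.cases with
    | zero => simp
    | succ i => simp only [Fin.cons_succ]; fun_prop
  have hpt : ∀ᵐ s : ι → ℝ, s ∈ (Set.pi univ fun _ : ι => Ioc 0 T) →
      ENNReal.ofReal (∏ j, timeGap s j ^ (-a)) ≤
        ∑ σ : Fin n ≃ ι, ENNReal.ofReal K * Φ (s ∘ σ) := by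
    filter_upwards [ae_injective] with s hinj hs
    obtain ⟨σ, hσ⟩ := exists_equiv_strictMono hn hinj
    refine le_trans ?_ (Finset.single_le_sum (f := fun σ : Fin n ≃ ι =>
      ENNReal.ofReal K * Φ (s ∘ σ)) (fun _ _ => bot_le) (Finset.mem_univ σ))
    have hpos : ∀ k, 0 < (s ∘ σ) k := fun k => (hs (σ k) trivial).1
    have h1 := prod_timeGap_rpow_le ha hl hpos hσ (fun k => (hs (σ k) trivial).2) hT
    have h2 : ∏ j, timeGap s j ^ (-a) = ∏ k, timeGap (s ∘ σ) k ^ (-a) := by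
      simp only [timeGap_comp_equiv]
      exact (Equiv.prod_comp σ fun j => timeGap s j ^ (-a)).symm
    rw [h2]
    refine (ENNReal.ofReal_le_ofReal h1).trans (le_of_eq ?_)
    rw [← hK, ENNReal.ofReal_mul hK0, ENNReal.ofReal_prod_of_nonneg fun k _ => hφ0 _]
    congr 1
    refine Finset.prod_congr rfl fun k _ => ?_
    have : 0 < (s ∘ σ) k - (Fin.cons 0 (s ∘ σ) : Fin (n + 1) → ℝ) k.castSucc := by
      rcases Fin.eq_zero_or_eq_succ k.castSucc with h | ⟨j, hj⟩
      · rw [h, Fin.cons_zero, sub_zero]; exact hpos k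
      · rw [hj, Fin.cons_succ, sub_pos]
        apply hσ
        have := congrArg Fin.val hj
        simp at this
        exact Fin.lt_def.2 (by omega)
    simp only [hf]
    rw [indicator_of_mem (mem_Ioi.2 this)]
  have hperm : ∀ σ : Fin n ≃ ι, ∫⁻ s : ι → ℝ, Φ (s ∘ σ) = ENNReal.ofReal (C / l) ^ n := by
    intro σ
    have h1 := (volume_measurePreserving_piCongrLeft (fun _ : ι => ℝ) σ).symm
    have h2 := h1.lintegral_comp_emb (MeasurableEquiv.measurableEmbedding _) Φ
    rw [← hfint, ← lintegral_prod_gaps hfm n 0, ← h2]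
    rfl
  calc ∫⁻ s in Set.pi univ fun _ : ι => Ioc 0 T, ENNReal.ofReal (∏ j, timeGap s j ^ (-a))
      ≤ ∫⁻ s in Set.pi univ fun _ : ι => Ioc 0 T,
          ∑ σ : Fin n ≃ ι, ENNReal.ofReal K * Φ (s ∘ σ) :=
        setLIntegral_mono_ae' (MeasurableSet.univ_pi fun _ => measurableSet_Ioc) hpt
    _ ≤ ∫⁻ s, ∑ σ : Fin n ≃ ι, ENNReal.ofReal K * Φ (s ∘ σ) := setLIntegral_le_lintegral _ _
    _ = ∑ σ : Fin n ≃ ι, ENNReal.ofReal K * ENNReal.ofReal (C / l) ^ n := by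
        have hm : ∀ σ : Fin n ≃ ι, Measurable fun s : ι → ℝ => Φ (s ∘ σ) :=
          fun σ => hΦm.comp (measurable_pi_lambda _ fun k => measurable_pi_apply _)
        rw [lintegral_finsetSum _ fun σ _ => (hm σ).const_mul _]
        refine Finset.sum_congr rfl fun σ _ => ?_
        rw [lintegral_const_mul _ (hm σ), hperm σ]
    _ = _ := by
        rw [Finset.sum_const, Finset.card_univ, Fintype.card_equiv
          (Fintype.equivFinOfCardEq hn).symm, Fintype.card_fin, nsmul_eq_mul,
          ENNReal.ofReal_mul (p := (n.factorial : ℝ)) (by positivity),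
          ENNReal.ofReal_mul (p := K) hK0, ENNReal.ofReal_pow (by positivity),
          ENNReal.ofReal_natCast]

/-! ### The derivative of the Gaussian density -/

/-- Minus the derivative of the density of the centered Gaussian law of variance `v`. -/
noncomputable def gaussDeriv (v x : ℝ) : ℝ :=
  x / v * ((√(2 * Real.pi * v))⁻¹ * Real.exp (-(x ^ 2 / (2 * v))))

@[fun_prop]
lemma continuous_gaussDeriv (v : ℝ) : Continuous (gaussDeriv v) := by
  unfold gaussDeriv; fun_prop

lemma gaussDeriv_sq {v : ℝ} (hv : 0 < v) (x : ℝ) :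
    gaussDeriv v x ^ 2 = x ^ 2 / v ^ 2 * ((2 * Real.pi * v)⁻¹ * Real.exp (-(x ^ 2 / v))) := by
  have h : 0 ≤ 2 * Real.pi * v := by positivity
  rw [gaussDeriv, mul_pow, mul_pow, div_pow, inv_pow, Real.sq_sqrt h, ← Real.exp_nat_mul]
  congr 3
  push_cast
  field_simp

lemma mul_exp_neg_le_one (x : ℝ) : x * Real.exp (-x) ≤ 1 := by
  rw [Real.exp_neg, ← div_eq_mul_inv, div_le_one (Real.exp_pos x)]
  linarith [Real.add_one_le_exp x]

lemma gaussDeriv_sq_le {v : ℝ} (hv : 0 < v) (x : ℝ) :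
    gaussDeriv v x ^ 2 ≤ (Real.pi * v ^ 2)⁻¹ * Real.exp (-(2 * v)⁻¹ * x ^ 2) := by
  have h1 := mul_exp_neg_le_one (x ^ 2 / (2 * v))
  have h2 : Real.exp (-(x ^ 2 / v)) =
      Real.exp (-(x ^ 2 / (2 * v))) * Real.exp (-(2 * v)⁻¹ * x ^ 2) := by
    rw [← Real.exp_add]; congr 1; field_simp; ring
  rw [gaussDeriv_sq hv, h2]
  calc x ^ 2 / v ^ 2 * ((2 * Real.pi * v)⁻¹ *
        (Real.exp (-(x ^ 2 / (2 * v))) * Real.exp (-(2 * v)⁻¹ * x ^ 2)))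
      = (Real.pi * v ^ 2)⁻¹ * Real.exp (-(2 * v)⁻¹ * x ^ 2) *
        (x ^ 2 / (2 * v) * Real.exp (-(x ^ 2 / (2 * v)))) := by field_simp
    _ ≤ _ := mul_le_of_le_one_right (by positivity) h1

lemma abs_gaussDeriv_le {v : ℝ} (hv : 0 < v) (x : ℝ) : |gaussDeriv v x| ≤ v⁻¹ := by
  rw [← abs_of_pos (inv_pos.2 hv), ← sq_le_sq]
  refine (gaussDeriv_sq_le hv x).trans ?_
  have h1 : Real.exp (-(2 * v)⁻¹ * x ^ 2) ≤ 1 := by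
    rw [Real.exp_le_one_iff, neg_mul, neg_nonpos]; positivity
  have h2 : (Real.pi * v ^ 2)⁻¹ ≤ (v⁻¹) ^ 2 := by
    rw [inv_pow]
    refine inv_anti₀ (by positivity) (le_mul_of_one_le_left (by positivity) ?_)
    linarith [Real.pi_gt_three]
  exact (mul_le_of_le_one_right (by positivity) h1).trans h2

lemma sq_mul_gaussDeriv_sq_le {v : ℝ} (hv : 0 < v) (x : ℝ) :
    x ^ 2 * gaussDeriv v x ^ 2 ≤ 8 / (Real.pi * v) * Real.exp (-(2 * v)⁻¹ * x ^ 2) := by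
  have h1 := mul_exp_neg_le_one (x ^ 2 / (4 * v))
  have h0 : 0 ≤ x ^ 2 / (4 * v) * Real.exp (-(x ^ 2 / (4 * v))) := by positivity
  have h2 : Real.exp (-(x ^ 2 / v)) =
      Real.exp (-(x ^ 2 / (4 * v))) ^ 2 * Real.exp (-(2 * v)⁻¹ * x ^ 2) := by
    rw [← Real.exp_nat_mul, ← Real.exp_add]; congr 1; push_cast; field_simp; ring
  rw [gaussDeriv_sq hv, h2]
  calc x ^ 2 * (x ^ 2 / v ^ 2 * ((2 * Real.pi * v)⁻¹ *
        (Real.exp (-(x ^ 2 / (4 * v))) ^ 2 * Real.exp (-(2 * v)⁻¹ * x ^ 2))))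
      = 8 / (Real.pi * v) * Real.exp (-(2 * v)⁻¹ * x ^ 2) *
        (x ^ 2 / (4 * v) * Real.exp (-(x ^ 2 / (4 * v)))) ^ 2 := by field_simp; ring
    _ ≤ _ := mul_le_of_le_one_right (by positivity) (pow_le_one₀ h0 h1)

/-- Weighted `L²` norm of the derivative of the Gaussian density, with its order in `v`. -/
lemma lintegral_weight_mul_gaussDeriv_sq_le {v V : ℝ} (hv : 0 < v) (hV : v ≤ V) (x : ℝ) :
    ∫⁻ y : ℝ, ENNReal.ofReal ((1 + y ^ 2) * gaussDeriv v (x - y) ^ 2) ≤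
      ENNReal.ofReal ((√(2 + 16 * V) * ((1 + |x|) * v ^ (-(3 / 4 : ℝ)))) ^ 2) := by
  have hVp : 0 < V := hv.trans_le hV
  set c := (1 + |x|) ^ 2 * (2 + 16 * V) * (Real.pi * v ^ 2)⁻¹ with hc
  have hc0 : 0 ≤ c := by simp only [hc]; positivity
  have hb : 0 < (2 * v)⁻¹ := by positivity
  have hpt : ∀ y : ℝ, (1 + y ^ 2) * gaussDeriv v (x - y) ^ 2 ≤
      c * Real.exp (-(2 * v)⁻¹ * (x - y) ^ 2) := by
    intro y
    have h1 := gaussDeriv_sq_le hv (x - y)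
    have h2 := sq_mul_gaussDeriv_sq_le hv (x - y)
    set E := Real.exp (-(2 * v)⁻¹ * (x - y) ^ 2)
    have hE : 0 ≤ E := (Real.exp_pos _).le
    have h3 : 1 + y ^ 2 ≤ 2 * (1 + |x|) ^ 2 + 2 * (x - y) ^ 2 := by
      have : x ^ 2 ≤ (1 + |x|) ^ 2 := by
        rw [← sq_abs x]; exact pow_le_pow_left₀ (abs_nonneg x) (by linarith) 2
      have : 1 ≤ (1 + |x|) ^ 2 := one_le_pow₀ (by linarith [abs_nonneg x])
      nlinarith [sq_nonneg (2 * x - y), sq_abs x, abs_nonneg x]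
    have h4 : 8 / (Real.pi * v) ≤ (1 + |x|) ^ 2 * (8 * V) * (Real.pi * v ^ 2)⁻¹ := by
      have h5 : 1 ≤ (1 + |x|) ^ 2 := one_le_pow₀ (by linarith [abs_nonneg x])
      have h6 : 8 / (Real.pi * v) = 8 * v * (Real.pi * v ^ 2)⁻¹ := by field_simp
      rw [h6]
      refine mul_le_mul_of_nonneg_right ?_ (by positivity)
      nlinarith
    calc (1 + y ^ 2) * gaussDeriv v (x - y) ^ 2
        ≤ (2 * (1 + |x|) ^ 2 + 2 * (x - y) ^ 2) * gaussDeriv v (x - y) ^ 2 :=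
          mul_le_mul_of_nonneg_right h3 (sq_nonneg _)
      _ = 2 * (1 + |x|) ^ 2 * gaussDeriv v (x - y) ^ 2 +
          2 * ((x - y) ^ 2 * gaussDeriv v (x - y) ^ 2) := by ring
      _ ≤ 2 * (1 + |x|) ^ 2 * ((Real.pi * v ^ 2)⁻¹ * E) +
          2 * (((1 + |x|) ^ 2 * (8 * V) * (Real.pi * v ^ 2)⁻¹) * E) := by
          exact add_le_add (mul_le_mul_of_nonneg_left h1 (by positivity))
            (mul_le_mul_of_nonneg_left (h2.trans (mul_le_mul_of_nonneg_right h4 hE)) zero_le_two)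
      _ = c * E := by simp only [hc]; ring
  have hint : Integrable fun y : ℝ => c * Real.exp (-(2 * v)⁻¹ * (x - y) ^ 2) :=
    ((integrable_exp_neg_mul_sq hb).comp_sub_left x).const_mul c
  refine (lintegral_mono fun y => ENNReal.ofReal_le_ofReal (hpt y)).trans ?_
  rw [← ofReal_integral_eq_lintegral_ofReal hint
    (Eventually.of_forall fun y => mul_nonneg hc0 (Real.exp_pos _).le)]
  refine ENNReal.ofReal_le_ofReal ?_
  rw [integral_const_mul, integral_sub_left_eq_self
    (fun z => Real.exp (-(2 * v)⁻¹ * z ^ 2)), integral_gaussian]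
  have h7 : Real.pi / (2 * v)⁻¹ = 2 * Real.pi * v := by field_simp
  rw [h7, mul_pow, mul_pow, Real.sq_sqrt (by positivity), hc]
  have h8 : (v ^ (-(3 / 4 : ℝ))) ^ 2 = √v * (v ^ 2)⁻¹ := by
    rw [← Real.rpow_natCast, ← Real.rpow_mul hv.le, Real.sqrt_eq_rpow, ← Real.rpow_natCast,
      ← Real.rpow_neg hv.le, ← Real.rpow_add hv]
    norm_num
  have h9 : √(2 * Real.pi) ≤ Real.pi := by
    rw [Real.sqrt_le_left Real.pi_pos.le]
    nlinarith [Real.pi_gt_three]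
  rw [h8, Real.sqrt_mul (by positivity), mul_inv]
  have h10 : Real.pi⁻¹ * √(2 * Real.pi) ≤ 1 := by
    rw [inv_mul_le_iff₀ Real.pi_pos]; linarith
  calc (1 + |x|) ^ 2 * (2 + 16 * V) * (Real.pi⁻¹ * (v ^ 2)⁻¹) * (√(2 * Real.pi) * √v)
      = ((2 + 16 * V) * ((1 + |x|) ^ 2 * (√v * (v ^ 2)⁻¹))) * (Real.pi⁻¹ * √(2 * Real.pi)) := by
        ring
    _ ≤ _ := mul_le_of_le_one_right (by positivity) h10

/-- The Cauchy-Schwarz inequality in the space variable, for the two factors in which it occurs. -/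
lemma lintegral_weight_mul_abs_gaussDeriv_mul_le {v v' V : ℝ} (hv : 0 < v) (hV : v ≤ V)
    (hv' : 0 < v') (hV' : v' ≤ V) (x x' : ℝ) :
    ∫⁻ y : ℝ, ENNReal.ofReal ((1 + y ^ 2) * (|gaussDeriv v (x - y)| * |gaussDeriv v' (x' - y)|)) ≤
      ENNReal.ofReal (√(2 + 16 * V) * ((1 + |x|) * v ^ (-(3 / 4 : ℝ)))) *
      ENNReal.ofReal (√(2 + 16 * V) * ((1 + |x'|) * v' ^ (-(3 / 4 : ℝ)))) := by
  have key : ∀ {w : ℝ}, 0 < w → w ≤ V → ∀ z : ℝ,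
      (∫⁻ y : ℝ, ENNReal.ofReal (√(1 + y ^ 2) * |gaussDeriv w (z - y)|) ^ (2 : ℝ)) ^ (1 / 2 : ℝ) ≤
        ENNReal.ofReal (√(2 + 16 * V) * ((1 + |z|) * w ^ (-(3 / 4 : ℝ)))) := by
    intro w hw hwV z
    have h := lintegral_weight_mul_gaussDeriv_sq_le hw hwV z
    rw [ENNReal.ofReal_pow (by positivity)] at h
    refine (ENNReal.rpow_le_rpow ((le_of_eq ?_).trans h) (by norm_num)).trans (le_of_eq ?_)
    · refine lintegral_congr fun y => ?_
      rw [ENNReal.ofReal_rpow_of_nonneg (by positivity) (by norm_num)]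
      congr 1
      rw [Real.rpow_two, mul_pow, Real.sq_sqrt (by positivity), sq_abs]
    · rw [← ENNReal.rpow_natCast, ← ENNReal.rpow_mul]; norm_num
  have hm : ∀ w z : ℝ, AEMeasurable
      (fun y : ℝ => ENNReal.ofReal (√(1 + y ^ 2) * |gaussDeriv w (z - y)|)) := fun w z => by
    refine Measurable.aemeasurable ?_
    have : Continuous fun y : ℝ => √(1 + y ^ 2) * |gaussDeriv w (z - y)| := by fun_prop
    exact this.measurable.ennreal_ofReal
  refine le_trans (le_of_eq ?_) ((ENNReal.lintegral_mul_le_Lp_mul_Lq volume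
    Real.HolderConjugate.two_two (hm v x) (hm v' x')).trans
      (mul_le_mul' (key hv hV x) (key hv' hV' x')))
  refine lintegral_congr fun y => ?_
  rw [Pi.mul_apply, ← ENNReal.ofReal_mul (by positivity)]
  congr 1
  have : √(1 + y ^ 2) * √(1 + y ^ 2) = 1 + y ^ 2 := Real.mul_self_sqrt (by positivity)
  linear_combination (-(|gaussDeriv v (x - y)| * |gaussDeriv v' (x' - y)|)) * this

lemma integrable_id_mul_exp_neg_sq {v : ℝ} (hv : 0 < v) :
    Integrable fun u : ℝ => u * Real.exp (-(v * u ^ 2 / 2)) := by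
  have := integrable_mul_exp_neg_mul_sq (b := v / 2) (by positivity)
  refine this.congr (Eventually.of_forall fun u => ?_)
  simp only; congr 2; ring

/-- Fourier representation of the derivative of the Gaussian density. -/
lemma integral_fourier_gaussDeriv {v : ℝ} (hv : 0 < v) (x : ℝ) :
    ∫ u : ℝ, (Complex.I * u) * Real.exp (-(v * u ^ 2 / 2)) * Complex.exp (-(Complex.I * u * x)) =
      2 * Real.pi * (gaussDeriv v x : ℂ) := by
  have hvc : (v : ℂ) ≠ 0 := by exact_mod_cast hv.ne'
  have hg : ∀ u : ℝ, HasDerivAt (fun u : ℝ => Complex.exp (-(v * u ^ 2 / 2) - Complex.I * u * x))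
      ((-(v * u) - Complex.I * x) *
        Complex.exp (-(v * u ^ 2 / 2) - Complex.I * u * x)) u := by
    intro u
    have h1 : HasDerivAt (fun u : ℝ => (u : ℂ)) 1 u := Complex.ofRealCLM.hasDerivAt
    have h2 := ((((h1.pow 2).const_mul (v : ℂ)).div_const 2).neg.sub
      ((h1.const_mul Complex.I).mul_const (x : ℂ))).cexp
    refine h2.congr_deriv ?_
    change Complex.exp (-((v : ℂ) * (u : ℂ) ^ 2 / 2) - Complex.I * u * x) *
      (-(v * ((2 : ℕ) * (u : ℂ) ^ (2 - 1) * 1) / 2) - Complex.I * 1 * x) = _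
    push_cast
    ring
  have hbase : ∀ u : ℝ, Complex.exp (-(v * u ^ 2 / 2) - Complex.I * u * x) =
      (Real.exp (-(v * u ^ 2 / 2)) : ℂ) * Complex.exp (-(Complex.I * u * x)) := by
    intro u
    rw [sub_eq_add_neg, Complex.exp_add]; push_cast; rfl
  have hnorm : ∀ u : ℝ, ‖Complex.exp (-(Complex.I * u * x))‖ = 1 := by
    intro u
    rw [Complex.norm_exp]; simp
  have hi1 : Integrable fun u : ℝ => Complex.exp (-(v * u ^ 2 / 2) - Complex.I * u * x) := by
    have := integrable_exp_neg_mul_sq (b := v / 2) (by positivity)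
    refine this.mono' (by fun_prop) (Eventually.of_forall fun u => ?_)
    rw [hbase, norm_mul, hnorm, mul_one, Complex.norm_real, Real.norm_of_nonneg (Real.exp_pos _).le]
    apply le_of_eq; congr 1; ring
  have hi2 : Integrable fun u : ℝ => (u : ℂ) *
      Complex.exp (-(v * u ^ 2 / 2) - Complex.I * u * x) := by
    refine (integrable_id_mul_exp_neg_sq hv).norm.mono' (by fun_prop)
      (Eventually.of_forall fun u => ?_)
    rw [hbase, norm_mul, norm_mul, hnorm, mul_one, Complex.norm_real, Complex.norm_real, norm_mul]
  have hz := integral_eq_zero_of_hasDerivAt_of_integrable hg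
    (((hi2.const_mul (-(v : ℂ))).sub (hi1.const_mul (Complex.I * x))).congr
      (Eventually.of_forall fun u => by simp only [Pi.sub_apply]; ring)) hi1
  have hz2 : (v : ℂ) * ∫ u : ℝ, (u : ℂ) * Complex.exp (-(v * u ^ 2 / 2) - Complex.I * u * x) =
      -(Complex.I * x) * ∫ u : ℝ, Complex.exp (-(v * u ^ 2 / 2) - Complex.I * u * x) := by
    rw [← integral_const_mul, ← integral_const_mul, ← sub_eq_zero,
      ← integral_sub (hi2.const_mul _) (hi1.const_mul _), ← neg_eq_zero, ← integral_neg, ← hz]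
    exact integral_congr_ae (Eventually.of_forall fun u => by simp only; ring)
  have hgauss : ∫ u : ℝ, Complex.exp (-(v * u ^ 2 / 2) - Complex.I * u * x) =
      (√(2 * Real.pi / v) * Real.exp (-(x ^ 2 / (2 * v))) : ℝ) := by
    have h := fourierIntegral_gaussian (b := (v / 2 : ℂ)) (by
      rw [show (v / 2 : ℂ) = ((v / 2 : ℝ) : ℂ) by push_cast; rfl, Complex.ofReal_re]
      positivity) (-x : ℂ)
    have h1 : ∀ u : ℝ, Complex.exp (-(v * u ^ 2 / 2) - Complex.I * u * x) =
        Complex.exp (Complex.I * (-x : ℂ) * u) * Complex.exp (-(v / 2 : ℂ) * u ^ 2) := by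
      intro u; rw [← Complex.exp_add]; congr 1; ring
    simp only [h1]
    rw [h]
    push_cast
    congr 1
    · rw [show (Real.pi : ℂ) / (v / 2) = ((2 * Real.pi / v : ℝ) : ℂ) by push_cast; field_simp,
        Real.sqrt_eq_rpow, Complex.ofReal_cpow (by positivity)]
      norm_num
    · congr 1; field_simp; ring
  have h3 : ∫ u : ℝ, (Complex.I * u) * Real.exp (-(v * u ^ 2 / 2)) *
      Complex.exp (-(Complex.I * u * x)) =
      Complex.I * ∫ u : ℝ, (u : ℂ) * Complex.exp (-(v * u ^ 2 / 2) - Complex.I * u * x) := by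
    rw [← integral_const_mul]
    refine integral_congr_ae (Eventually.of_forall fun u => ?_)
    simp only [hbase]; ring
  rw [h3]
  have h4 : ∫ u : ℝ, (u : ℂ) * Complex.exp (-(v * u ^ 2 / 2) - Complex.I * u * x) =
      -(Complex.I * x) / v * (√(2 * Real.pi / v) * Real.exp (-(x ^ 2 / (2 * v))) : ℝ) := by
    rw [hgauss] at hz2
    generalize ∫ u : ℝ, (u : ℂ) * Complex.exp (-(v * u ^ 2 / 2) - Complex.I * u * x) = J at hz2 ⊢
    field_simp
    linear_combination hz2
  have h5 : √(2 * Real.pi / v) = 2 * Real.pi * (√(2 * Real.pi * v))⁻¹ := by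
    rw [eq_comm, ← div_eq_mul_inv, div_eq_iff (by positivity), ← Real.sqrt_mul (by positivity)]
    rw [show 2 * Real.pi / v * (2 * Real.pi * v) = (2 * Real.pi) ^ 2 by field_simp,
      Real.sqrt_sq (by positivity)]
  rw [h4, h5, gaussDeriv]
  push_cast
  linear_combination (-(x : ℂ) / v * (2 * Real.pi * (√(2 * Real.pi * v) : ℂ)⁻¹ *
    Complex.exp (-(x ^ 2 / (2 * v))))) * Complex.I_sq

/-- Averaging over an independent Gaussian variable adds up the variances. -/
lemma integral_gaussDeriv_add {v : ℝ} (hv : 0 < v) (d : NNReal) (x : ℝ) :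
    ∫ w, gaussDeriv v (x + w) ∂(gaussianReal 0 d) = gaussDeriv (v + d) x := by
  have hvd : 0 < v + d := by positivity
  have h2pi : (2 * Real.pi : ℂ) ≠ 0 := by
    exact_mod_cast (by positivity : (2 * Real.pi : ℝ) ≠ 0)
  have hnorm : ∀ y z : ℝ, ‖Complex.exp (-(Complex.I * y * z))‖ = 1 := by
    intro y z; rw [Complex.norm_exp]; simp
  have hswap : Integrable (Function.uncurry fun (w u : ℝ) => (Complex.I * u) *
      Real.exp (-(v * u ^ 2 / 2)) * Complex.exp (-(Complex.I * u * ((x + w : ℝ) : ℂ))))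
      ((gaussianReal 0 d).prod volume) := by
    have h := (integrable_id_mul_exp_neg_sq hv).norm.comp_snd (gaussianReal 0 d)
    refine h.mono' ?_ (Eventually.of_forall fun p => ?_)
    · exact Continuous.aestronglyMeasurable (by unfold Function.uncurry; fun_prop)
    · simp only [Function.uncurry, norm_mul, hnorm, Complex.norm_I, one_mul, mul_one,
        Complex.norm_real, le_refl]
  have h : (2 * Real.pi : ℂ) * ((∫ w, gaussDeriv v (x + w) ∂(gaussianReal 0 d) : ℝ) : ℂ) =
      2 * Real.pi * (gaussDeriv (v + d) x : ℂ) := by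
    rw [← integral_fourier_gaussDeriv hvd, ← integral_complex_ofReal, ← integral_const_mul]
    simp only [← integral_fourier_gaussDeriv hv]
    rw [integral_integral_swap hswap]
    refine integral_congr_ae (Eventually.of_forall fun u => ?_)
    have h1 : ∀ w : ℝ, (Complex.I * u) * Real.exp (-(v * u ^ 2 / 2)) *
        Complex.exp (-(Complex.I * u * ((x + w : ℝ) : ℂ))) =
        (Complex.I * u) * Real.exp (-(v * u ^ 2 / 2)) * Complex.exp (-(Complex.I * u * x)) *
          Complex.exp (((-u : ℝ) : ℂ) * w * Complex.I) := by
      intro w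
      rw [mul_assoc _ (Complex.exp _) (Complex.exp _), ← Complex.exp_add]
      congr 2; push_cast; ring
    simp only [h1]
    rw [integral_const_mul, ← charFun_apply_real, charFun_gaussianReal]
    have h2 : Real.exp (-((v + d) * u ^ 2 / 2)) =
        Real.exp (-(v * u ^ 2 / 2)) * Real.exp (-(d * u ^ 2 / 2)) := by
      rw [← Real.exp_add]; congr 1; ring
    rw [h2]
    push_cast
    rw [show (-(u : ℂ)) * 0 * Complex.I - d * (-(u : ℂ)) ^ 2 / 2 = -(d * (u : ℂ) ^ 2 / 2) by ring]
    ring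
  exact_mod_cast mul_left_cancel₀ h2pi h

/-- Moments of order `2m` of centered Gaussian laws with bounded variance are at most of the order
of `m!`: a power is dominated by `m! exp (z ^ 2 / 4)`, which is integrable for the standard Gaussian
law. -/
lemma exists_lintegral_one_add_abs_pow_le (Q : ℝ) :
    ∃ C : ℝ, 1 ≤ C ∧ ∀ q : NNReal, (q : ℝ) ≤ Q → ∀ m : ℕ,
      ∫⁻ x, ENNReal.ofReal ((1 + |x|) ^ (2 * m)) ∂(gaussianReal 0 q) ≤
        ENNReal.ofReal (C ^ (m + 1) * m.factorial) := by
  have hfin : Integrable (fun z : ℝ => Real.exp (z ^ 2 / 4)) (gaussianReal 0 1) := by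
    rw [gaussianReal_of_var_ne_zero 0 one_ne_zero, integrable_withDensity_iff
      (measurable_gaussianPDF _ _) (Eventually.of_forall fun _ => gaussianPDF_lt_top)]
    have := (integrable_exp_neg_mul_sq (b := 1 / 4) (by norm_num)).const_mul
      ((√(2 * Real.pi * ((1 : NNReal) : ℝ)))⁻¹)
    refine this.congr (Eventually.of_forall fun z => ?_)
    simp only [toReal_gaussianPDF, gaussianPDFReal]
    rw [mul_left_comm, ← Real.exp_add]
    congr 2
    push_cast; ring
  set A := ∫ z : ℝ, Real.exp (z ^ 2 / 4) ∂(gaussianReal 0 1) with hA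
  have hA0 : 0 ≤ A := integral_nonneg fun z => (Real.exp_pos _).le
  -- `c` makes `(1 + |√q z|) ^ 2 ≤ c (1 + z ^ 2 / 4)` hold for all variances `q ≤ Q`
  set c := 8 * |Q| + 2 with hc
  have hc2 : 2 ≤ c := by simp only [hc]; linarith [abs_nonneg Q]
  refine ⟨c + Real.exp 1 * A, by nlinarith [Real.exp_pos 1], fun q hq m => ?_⟩
  have hpt : ∀ z : ℝ, (1 + |√q * z|) ^ (2 * m) ≤
      c ^ m * m.factorial * Real.exp 1 * Real.exp (z ^ 2 / 4) := by
    intro z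
    have h1 : (1 + |√q * z|) ^ 2 ≤ c * (1 + z ^ 2 / 4) := by
      have h2 : (√q * z) ^ 2 = q * z ^ 2 := by rw [mul_pow, Real.sq_sqrt q.coe_nonneg]
      have h3 : (q : ℝ) * z ^ 2 ≤ |Q| * z ^ 2 :=
        mul_le_mul_of_nonneg_right (hq.trans (le_abs_self Q)) (sq_nonneg z)
      have h4 : (1 + |√q * z|) ^ 2 ≤ 2 + 2 * (√q * z) ^ 2 := by
        nlinarith [sq_nonneg (1 - |√q * z|), sq_abs (√q * z)]
      have h5 : 0 ≤ |Q| := abs_nonneg Q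
      rw [h2] at h4
      simp only [hc]
      nlinarith [sq_nonneg z]
    have h6 : (1 + z ^ 2 / 4) ^ m ≤ m.factorial * Real.exp (1 + z ^ 2 / 4) := by
      have := Real.pow_div_factorial_le_exp (1 + z ^ 2 / 4) (by positivity) m
      rwa [div_le_iff₀ (by positivity), mul_comm] at this
    rw [pow_mul]
    calc ((1 + |√q * z|) ^ 2) ^ m ≤ (c * (1 + z ^ 2 / 4)) ^ m :=
          pow_le_pow_left₀ (by positivity) h1 m
      _ = c ^ m * (1 + z ^ 2 / 4) ^ m := mul_pow _ _ _
      _ ≤ c ^ m * (m.factorial * Real.exp (1 + z ^ 2 / 4)) := by gcongr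
      _ = _ := by rw [Real.exp_add]; ring
  have hmap : gaussianReal 0 q = (gaussianReal 0 1).map (√q * ·) := by
    rw [gaussianReal_map_const_mul, mul_zero, mul_one]
    congr 1
    ext
    simp
  rw [hmap, lintegral_map (by fun_prop) (by fun_prop)]
  refine (lintegral_mono fun z => ENNReal.ofReal_le_ofReal (hpt z)).trans ?_
  rw [← ofReal_integral_eq_lintegral_ofReal (hfin.const_mul _)
    (Eventually.of_forall fun z => by positivity), integral_const_mul, ← hA]
  refine ENNReal.ofReal_le_ofReal ?_
  have h7 : 0 ≤ Real.exp 1 * A := by positivity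
  calc c ^ m * m.factorial * Real.exp 1 * A = c ^ m * (Real.exp 1 * A) * m.factorial := by ring
    _ ≤ (c + Real.exp 1 * A) ^ m * (c + Real.exp 1 * A) * m.factorial := by
        gcongr <;> linarith
    _ = _ := by rw [pow_succ]

/-! ### Splitting off an independent Gaussian vector -/

/-- The finite dimensional marginals of `B` at times in `[0, T]` have the characteristic functions
of those of fractional Brownian motion with Hurst parameter `H`. -/
def HasFbmMarginals {Ω : Type*} [MeasurableSpace Ω] (H T : ℝ) (B : ℝ → Ω → ℝ)
    (P : Measure Ω) : Prop :=
  ∀ (ι : Type) [Fintype ι] (s u : ι → ℝ), (∀ j, s j ∈ Icc 0 T) →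
    ∫ ω, Complex.exp (Complex.I * ((∑ j, u j * B (s j) ω : ℝ) : ℂ)) ∂P =
      (Real.exp (-(fbmVar H s u / 2)) : ℂ)

lemma fbmCov_self {H : ℝ} (hH : 0 < H) (t : ℝ) : fbmCov H t t = t ^ (2 * H) := by
  rw [fbmCov, sub_self, abs_zero, Real.zero_rpow (by positivity)]; ring

section Smoothing

variable {ι : Type} [Fintype ι] [DecidableEq ι]

/-- The covariance matrix of `(B_{s j})`, minus the diagonal matrix with entries `d j`. -/
noncomputable def fbmCovSub (H : ℝ) (s d : ι → ℝ) : Matrix ι ι ℝ :=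
  Matrix.of fun j k => fbmCov H (s j) (s k) - if j = k then d j else 0

lemma dotProduct_fbmCovSub_mulVec (H : ℝ) (s d u : ι → ℝ) :
    u ⬝ᵥ (fbmCovSub H s d).mulVec u = fbmVar H s u - ∑ j, d j * u j ^ 2 := by
  simp only [dotProduct, Matrix.mulVec, fbmCovSub, Matrix.of_apply, fbmVar, Finset.mul_sum,
    ← Finset.sum_sub_distrib]
  refine Finset.sum_congr rfl fun j _ => ?_
  have : d j * u j ^ 2 = ∑ k, u j * ((if j = k then d j else 0) * u k) := by
    simp; ring
  rw [this, ← Finset.sum_sub_distrib]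
  exact Finset.sum_congr rfl fun k _ => by ring

lemma posSemidef_fbmCovSub {H : ℝ} {s d : ι → ℝ}
    (h : ∀ u : ι → ℝ, ∑ j, d j * u j ^ 2 ≤ fbmVar H s u) : (fbmCovSub H s d).PosSemidef := by
  refine Matrix.PosSemidef.of_dotProduct_mulVec_nonneg ?_ fun u => ?_
  · ext j k
    simp only [Matrix.conjTranspose_apply, fbmCovSub, Matrix.of_apply, star_trivial]
    rw [fbmCov_comm]
    by_cases hjk : j = k
    · subst hjk; simp
    · rw [if_neg hjk, if_neg (Ne.symm hjk)]
  · rw [star_trivial, dotProduct_fbmCovSub_mulVec]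
    linarith [h u]

variable {Ω : Type*} [MeasurableSpace Ω] {P : Measure Ω} [IsProbabilityMeasure P] {H T : ℝ}
  {B : ℝ → Ω → ℝ}

/-- If the covariance matrix of `(B_{s j})` dominates a diagonal matrix, then `(B_{s j})` has the
law of a sum of two independent Gaussian vectors, of which one has this diagonal covariance. -/
lemma map_fbm_eq (hB : Measurable (Function.uncurry B)) (hlaw : HasFbmMarginals H T B P)
    {s : ι → ℝ} (hs : ∀ j, s j ∈ Icc 0 T) (d : ι → NNReal)
    (hd : (fbmCovSub H s fun j => d j).PosSemidef) :
    P.map (fun ω => WithLp.toLp 2 fun j => B (s j) ω) =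
      ((multivariateGaussian 0 (fbmCovSub H s fun j => d j)).prod
        (Measure.pi fun j => gaussianReal 0 (d j))).map
        fun p => p.1 + WithLp.toLp 2 p.2 := by
  have hBs : ∀ j, Measurable fun ω => B (s j) ω := fun j =>
    hB.comp (measurable_const.prodMk measurable_id)
  have hm1 : Measurable fun ω => WithLp.toLp 2 fun j => B (s j) ω :=
    (WithLp.measurable_toLp 2 _).comp (measurable_pi_lambda _ hBs)
  have hm2 : Measurable fun p : EuclideanSpace ℝ ι × (ι → ℝ) => p.1 + WithLp.toLp 2 p.2 :=
    measurable_fst.add ((WithLp.measurable_toLp 2 _).comp measurable_snd)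
  have := Measure.isProbabilityMeasure_map (μ := P) hm1.aemeasurable
  have := Measure.isProbabilityMeasure_map (μ := ((multivariateGaussian 0
    (fbmCovSub H s fun j => d j)).prod (Measure.pi fun j => gaussianReal 0 (d j)))) hm2.aemeasurable
  refine Measure.ext_of_charFun (funext fun u => ?_)
  have hL : charFun (P.map fun ω => WithLp.toLp 2 fun j => B (s j) ω) u =
      (Real.exp (-(fbmVar H s u / 2)) : ℂ) := by
    rw [← hlaw ι s u hs, charFun_apply, integral_map hm1.aemeasurable
      (Continuous.aestronglyMeasurable (by fun_prop))]
    refine integral_congr_ae (Eventually.of_forall fun ω => ?_)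
    simp only [PiLp.inner_apply, RCLike.inner_apply, conj_trivial]
    rw [mul_comm]
  have hR : charFun (((multivariateGaussian 0 (fbmCovSub H s fun j => d j)).prod
        (Measure.pi fun j => gaussianReal 0 (d j))).map fun p => p.1 + WithLp.toLp 2 p.2) u =
      charFun (multivariateGaussian 0 (fbmCovSub H s fun j => d j)) u *
        charFun ((Measure.pi fun j => gaussianReal 0 (d j)).map (WithLp.toLp 2)) u := by
    rw [charFun_apply, charFun_apply, charFun_apply, integral_map hm2.aemeasurable
      (Continuous.aestronglyMeasurable (by fun_prop)), integral_map
      (WithLp.measurable_toLp 2 _).aemeasurable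
      (Continuous.aestronglyMeasurable (by fun_prop)), ← integral_prod_mul]
    refine integral_congr_ae (Eventually.of_forall fun p => ?_)
    simp only [inner_add_left]
    rw [← Complex.exp_add]
    push_cast
    ring_nf
  rw [hL, hR, charFun_multivariateGaussian hd, charFun_pi]
  simp only [charFun_gaussianReal, ← Complex.exp_sum, ← Complex.exp_add, inner_zero_right]
  have hq : (u.ofLp ⬝ᵥ (fbmCovSub H s fun j => (d j : ℝ)).mulVec u.ofLp) =
      fbmVar H s u - ∑ j, (d j : ℝ) * u j ^ 2 := dotProduct_fbmCovSub_mulVec H s _ _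
  rw [hq]
  push_cast
  congr 1
  simp only [mul_zero, zero_mul, zero_sub, Finset.sum_neg_distrib, ← Finset.sum_div]
  ring

/-- The expectation of a product of functions of `B_{s j}`, by averaging first over the
independent Gaussian vector that has been split off. -/
lemma integral_prod_fbm_eq (hB : Measurable (Function.uncurry B)) (hlaw : HasFbmMarginals H T B P)
    {s : ι → ℝ} (hs : ∀ j, s j ∈ Icc 0 T) (d : ι → NNReal)
    (hd : (fbmCovSub H s fun j => d j).PosSemidef) {f : ι → ℝ → ℝ} (hf : ∀ j, Continuous (f j))
    {c : ι → ℝ} (hc : ∀ j x, |f j x| ≤ c j) :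
    ∫ ω, ∏ j, f j (B (s j) ω) ∂P = ∫ x, ∏ j, ∫ w, f j (x j + w) ∂(gaussianReal 0 (d j))
      ∂(multivariateGaussian 0 (fbmCovSub H s fun j => d j)) := by
  have hBs : ∀ j, Measurable fun ω => B (s j) ω := fun j =>
    hB.comp (measurable_const.prodMk measurable_id)
  have hm1 : Measurable fun ω => WithLp.toLp 2 fun j => B (s j) ω :=
    (WithLp.measurable_toLp 2 _).comp (measurable_pi_lambda _ hBs)
  have hm2 : Measurable fun p : EuclideanSpace ℝ ι × (ι → ℝ) => p.1 + WithLp.toLp 2 p.2 :=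
    measurable_fst.add ((WithLp.measurable_toLp 2 _).comp measurable_snd)
  have hcont : Continuous fun x : EuclideanSpace ℝ ι => ∏ j, f j (x j) :=
    continuous_finsetProd _ fun j _ => (hf j).comp (by fun_prop)
  have h1 : ∫ ω, ∏ j, f j (B (s j) ω) ∂P =
      ∫ x, ∏ j, f j (x j) ∂(P.map fun ω => WithLp.toLp 2 fun j => B (s j) ω) := by
    rw [integral_map hm1.aemeasurable hcont.aestronglyMeasurable]
  rw [h1, map_fbm_eq hB hlaw hs d hd, integral_map hm2.aemeasurable hcont.aestronglyMeasurable,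
    integral_prod]
  · refine integral_congr_ae (Eventually.of_forall fun x => ?_)
    simp only [PiLp.add_apply]
    exact integral_fintype_prod_eq_prod (fun j w => f j (x j + w))
  · refine Integrable.of_bound (C := ∏ j, c j) ?_ (Eventually.of_forall fun p => ?_)
    · exact (hcont.measurable.comp hm2).aestronglyMeasurable
    · rw [norm_prod]
      exact Finset.prod_le_prod (fun _ _ => norm_nonneg _) fun j _ => hc j _

/-- The smoothing that strong local nondeterminism provides: the expectation of a product of
derivatives of narrow Gaussian densities at `B_{s j}` is that of the derivatives of densities whose
variances are at least of the order of the power `2H` of the gaps between the times, at a Gaussian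
vector with smaller variances. -/
lemma exists_integral_prod_gaussDeriv_eq (hH0 : 0 < H) (hH1 : 2 * H < 1)
    (hB : Measurable (Function.uncurry B)) (hlaw : HasFbmMarginals H T B P) {s : ι → ℝ}
    (hs : ∀ j, s j ∈ Ioc 0 T) :
    ∃ μ : Measure (EuclideanSpace ℝ ι), IsProbabilityMeasure μ ∧
      (∀ j, ∃ q : NNReal, (q : ℝ) ≤ T ^ (2 * H) ∧
        MeasurePreserving (fun x : EuclideanSpace ℝ ι => x j) μ (gaussianReal 0 q)) ∧
      ∀ ε : ℝ, 0 < ε → ∀ y : ι → ℝ, ∫ ω, ∏ j, gaussDeriv ε (B (s j) ω - y j) ∂P =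
        ∫ x, ∏ j, gaussDeriv (ε + timeGap s j ^ (2 * H) / 4) (x j - y j) ∂μ := by
  have hgap : ∀ j, 0 ≤ timeGap s j := timeGap_nonneg fun j => (hs j).1.le
  set d : ι → NNReal := fun j =>
    ⟨timeGap s j ^ (2 * H) / 4, div_nonneg (Real.rpow_nonneg (hgap j) _) (by norm_num)⟩ with hd
  have hdv : ∀ j, (d j : ℝ) = timeGap s j ^ (2 * H) / 4 := fun j => rfl
  have hpsd : (fbmCovSub H s fun j => (d j : ℝ)).PosSemidef :=
    posSemidef_fbmCovSub fun u => fbmVar_lower_bound hH0 hH1 s u (timeGap s)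
      (fun j => (hs j).1.le) hgap (timeGap_le_self s) fun j k h => timeGap_le_abs_sub s h
  refine ⟨multivariateGaussian 0 (fbmCovSub H s fun j => (d j : ℝ)), inferInstance,
    fun j => ⟨_, ?_, measurePreserving_eval_multivariateGaussian hpsd⟩, fun ε hε y => ?_⟩
  · have h1 : fbmCovSub H s (fun j => (d j : ℝ)) j j ≤ T ^ (2 * H) := by
      simp only [fbmCovSub, Matrix.of_apply, if_true, fbmCov_self hH0]
      have := Real.rpow_le_rpow (hs j).1.le (hs j).2 (by positivity : 0 ≤ 2 * H)
      linarith [(d j).coe_nonneg]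
    rw [Real.coe_toNNReal']
    exact max_le h1 (Real.rpow_nonneg ((hs j).1.le.trans (hs j).2) _)
  · rw [integral_prod_fbm_eq hB hlaw (fun j => ⟨(hs j).1.le, (hs j).2⟩) d hpsd
      (f := fun j z => gaussDeriv ε (z - y j)) (fun j => by fun_prop)
      (fun j x => abs_gaussDeriv_le hε _)]
    refine integral_congr_ae (Eventually.of_forall fun x => ?_)
    refine Finset.prod_congr rfl fun j _ => ?_
    rw [← hdv, ← integral_gaussDeriv_add hε]
    refine integral_congr_ae (Eventually.of_forall fun w => ?_)
    simp only
    congr 1; ring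

end Smoothing

/-! ### Moments of the mollified field -/

/-- The inequality between the geometric and the arithmetic mean, for the powers `a_j ^ n` with `n`
the number of factors. It bounds a product of dependent variables by their single laws. -/
lemma prod_le_sum_pow_card {ι : Type*} [Fintype ι] [Nonempty ι] {a : ι → ℝ} (ha : ∀ j, 0 ≤ a j) :
    ∏ j, a j ≤ ∑ j, (Fintype.card ι : ℝ)⁻¹ * a j ^ Fintype.card ι := by
  have hn : (Fintype.card ι : ℝ) ≠ 0 := by exact_mod_cast Fintype.card_ne_zero
  have h := Real.geom_mean_le_arith_mean_weighted Finset.univ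
    (fun _ : ι => (Fintype.card ι : ℝ)⁻¹) (fun j => a j ^ Fintype.card ι)
    (fun _ _ => by positivity) (by simp [hn]) (fun j _ => pow_nonneg (ha j) _)
  refine le_trans (le_of_eq ?_) h
  refine Finset.prod_congr rfl fun j _ => ?_
  rw [← Real.rpow_natCast, ← Real.rpow_mul (ha j), mul_inv_cancel₀ hn, Real.rpow_one]

lemma lintegral_pi_prod {n : ℕ} {f : Fin n → ℝ → ENNReal} (hf : ∀ i, Measurable (f i)) :
    ∫⁻ x : Fin n → ℝ, ∏ i, f i (x i) = ∏ i, ∫⁻ z, f i z := by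
  induction n with
  | zero => simp [volume_pi]
  | succ n ih =>
    have e := (volume_preserving_piFinSuccAbove (fun _ : Fin (n + 1) => ℝ) 0).symm
    rw [← e.lintegral_comp_emb (MeasurableEquiv.measurableEmbedding _)]
    simp only [MeasurableEquiv.piFinSuccAbove_symm_apply, Fin.insertNthEquiv_zero,
      Fin.consEquiv_apply, Fin.prod_univ_succ, Fin.cons_zero, Fin.cons_succ]
    rw [Measure.volume_eq_prod, ← ih fun i : Fin n => hf i.succ]
    exact lintegral_prod_mul (hf 0).aemeasurable (Finset.measurable_prod _ fun (i : Fin n) _ =>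
      (hf i.succ).comp (measurable_pi_apply i)).aemeasurable

section Moments

variable {H : ℝ}

/-- The bound for fixed times: after the smoothing, the integrals over the space variables, each
of which occurs twice, are bounded by the Cauchy-Schwarz inequality. -/
lemma exists_lintegral_weight_mul_prod_gaussDeriv_le (hH0 : 0 < H) (hH1 : 2 * H < 1) (T : ℝ) :
    ∃ K : ℝ, 0 < K ∧ ∀ (Ω : Type*) [MeasurableSpace Ω] (P : Measure Ω) [IsProbabilityMeasure P]
      (B : ℝ → Ω → ℝ), Measurable (Function.uncurry B) → HasFbmMarginals H T B P →
      ∀ (m : ℕ), 0 < m → ∀ s : Fin m × Fin 2 → ℝ, (∀ j, s j ∈ Ioc 0 T) → Function.Injective s →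
      ∀ ε : ℝ, 0 < ε → ε ≤ 1 →
      ∫⁻ y : Fin m → ℝ, ENNReal.ofReal (∏ i, (1 + y i ^ 2)) *
          ‖∫ ω, ∏ j, gaussDeriv ε (B (s j) ω - y j.1) ∂P‖ₑ ≤
        ENNReal.ofReal (K ^ m * m.factorial * ∏ j, timeGap s j ^ (-(3 * H / 2))) := by
  obtain ⟨C, hC1, hC⟩ := exists_lintegral_one_add_abs_pow_le (T ^ (2 * H))
  set V := 1 + |T| ^ (2 * H) with hV
  have hV0 : 0 < V := by positivity
  set D := 4 * √(2 + 16 * V) with hD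
  have hD0 : 0 < D := by positivity
  refine ⟨D ^ 2 * C ^ 2, by positivity, fun Ω _ P _ B hB hlaw m hm s hs hinj ε hε hε1 => ?_⟩
  have : Nonempty (Fin m × Fin 2) := ⟨(⟨0, hm⟩, 0)⟩
  have hcard : Fintype.card (Fin m × Fin 2) = 2 * m := by simp [mul_comm]
  obtain ⟨μ, hμP, hμq, hμ⟩ := exists_integral_prod_gaussDeriv_eq hH0 hH1 hB hlaw hs
  have hgap : ∀ j, 0 < timeGap s j := timeGap_pos (fun j => (hs j).1) hinj
  set v : Fin m × Fin 2 → ℝ := fun j => ε + timeGap s j ^ (2 * H) / 4 with hv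
  have hv0 : ∀ j, 0 < v j := fun j => by
    have := Real.rpow_pos_of_pos (hgap j) (2 * H); simp only [hv]; positivity
  have hvV : ∀ j, v j ≤ V := fun j => by
    have h1 : timeGap s j ≤ |T| := (timeGap_le_self s j).trans ((hs j).2.trans (le_abs_self T))
    have h2 := Real.rpow_le_rpow (hgap j).le h1 (by positivity : 0 ≤ 2 * H)
    have h3 := Real.rpow_nonneg (hgap j).le (2 * H)
    simp only [hv, hV]; linarith
  have hvgap : ∀ j, v j ^ (-(3 / 4 : ℝ)) ≤ 4 * timeGap s j ^ (-(3 * H / 2)) := fun j => by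
    have h3 := Real.rpow_pos_of_pos (hgap j) (2 * H)
    have h4 : v j ^ (-(3 / 4 : ℝ)) ≤ (timeGap s j ^ (2 * H) / 4) ^ (-(3 / 4 : ℝ)) :=
      Real.rpow_le_rpow_of_nonpos (by positivity) (by simp only [hv]; linarith) (by norm_num)
    refine h4.trans ?_
    rw [Real.div_rpow h3.le (by norm_num), ← Real.rpow_mul (hgap j).le,
      show 2 * H * -(3 / 4) = -(3 * H / 2) by ring, Real.rpow_neg (by norm_num : (0 : ℝ) ≤ 4),
      div_inv_eq_mul, mul_comm]
    refine mul_le_mul_of_nonneg_right ?_ (Real.rpow_nonneg (hgap j).le _)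
    calc (4 : ℝ) ^ (3 / 4 : ℝ) ≤ 4 ^ (1 : ℝ) :=
          Real.rpow_le_rpow_of_exponent_le (by norm_num) (by norm_num)
      _ = 4 := Real.rpow_one 4
  have hpos1 : ∀ y : Fin m → ℝ, 0 ≤ ∏ i, (1 + y i ^ 2) := fun y =>
    Finset.prod_nonneg fun i _ => by positivity
  -- the integrand, arranged as a product over the space variables
  set F : EuclideanSpace ℝ (Fin m × Fin 2) → Fin m → ℝ → ENNReal := fun x i z =>
    ENNReal.ofReal ((1 + z ^ 2) * (|gaussDeriv (v (i, 0)) (x (i, 0) - z)| *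
      |gaussDeriv (v (i, 1)) (x (i, 1) - z)|)) with hF
  have hFm : Measurable fun p : (Fin m → ℝ) × EuclideanSpace ℝ (Fin m × Fin 2) =>
      ∏ i, F p.2 i (p.1 i) := by
    refine Finset.measurable_prod _ fun i _ => Measurable.ennreal_ofReal ?_
    refine Continuous.measurable ?_
    fun_prop
  have h1 : ∀ y : Fin m → ℝ, ENNReal.ofReal (∏ i, (1 + y i ^ 2)) *
      ‖∫ ω, ∏ j, gaussDeriv ε (B (s j) ω - y j.1) ∂P‖ₑ ≤ ∫⁻ x, ∏ i, F x i (y i) ∂μ := by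
    intro y
    rw [hμ ε hε fun j => y j.1]
    refine (mul_le_mul_right (enorm_integral_le_lintegral_enorm _) _).trans (le_of_eq ?_)
    rw [← lintegral_const_mul' _ _ ENNReal.ofReal_ne_top]
    refine lintegral_congr fun x => ?_
    rw [← ofReal_norm, ← ENNReal.ofReal_mul (hpos1 y), norm_prod,
      ← ENNReal.ofReal_prod_of_nonneg fun i _ => by positivity, Fintype.prod_prod_type,
      ← Finset.prod_mul_distrib]
    simp only [Fin.prod_univ_two, Real.norm_eq_abs, hv]
  have h2 : ∀ x, ∫⁻ y : Fin m → ℝ, ∏ i, F x i (y i) ≤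
      ENNReal.ofReal ((∏ j, D * timeGap s j ^ (-(3 * H / 2))) * ∏ j, (1 + |x j|)) := by
    intro x
    rw [lintegral_pi_prod fun i => by
      refine Measurable.ennreal_ofReal (Continuous.measurable ?_); fun_prop]
    have h3 : ∀ j : Fin m × Fin 2, √(2 + 16 * V) * ((1 + |x j|) * v j ^ (-(3 / 4 : ℝ))) ≤
        D * timeGap s j ^ (-(3 * H / 2)) * (1 + |x j|) := fun j => by
      calc √(2 + 16 * V) * ((1 + |x j|) * v j ^ (-(3 / 4 : ℝ)))
          ≤ √(2 + 16 * V) * ((1 + |x j|) * (4 * timeGap s j ^ (-(3 * H / 2)))) := by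
            have := hvgap j; gcongr
        _ = _ := by simp only [hD]; ring
    have hnn : ∀ j, 0 ≤ D * timeGap s j ^ (-(3 * H / 2)) * (1 + |x j|) := fun j => by
      have := Real.rpow_nonneg (hgap j).le (-(3 * H / 2)); positivity
    rw [← Finset.prod_mul_distrib, ENNReal.ofReal_prod_of_nonneg fun j _ => hnn j,
      Fintype.prod_prod_type]
    refine Finset.prod_le_prod' fun i _ => ?_
    rw [Fin.prod_univ_two]
    exact (lintegral_weight_mul_abs_gaussDeriv_mul_le (hv0 _) (hvV _) (hv0 _) (hvV _) _ _).trans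
      (mul_le_mul' (ENNReal.ofReal_le_ofReal (h3 _)) (ENNReal.ofReal_le_ofReal (h3 _)))
  have h4 : ∫⁻ x, ENNReal.ofReal (∏ j, (1 + |x j|)) ∂μ ≤
      ENNReal.ofReal (C ^ (m + 1) * m.factorial) := by
    have h5 : ∀ x : EuclideanSpace ℝ (Fin m × Fin 2), ENNReal.ofReal (∏ j, (1 + |x j|)) ≤
        ∑ j, ENNReal.ofReal ((2 * m : ℕ) : ℝ)⁻¹ * ENNReal.ofReal ((1 + |x j|) ^ (2 * m)) := by
      intro x
      have h6 := prod_le_sum_pow_card (a := fun j => 1 + |x j|) fun j => by positivity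
      rw [hcard] at h6
      refine (ENNReal.ofReal_le_ofReal h6).trans (le_of_eq ?_)
      rw [ENNReal.ofReal_sum_of_nonneg fun j _ => by positivity]
      exact Finset.sum_congr rfl fun j _ => ENNReal.ofReal_mul (by positivity)
    refine (lintegral_mono h5).trans ?_
    rw [lintegral_finsetSum _ fun j _ => by fun_prop]
    have h7 : ∀ j : Fin m × Fin 2, ∫⁻ x : EuclideanSpace ℝ (Fin m × Fin 2),
        ENNReal.ofReal ((2 * m : ℕ) : ℝ)⁻¹ * ENNReal.ofReal ((1 + |x j|) ^ (2 * m)) ∂μ ≤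
        ENNReal.ofReal ((2 * m : ℕ) : ℝ)⁻¹ * ENNReal.ofReal (C ^ (m + 1) * m.factorial) := by
      intro j
      obtain ⟨q, hq, hmp⟩ := hμq j
      rw [lintegral_const_mul' _ _ ENNReal.ofReal_ne_top]
      have h8 := hmp.lintegral_comp (f := fun z => ENNReal.ofReal ((1 + |z|) ^ (2 * m)))
        (by fun_prop)
      rw [h8]
      gcongr
      exact hC q hq m
    refine (Finset.sum_le_sum fun j _ => h7 j).trans (le_of_eq ?_)
    rw [Finset.sum_const, Finset.card_univ, hcard, nsmul_eq_mul, ← mul_assoc,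
      ← ENNReal.ofReal_natCast, ← ENNReal.ofReal_mul (by positivity),
      mul_inv_cancel₀ (by positivity), ENNReal.ofReal_one, one_mul]
  have hprod0 : 0 ≤ ∏ j, timeGap s j ^ (-(3 * H / 2)) :=
    Finset.prod_nonneg fun j _ => Real.rpow_nonneg (hgap j).le _
  have hprodD : ∏ j, D * timeGap s j ^ (-(3 * H / 2)) =
      D ^ (2 * m) * ∏ j, timeGap s j ^ (-(3 * H / 2)) := by
    rw [Finset.prod_mul_distrib, Finset.prod_const, Finset.card_univ, hcard]
  calc ∫⁻ y : Fin m → ℝ, ENNReal.ofReal (∏ i, (1 + y i ^ 2)) *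
          ‖∫ ω, ∏ j, gaussDeriv ε (B (s j) ω - y j.1) ∂P‖ₑ
      ≤ ∫⁻ y : Fin m → ℝ, (∫⁻ x, ∏ i, F x i (y i) ∂μ) := lintegral_mono h1
    _ = ∫⁻ x, (∫⁻ y : Fin m → ℝ, ∏ i, F x i (y i)) ∂μ := lintegral_lintegral_swap hFm.aemeasurable
    _ ≤ ∫⁻ x, ENNReal.ofReal ((∏ j, D * timeGap s j ^ (-(3 * H / 2))) * ∏ j, (1 + |x j|)) ∂μ :=
        lintegral_mono h2
    _ = ENNReal.ofReal (∏ j, D * timeGap s j ^ (-(3 * H / 2))) *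
          ∫⁻ x, ENNReal.ofReal (∏ j, (1 + |x j|)) ∂μ := by
        rw [← lintegral_const_mul' _ _ ENNReal.ofReal_ne_top]
        refine lintegral_congr fun x => ENNReal.ofReal_mul ?_
        rw [hprodD]; positivity
    _ ≤ ENNReal.ofReal (∏ j, D * timeGap s j ^ (-(3 * H / 2))) *
          ENNReal.ofReal (C ^ (m + 1) * m.factorial) := by gcongr
    _ ≤ _ := by
        rw [hprodD, ← ENNReal.ofReal_mul (by positivity)]
        refine ENNReal.ofReal_le_ofReal ?_
        have h9 : C ^ (m + 1) ≤ (C ^ 2) ^ m := by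
          rw [← pow_mul]; exact pow_le_pow_right₀ hC1 (by omega)
        calc D ^ (2 * m) * (∏ j, timeGap s j ^ (-(3 * H / 2))) * (C ^ (m + 1) * m.factorial)
            ≤ D ^ (2 * m) * (∏ j, timeGap s j ^ (-(3 * H / 2))) *
              ((C ^ 2) ^ m * m.factorial) := by gcongr
          _ = _ := by rw [pow_mul, mul_pow]; ring

end Moments

/-- The mollification of the field `Λ^b(t, ·)`: the Dirac mass in its formal definition
`Λ^b(t, y) = -∫_0^t b(s, y) δ_y'(B_s) ds` is replaced by the centered Gaussian density of
variance `ε`. -/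
noncomputable def mollLambda {Ω : Type*} (B : ℝ → Ω → ℝ) (b : ℝ → ℝ → ℝ) (t ε : ℝ)
    (ω : Ω) (y : ℝ) : ℝ :=
  ∫ s in Ioc 0 t, b s y * gaussDeriv ε (B s ω - y)

section Moments

variable {Ω : Type*} [MeasurableSpace Ω] {P : Measure Ω} [IsProbabilityMeasure P] {H T : ℝ}
  {B : ℝ → Ω → ℝ} {b : ℝ → ℝ → ℝ}

lemma measurable_mollLambda (hB : Measurable (Function.uncurry B))
    (hb : Measurable (Function.uncurry b)) (t ε : ℝ) :
    Measurable (Function.uncurry (mollLambda B b t ε)) := by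
  have h : Measurable fun p : (Ω × ℝ) × ℝ =>
      b p.2 p.1.2 * gaussDeriv ε (B p.2 p.1.1 - p.1.2) := by
    refine (hb.comp (measurable_snd.prodMk (measurable_snd.comp measurable_fst))).mul ?_
    refine (continuous_gaussDeriv ε).measurable.comp (Measurable.sub ?_ (by fun_prop))
    exact hB.comp (measurable_snd.prodMk (measurable_fst.comp measurable_fst))
  exact (h.stronglyMeasurable.integral_prod_right (ν := volume.restrict (Ioc 0 t))).measurable

/-- The moments of the weighted square integral of the mollified field over a bounded range, as
an integral over times of expectations of products. -/
lemma lintegral_pow_integral_mollLambda_sq_le (hB : Measurable (Function.uncurry B))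
    (hb : Measurable (Function.uncurry b)) {M : ℝ} (hM0 : 0 ≤ M) (hM : ∀ s y, |b s y| ≤ M)
    {ε : ℝ} (hε : 0 < ε) {w : ℝ → ℝ} (hwm : Measurable w) (hw0 : ∀ y, 0 ≤ w y)
    (hw1 : ∀ y, w y ≤ 1 + y ^ 2) {cw : ℝ} (hwc : ∀ y, w y ≤ cw) (R t : ℝ) (m : ℕ) :
    ∫⁻ ω, ENNReal.ofReal (∫ y in Icc (-R) R, w y * mollLambda B b t ε ω y ^ 2) ^ m ∂P ≤
      ENNReal.ofReal (M ^ (2 * m)) * ∫⁻ s in Set.pi univ fun _ : Fin m × Fin 2 => Ioc 0 t,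
        ∫⁻ y : Fin m → ℝ, ENNReal.ofReal (∏ i, (1 + y i ^ 2)) *
          ‖∫ ω, ∏ j, gaussDeriv ε (B (s j) ω - y j.1) ∂P‖ₑ := by
  set ν : Measure ℝ := volume.restrict (Icc (-R) R) with hν
  set τ : Measure ℝ := volume.restrict (Ioc 0 t) with hτ
  have hνf : IsFiniteMeasure ν := ⟨by simp [hν]⟩
  have hτf : IsFiniteMeasure τ := ⟨by simp [hτ]⟩
  set νm : Measure (Fin m → ℝ) := Measure.pi fun _ => ν with hνm
  set τm : Measure (Fin m × Fin 2 → ℝ) := Measure.pi fun _ => τ with hτm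
  set E : (Fin m → ℝ) × (Fin m × Fin 2 → ℝ) → Ω → ℝ := fun p ω =>
    ∏ j, gaussDeriv ε (B (p.2 j) ω - p.1 j.1) with hE
  set W : (Fin m → ℝ) × (Fin m × Fin 2 → ℝ) → ℝ := fun p =>
    (∏ i, w (p.1 i)) * ∏ j : Fin m × Fin 2, b (p.2 j) (p.1 j.1) with hW
  have hEm : Measurable (Function.uncurry E) := by
    refine Finset.measurable_prod _ fun j _ => ?_
    refine (continuous_gaussDeriv ε).measurable.comp (Measurable.sub ?_ (by fun_prop))
    exact hB.comp (Measurable.prodMk (by fun_prop) measurable_snd)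
  have hWm : Measurable W := by
    refine (Finset.measurable_prod _ fun i _ => hwm.comp (by fun_prop)).mul
      (Finset.measurable_prod _ fun j _ => ?_)
    exact hb.comp (Measurable.prodMk (by fun_prop) (by fun_prop) :
      Measurable fun p : (Fin m → ℝ) × (Fin m × Fin 2 → ℝ) => (p.2 j, p.1 j.1))
  have hEb : ∀ p ω, |E p ω| ≤ ∏ j : Fin m × Fin 2, ε⁻¹ := fun p ω => by
    simp only [hE, Finset.abs_prod]
    exact Finset.prod_le_prod (fun _ _ => abs_nonneg _) fun j _ => abs_gaussDeriv_le hε _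
  have hbb : ∀ p : (Fin m → ℝ) × (Fin m × Fin 2 → ℝ),
      |∏ j : Fin m × Fin 2, b (p.2 j) (p.1 j.1)| ≤ M ^ (2 * m) := fun p => by
    rw [Finset.abs_prod]
    refine (Finset.prod_le_prod (fun _ _ => abs_nonneg _) fun j _ => hM _ _).trans (le_of_eq ?_)
    rw [Finset.prod_const]; simp [mul_comm]
  have hWb : ∀ p, |W p| ≤ (∏ _i : Fin m, cw) * M ^ (2 * m) := fun p => by
    simp only [hW, abs_mul]
    refine mul_le_mul ?_ (hbb p) (abs_nonneg _)
      (Finset.prod_nonneg fun _ _ => (hw0 0).trans (hwc 0))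
    rw [Finset.abs_prod]
    exact Finset.prod_le_prod (fun _ _ => abs_nonneg _) fun i _ => by
      rw [abs_of_nonneg (hw0 _)]; exact hwc _
  have hGint : Integrable (Function.uncurry fun ω p => W p * E p ω) (P.prod (νm.prod τm)) := by
    refine Integrable.of_bound (C := ((∏ _i : Fin m, cw) * M ^ (2 * m)) *
      ∏ j : Fin m × Fin 2, ε⁻¹) ?_ (Eventually.of_forall fun q => ?_)
    · refine Measurable.aestronglyMeasurable ?_
      exact (hWm.comp measurable_snd).mul (hEm.comp measurable_swap)
    · simp only [Function.uncurry, norm_mul]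
      exact mul_le_mul (hWb _) (hEb _ _) (norm_nonneg _) ((abs_nonneg _).trans (hWb q.2))
  -- the power of the integral as an integral over a product space
  have hX : ∀ ω, (∫ y in Icc (-R) R, w y * mollLambda B b t ε ω y ^ 2) ^ m =
      ∫ p, W p * E p ω ∂(νm.prod τm) := by
    intro ω
    have hi : Integrable (fun p => W p * E p ω) (νm.prod τm) := by
      refine Integrable.of_bound (C := ((∏ _i : Fin m, cw) * M ^ (2 * m)) *
        ∏ j : Fin m × Fin 2, ε⁻¹) ?_ (Eventually.of_forall fun p => ?_)
      · exact (hWm.mul (hEm.comp (measurable_id.prodMk measurable_const))).aestronglyMeasurable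
      · rw [norm_mul]
        exact mul_le_mul (hWb _) (hEb _ _) (norm_nonneg _) ((abs_nonneg _).trans (hWb p))
    have hpow := integral_fintype_prod_eq_pow (ι := Fin m) (μ := ν)
      fun y => w y * mollLambda B b t ε ω y ^ 2
    rw [Fintype.card_fin] at hpow
    rw [integral_prod _ hi, ← hpow]
    refine integral_congr_ae (Eventually.of_forall fun y => ?_)
    have h1 : ∀ s : Fin m × Fin 2 → ℝ, W (y, s) * E (y, s) ω = (∏ i, w (y i)) *
        ∏ j : Fin m × Fin 2, b (s j) (y j.1) * gaussDeriv ε (B (s j) ω - y j.1) := fun s => by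
      simp only [hW, hE]
      rw [mul_assoc, ← Finset.prod_mul_distrib]
    simp only [h1]
    rw [integral_const_mul, hτm, integral_fintype_prod_eq_prod
      (fun (j : Fin m × Fin 2) z => b z (y j.1) * gaussDeriv ε (B z ω - y j.1)),
      Fintype.prod_prod_type, ← Finset.prod_mul_distrib]
    refine Finset.prod_congr rfl fun i _ => ?_
    rw [Fin.prod_univ_two, sq]
    rfl
  have hXnn : ∀ ω, 0 ≤ ∫ y in Icc (-R) R, w y * mollLambda B b t ε ω y ^ 2 := fun ω =>
    integral_nonneg fun y => mul_nonneg (hw0 y) (sq_nonneg _)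
  have hnn : ∀ ω, 0 ≤ ∫ p, W p * E p ω ∂(νm.prod τm) := fun ω => by
    rw [← hX]; exact pow_nonneg (hXnn ω) m
  have hEP : Measurable fun p => ‖∫ ω, E p ω ∂P‖ₑ := by
    have := (hEm.stronglyMeasurable.integral_prod_right (ν := P)).measurable
    exact this.enorm
  have hΨm : Measurable fun p : (Fin m → ℝ) × (Fin m × Fin 2 → ℝ) =>
      ENNReal.ofReal (∏ i, (1 + p.1 i ^ 2)) * ‖∫ ω, E p ω ∂P‖ₑ :=
    (by fun_prop : Measurable fun p : (Fin m → ℝ) × (Fin m × Fin 2 → ℝ) =>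
      ENNReal.ofReal (∏ i, (1 + p.1 i ^ 2))).mul hEP
  calc ∫⁻ ω, ENNReal.ofReal (∫ y in Icc (-R) R, w y * mollLambda B b t ε ω y ^ 2) ^ m ∂P
      = ∫⁻ ω, ENNReal.ofReal (∫ p, W p * E p ω ∂(νm.prod τm)) ∂P := by
        refine lintegral_congr fun ω => ?_
        rw [← hX, ENNReal.ofReal_pow (hXnn ω)]
    _ = ENNReal.ofReal (∫ ω, ∫ p, W p * E p ω ∂(νm.prod τm) ∂P) :=
        (ofReal_integral_eq_lintegral_ofReal hGint.integral_prod_left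
          (Eventually.of_forall hnn)).symm
    _ = ENNReal.ofReal (∫ p, W p * ∫ ω, E p ω ∂P ∂(νm.prod τm)) := by
        rw [integral_integral_swap hGint]
        simp only [integral_const_mul]
    _ ≤ ∫⁻ p, ‖W p * ∫ ω, E p ω ∂P‖ₑ ∂(νm.prod τm) :=
        (Real.ofReal_le_enorm _).trans (enorm_integral_le_lintegral_enorm _)
    _ ≤ ∫⁻ p, ENNReal.ofReal (M ^ (2 * m)) * (ENNReal.ofReal (∏ i, (1 + p.1 i ^ 2)) *
          ‖∫ ω, E p ω ∂P‖ₑ) ∂(νm.prod τm) := by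
        refine lintegral_mono fun p => ?_
        rw [enorm_mul, ← mul_assoc]
        refine mul_le_mul' ?_ le_rfl
        rw [← ofReal_norm, ← ENNReal.ofReal_mul (by positivity), Real.norm_eq_abs]
        refine ENNReal.ofReal_le_ofReal ?_
        simp only [hW, abs_mul]
        rw [mul_comm]
        refine mul_le_mul (hbb p) ?_ (abs_nonneg _) (by positivity)
        rw [Finset.abs_prod]
        exact Finset.prod_le_prod (fun _ _ => abs_nonneg _) fun i _ => by
          rw [abs_of_nonneg (hw0 _)]; exact hw1 _
    _ = ENNReal.ofReal (M ^ (2 * m)) * ∫⁻ s, ∫⁻ y, ENNReal.ofReal (∏ i, (1 + y i ^ 2)) *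
          ‖∫ ω, E (y, s) ω ∂P‖ₑ ∂νm ∂τm := by
        rw [lintegral_const_mul _ hΨm, lintegral_prod_symm _ hΨm.aemeasurable]
    _ ≤ _ := by
        refine mul_le_mul' le_rfl ?_
        rw [hτm, hτ, ← Measure.restrict_pi_pi, ← volume_pi]
        refine lintegral_mono fun s => ?_
        rw [hνm, hν, ← Measure.restrict_pi_pi, ← volume_pi]
        exact setLIntegral_le_lintegral _ _

end Moments

/-- The constants in the moment bound, brought to their final form. -/
lemma exists_moment_constant_le {H T K C : ℝ} (hH0 : 0 < H) (hH1 : 3 * H < 1) (hK : 0 < K)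
    (hC : 0 < C) : ∃ A : ℝ, 0 < A ∧ ∀ m : ℕ, 0 < m →
      K ^ m * m.factorial * ((2 * m).factorial * (Real.exp (m * T) *
        (m : ℝ) ^ (3 * H / 2 * (2 * m : ℕ)) * (C / m) ^ (2 * m))) ≤
      A ^ m * (2 * m).factorial / Real.Gamma (m * (1 - 3 * H) + 1) := by
  refine ⟨K * Real.exp T * C ^ 2, by positivity, fun m hm => ?_⟩
  have hm0 : (0 : ℝ) < m := by exact_mod_cast hm
  have hG : Real.Gamma (m * (1 - 3 * H) + 1) ≤ (m : ℝ) ^ (m * (1 - 3 * H)) := by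
    have h := Real.Gamma_mul_add_mul_le_rpow_Gamma_mul_rpow_Gamma (s := (m : ℝ) + 1) (t := 1)
      (a := 1 - 3 * H) (b := 3 * H) (by positivity) one_pos (by linarith) (by positivity) (by ring)
    rw [Real.Gamma_one, Real.one_rpow, mul_one, Real.Gamma_nat_eq_factorial] at h
    rw [show (m : ℝ) * (1 - 3 * H) + 1 = (1 - 3 * H) * (m + 1) + 3 * H by ring]
    rw [mul_one] at h
    refine h.trans ?_
    rw [Real.rpow_mul hm0.le, Real.rpow_natCast]
    exact Real.rpow_le_rpow (by positivity) (by exact_mod_cast Nat.factorial_le_pow m)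
      (by linarith)
  have hGpos : 0 < Real.Gamma (m * (1 - 3 * H) + 1) :=
    Real.Gamma_pos_of_pos (by nlinarith [mul_pos hm0 (by linarith : 0 < 1 - 3 * H)])
  have hf : (m.factorial : ℝ) ≤ (m : ℝ) ^ (m : ℝ) := by
    rw [Real.rpow_natCast]; exact_mod_cast Nat.factorial_le_pow m
  rw [le_div_iff₀ hGpos]
  have hpow : (m : ℝ) ^ (m : ℝ) * ((m : ℝ) ^ (3 * H / 2 * (2 * m : ℕ)) *
      (m : ℝ) ^ (-((2 * m : ℕ) : ℝ)) * (m : ℝ) ^ (m * (1 - 3 * H))) = 1 := by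
    rw [← Real.rpow_add hm0, ← Real.rpow_add hm0, ← Real.rpow_add hm0]
    push_cast
    ring_nf
    exact Real.rpow_zero _
  have hdiv : (C / m) ^ (2 * m) = (C ^ 2) ^ m * (m : ℝ) ^ (-((2 * m : ℕ) : ℝ)) := by
    rw [Real.rpow_neg hm0.le, Real.rpow_natCast, div_pow, pow_mul, div_eq_mul_inv]
  have hexp : Real.exp (m * T) = Real.exp T ^ m := by rw [← Real.exp_nat_mul]
  rw [hdiv, hexp, mul_pow, mul_pow]
  calc K ^ m * m.factorial * ((2 * m).factorial * (Real.exp T ^ m *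
        (m : ℝ) ^ (3 * H / 2 * (2 * m : ℕ)) * ((C ^ 2) ^ m * (m : ℝ) ^ (-((2 * m : ℕ) : ℝ))))) *
        Real.Gamma (m * (1 - 3 * H) + 1)
      ≤ K ^ m * (m : ℝ) ^ (m : ℝ) * ((2 * m).factorial * (Real.exp T ^ m *
        (m : ℝ) ^ (3 * H / 2 * (2 * m : ℕ)) * ((C ^ 2) ^ m * (m : ℝ) ^ (-((2 * m : ℕ) : ℝ))))) *
        (m : ℝ) ^ (m * (1 - 3 * H)) := by gcongr
    _ = K ^ m * Real.exp T ^ m * (C ^ 2) ^ m * (2 * m).factorial *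
        ((m : ℝ) ^ (m : ℝ) * ((m : ℝ) ^ (3 * H / 2 * (2 * m : ℕ)) *
      (m : ℝ) ^ (-((2 * m : ℕ) : ℝ)) * (m : ℝ) ^ (m * (1 - 3 * H)))) := by ring
    _ = _ := by rw [hpow, mul_one]

section Fatou

variable {Ω : Type*} [MeasurableSpace Ω] {P : Measure Ω}

/-- Fatou's lemma, applied to the inner and to the outer integral: a bound on the moments of the
integrals of `F n` passes to the integral of the limit. -/
lemma lintegral_lintegral_pow_le_of_le_liminf {F : ℕ → Ω → ℝ → ENNReal}
    (hF : ∀ n, Measurable (Function.uncurry (F n))) {G : Ω → ℝ → ENNReal}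
    (hG : ∀ᵐ ω ∂P, ∀ᵐ y, G ω y ≤ liminf (fun n => F n ω y) atTop) {m : ℕ} {c : ENNReal}
    (hc : ∀ n, ∫⁻ ω, (∫⁻ y, F n ω y) ^ m ∂P ≤ c) : ∫⁻ ω, (∫⁻ y, G ω y) ^ m ∂P ≤ c := by
  have hmeas : ∀ n, Measurable fun ω => (∫⁻ y, F n ω y) ^ m := fun n =>
    ((hF n).lintegral_prod_right (ν := volume)).pow_const m
  have hpt : ∀ᵐ ω ∂P, (∫⁻ y, G ω y) ^ m ≤ liminf (fun n => (∫⁻ y, F n ω y) ^ m) atTop := by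
    filter_upwards [hG] with ω hω
    have h1 : ∫⁻ y, G ω y ≤ liminf (fun n => ∫⁻ y, F n ω y) atTop :=
      (lintegral_mono_ae hω).trans (lintegral_liminf_le fun n =>
        (hF n).comp (measurable_const.prodMk measurable_id))
    have h2 := Monotone.map_liminf_of_continuousAt (F := atTop)
      (f := fun x : ENNReal => x ^ m) (fun x y h => pow_le_pow_left' h m)
      (fun n => ∫⁻ y, F n ω y) (ENNReal.continuous_pow m).continuousAt
    exact (pow_le_pow_left' h1 m).trans (le_of_eq h2)
  calc ∫⁻ ω, (∫⁻ y, G ω y) ^ m ∂P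
      ≤ ∫⁻ ω, liminf (fun n => (∫⁻ y, F n ω y) ^ m) atTop ∂P := lintegral_mono_ae hpt
    _ ≤ liminf (fun n => ∫⁻ ω, (∫⁻ y, F n ω y) ^ m ∂P) atTop := lintegral_liminf_le hmeas
    _ ≤ c := liminf_le_of_le (by isBoundedDefault) fun a ha => by
        obtain ⟨n, hn⟩ := ha.exists; exact hn.trans (hc n)

end Fatou

lemma abs_mollLambda_le {Ω : Type*} {B : ℝ → Ω → ℝ} {b : ℝ → ℝ → ℝ} {M : ℝ}
    (hM : ∀ s y, |b s y| ≤ M) {ε : ℝ} (hε : 0 < ε) (t : ℝ) (ω : Ω) (y : ℝ) :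
    |mollLambda B b t ε ω y| ≤ M * ε⁻¹ * volume.real (Ioc 0 t) := by
  rw [mollLambda, ← Real.norm_eq_abs]
  refine norm_setIntegral_le_of_norm_le_const measure_Ioc_lt_top fun s _ => ?_
  rw [norm_mul]
  exact mul_le_mul (hM s y) (abs_gaussDeriv_le hε _) (norm_nonneg _) ((abs_nonneg _).trans (hM s y))

/-- The moments of the weighted square integral of the mollified field are bounded uniformly in
the mollification parameter. -/
lemma exists_lintegral_mollLambda_sq_pow_le {H T : ℝ} (hH0 : 0 < H) (hH1 : 3 * H < 1)
    (hT : 0 ≤ T) : ∃ A : ℝ, 0 < A ∧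
    ∀ (Ω : Type*) [MeasurableSpace Ω] (P : Measure Ω) [IsProbabilityMeasure P]
      (B : ℝ → Ω → ℝ), Measurable (Function.uncurry B) → HasFbmMarginals H T B P →
      ∀ b : ℝ → ℝ → ℝ, Measurable (Function.uncurry b) → ∀ M : ℝ, 0 ≤ M →
      (∀ s y, |b s y| ≤ M) → ∀ t ≤ T, ∀ ε : ℝ, 0 < ε → ε ≤ 1 → ∀ m : ℕ, 0 < m →
      ∫⁻ ω, (∫⁻ y, ENNReal.ofReal ((1 + y ^ 2) * mollLambda B b t ε ω y ^ 2)) ^ m ∂P ≤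
        ENNReal.ofReal (M ^ (2 * m) *
          (A ^ m * (2 * m).factorial / Real.Gamma (m * (1 - 3 * H) + 1))) := by
  obtain ⟨K, hK, hKle⟩ := exists_lintegral_weight_mul_prod_gaussDeriv_le hH0 (by linarith) T
  obtain ⟨C, hC, hCle⟩ := exists_lintegral_prod_timeGap_le (a := 3 * H / 2) (by positivity)
    (by linarith)
  obtain ⟨A, hA, hAle⟩ := exists_moment_constant_le (T := T) hH0 hH1 hK hC
  refine ⟨A, hA, fun Ω _ P _ B hB hlaw b hb M hM0 hM t ht ε hε hε1 m hm => ?_⟩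
  have hm0 : (0 : ℝ) < m := by exact_mod_cast hm
  have htime : ∫⁻ s in Set.pi univ fun _ : Fin m × Fin 2 => Ioc 0 t,
        ∫⁻ y : Fin m → ℝ, ENNReal.ofReal (∏ i, (1 + y i ^ 2)) *
          ‖∫ ω, ∏ j, gaussDeriv ε (B (s j) ω - y j.1) ∂P‖ₑ ≤
      ENNReal.ofReal (A ^ m * (2 * m).factorial / Real.Gamma (m * (1 - 3 * H) + 1)) := by
    calc _ ≤ ∫⁻ s in Set.pi univ fun _ : Fin m × Fin 2 => Ioc 0 T,
          ENNReal.ofReal (K ^ m * m.factorial) *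
            ENNReal.ofReal (∏ j, timeGap s j ^ (-(3 * H / 2))) := by
          refine (lintegral_mono_set (pi_mono fun _ _ => Ioc_subset_Ioc_right ht)).trans ?_
          refine setLIntegral_mono_ae' (MeasurableSet.univ_pi fun _ => measurableSet_Ioc) ?_
          filter_upwards [ae_injective] with s hinj hs
          rw [← ENNReal.ofReal_mul (by positivity)]
          exact hKle Ω P B hB hlaw m hm s (fun j => hs j trivial) hinj ε hε hε1
      _ = ENNReal.ofReal (K ^ m * m.factorial) * ∫⁻ s in Set.pi univ fun _ : Fin m × Fin 2 =>
            Ioc 0 T, ENNReal.ofReal (∏ j, timeGap s j ^ (-(3 * H / 2))) :=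
          lintegral_const_mul' _ _ ENNReal.ofReal_ne_top
      _ ≤ ENNReal.ofReal (K ^ m * m.factorial) * ENNReal.ofReal ((2 * m).factorial *
            (Real.exp (m * T) * (m : ℝ) ^ (3 * H / 2 * (2 * m : ℕ)) * (C / m) ^ (2 * m))) := by
          gcongr
          -- the free parameter `l` of the bound on the gap integral is taken to be `m`
          exact hCle _ (2 * m) (by simp [mul_comm]) T m hT hm0
      _ ≤ _ := by
          rw [← ENNReal.ofReal_mul (by positivity)]
          exact ENNReal.ofReal_le_ofReal (hAle m hm)
  -- truncation of the weight and of the range of integration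
  set w : ℕ → ℝ → ℝ := fun n y => min (1 + y ^ 2) n with hw
  have hwm : ∀ n, Measurable (w n) := fun n => by simp only [hw]; fun_prop
  have hw0 : ∀ n y, 0 ≤ w n y := fun n y => le_min (by positivity) (by positivity)
  have hLm := measurable_mollLambda hB hb t ε
  refine lintegral_lintegral_pow_le_of_le_liminf (F := fun n ω => (Icc (-(n : ℝ)) n).indicator
    fun y => ENNReal.ofReal (w n y * mollLambda B b t ε ω y ^ 2)) (fun n => ?_) ?_ fun n => ?_
  · have h1 : Measurable fun p : Ω × ℝ =>
        ENNReal.ofReal (w n p.2 * mollLambda B b t ε p.1 p.2 ^ 2) :=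
      (((hwm n).comp measurable_snd).mul (hLm.pow_const 2)).ennreal_ofReal
    exact h1.indicator (measurable_snd measurableSet_Icc)
  · refine Eventually.of_forall fun ω => Eventually.of_forall fun y => ?_
    refine le_liminf_of_le (by isBoundedDefault) ?_
    obtain ⟨N, hN⟩ := exists_nat_ge (1 + y ^ 2)
    filter_upwards [eventually_ge_atTop N] with n hn
    have hn' : 1 + y ^ 2 ≤ n := hN.trans (by exact_mod_cast hn)
    have hy : y ∈ Icc (-(n : ℝ)) n := by
      refine abs_le.1 (le_trans ?_ hn')
      nlinarith [sq_abs y, sq_nonneg (|y| - 1)]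
    rw [indicator_of_mem hy, hw]
    simp only [min_eq_left hn', le_refl]
  · have h1 : ∀ ω, ∫⁻ y, (Icc (-(n : ℝ)) n).indicator
        (fun y => ENNReal.ofReal (w n y * mollLambda B b t ε ω y ^ 2)) y =
        ENNReal.ofReal (∫ y in Icc (-(n : ℝ)) n, w n y * mollLambda B b t ε ω y ^ 2) := by
      intro ω
      rw [lintegral_indicator measurableSet_Icc, ofReal_integral_eq_lintegral_ofReal]
      · refine Integrable.of_bound (C := n * (M * ε⁻¹ * volume.real (Ioc 0 t)) ^ 2) ?_
          (Eventually.of_forall fun y => ?_)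
        · exact ((hwm n).mul ((hLm.comp (measurable_const.prodMk measurable_id)).pow_const
            2)).aestronglyMeasurable
        · rw [norm_mul, Real.norm_of_nonneg (hw0 n y), norm_pow]
          refine mul_le_mul (min_le_right _ _) ?_ (by positivity) (by positivity)
          exact pow_le_pow_left₀ (norm_nonneg _) (abs_mollLambda_le hM hε t ω y) 2
      · exact Eventually.of_forall fun y => mul_nonneg (hw0 n y) (sq_nonneg _)
    simp only [h1]
    refine (lintegral_pow_integral_mollLambda_sq_le hB hb hM0 hM hε (hwm n) (hw0 n)
      (fun y => min_le_left _ _) (fun y => min_le_right _ _) n t m).trans ?_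
    rw [ENNReal.ofReal_mul (by positivity)]
    gcongr

/-! ### Fourier multipliers and convergence in `L²(Ω)` -/

/-- The second moment of an integral, through the two-point function of the integrand. -/
lemma lintegral_enorm_integral_sq_le {Ω Z : Type*} [MeasurableSpace Ω] [MeasurableSpace Z]
    {P : Measure Ω} [IsProbabilityMeasure P] {ζ : Measure Z} [SFinite ζ] {f : Ω → Z → ℂ}
    (hf : Measurable (Function.uncurry f)) {g : Z → ℝ} (hg : Integrable g ζ)
    (hfg : ∀ ω z, ‖f ω z‖ ≤ g z) :
    ∫⁻ ω, ‖∫ z, f ω z ∂ζ‖ₑ ^ 2 ∂P ≤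
      ∫⁻ p, ‖∫ ω, f ω p.1 * (starRingEnd ℂ) (f ω p.2) ∂P‖ₑ ∂(ζ.prod ζ) := by
  set I : Ω → ℂ := fun ω => ∫ z, f ω z ∂ζ with hI
  have hint : Integrable (Function.uncurry fun ω (p : Z × Z) =>
      f ω p.1 * (starRingEnd ℂ) (f ω p.2)) (P.prod (ζ.prod ζ)) := by
    refine ((hg.mul_prod hg).comp_snd P).mono' ?_ (Eventually.of_forall fun q => ?_)
    · refine Measurable.aestronglyMeasurable ?_
      exact (hf.comp (measurable_fst.prodMk (measurable_fst.comp measurable_snd))).mul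
        (Complex.continuous_conj.measurable.comp
          (hf.comp (measurable_fst.prodMk (measurable_snd.comp measurable_snd))))
    · simp only [Function.uncurry, norm_mul, RCLike.norm_conj]
      exact mul_le_mul (hfg _ _) (hfg _ _) (norm_nonneg _) ((norm_nonneg _).trans (hfg q.1 _))
  have hsq : ∀ ω, ∫ p, f ω p.1 * (starRingEnd ℂ) (f ω p.2) ∂(ζ.prod ζ) = ((‖I ω‖ ^ 2 : ℝ) : ℂ) := by
    intro ω
    rw [integral_prod_mul (f ω) fun z => (starRingEnd ℂ) (f ω z), integral_conj, Complex.mul_conj,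
      Complex.normSq_eq_norm_sq]
  have hIi : Integrable (fun ω => ‖I ω‖ ^ 2) P := by
    have h := hint.integral_prod_left.re
    refine h.congr (Eventually.of_forall fun ω => ?_)
    simp only [Function.uncurry, hsq]
    exact Complex.ofReal_re _
  calc ∫⁻ ω, ‖I ω‖ₑ ^ 2 ∂P = ∫⁻ ω, ENNReal.ofReal (‖I ω‖ ^ 2) ∂P := by
        refine lintegral_congr fun ω => ?_
        rw [ENNReal.ofReal_pow (norm_nonneg _), ofReal_norm]
    _ = ENNReal.ofReal (∫ ω, ‖I ω‖ ^ 2 ∂P) := (ofReal_integral_eq_lintegral_ofReal hIi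
        (Eventually.of_forall fun ω => by positivity)).symm
    _ ≤ ‖∫ ω, ((‖I ω‖ ^ 2 : ℝ) : ℂ) ∂P‖ₑ := by
        rw [integral_complex_ofReal, ← ofReal_norm, Complex.norm_real]
        exact ENNReal.ofReal_le_ofReal (le_abs_self _)
    _ = ‖∫ p, ∫ ω, f ω p.1 * (starRingEnd ℂ) (f ω p.2) ∂P ∂(ζ.prod ζ)‖ₑ := by
        rw [← integral_integral_swap hint]
        simp only [hsq]
    _ ≤ _ := enorm_integral_le_lintegral_enorm _

/-- The field with the Fourier multiplier `φ` in the integral over `u`. The truncated field is that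
of an indicator function, and the mollified field that of a Gaussian function. -/
noncomputable def multLambda {Ω : Type*} (B : ℝ → Ω → ℝ) (b : ℝ → ℝ → ℝ) (t : ℝ) (φ : ℝ → ℝ)
    (ω : Ω) (y : ℝ) : ℂ :=
  (2 * (Real.pi : ℂ))⁻¹ * ∫ z : ℝ × ℝ, (b z.2 y : ℂ) * (Complex.I * (z.1 : ℂ)) * (φ z.1 : ℂ) *
    Complex.exp (-(Complex.I * (z.1 : ℂ) * ((B z.2 ω : ℂ) - (y : ℂ))))
      ∂(volume.prod (volume.restrict (Ioc 0 t)))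

/-- The bound for the expectation of `u v exp (-i (u B_s - v B_r))`, as a function of `(u, s)` and
`(v, r)`. -/
noncomputable def pairKernel (H : ℝ) (p : (ℝ × ℝ) × (ℝ × ℝ)) : ENNReal :=
  ENNReal.ofReal (|p.1.1| * |p.2.1| *
    Real.exp (-(fbmVar H ![p.1.2, p.2.2] ![-p.1.1, p.2.1] / 2)))

/-- The integral that bounds the second moment of the field with multiplier `φ`. -/
noncomputable def multEnergy (H T : ℝ) (φ : ℝ → ℝ) : ENNReal :=
  ∫⁻ p, ‖φ p.1.1 * φ p.2.1‖ₑ * pairKernel H p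
    ∂((volume.prod (volume.restrict (Ioc 0 T))).prod
      (volume.prod (volume.restrict (Ioc 0 T))))

section Multiplier

variable {Ω : Type*} {B : ℝ → Ω → ℝ} {b : ℝ → ℝ → ℝ} {M : ℝ}

lemma norm_multLambda_integrand_le (hM : ∀ s y, |b s y| ≤ M) (φ : ℝ → ℝ) (ω : Ω) (y : ℝ)
    (z : ℝ × ℝ) :
    ‖(b z.2 y : ℂ) * (Complex.I * (z.1 : ℂ)) * (φ z.1 : ℂ) *
      Complex.exp (-(Complex.I * (z.1 : ℂ) * ((B z.2 ω : ℂ) - (y : ℂ))))‖ ≤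
      M * ‖z.1 * φ z.1‖ := by
  have h : ‖Complex.exp (-(Complex.I * (z.1 : ℂ) * ((B z.2 ω : ℂ) - (y : ℂ))))‖ = 1 := by
    rw [Complex.norm_exp]; simp
  rw [norm_mul, h, mul_one, norm_mul, norm_mul, norm_mul, Complex.norm_I, one_mul,
    Complex.norm_real, Complex.norm_real, Complex.norm_real, norm_mul, mul_assoc]
  exact mul_le_mul_of_nonneg_right (hM _ _) (by positivity)

lemma measurable_multLambda_integrand [MeasurableSpace Ω] (hB : Measurable (Function.uncurry B))
    (hb : Measurable (Function.uncurry b)) {φ : ℝ → ℝ} (hφ : Measurable φ) :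
    Measurable fun q : (Ω × ℝ) × (ℝ × ℝ) =>
      (b q.2.2 q.1.2 : ℂ) * (Complex.I * (q.2.1 : ℂ)) * (φ q.2.1 : ℂ) *
      Complex.exp (-(Complex.I * (q.2.1 : ℂ) * ((B q.2.2 q.1.1 : ℂ) - (q.1.2 : ℂ)))) := by
  have h1 : Measurable fun q : (Ω × ℝ) × (ℝ × ℝ) => b q.2.2 q.1.2 :=
    hb.comp ((measurable_snd.comp measurable_snd).prodMk (measurable_snd.comp measurable_fst))
  have h2 : Measurable fun q : (Ω × ℝ) × (ℝ × ℝ) => B q.2.2 q.1.1 :=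
    hB.comp ((measurable_snd.comp measurable_snd).prodMk (measurable_fst.comp measurable_fst))
  have h3 : Measurable fun q : (Ω × ℝ) × (ℝ × ℝ) => φ q.2.1 := hφ.comp (by fun_prop)
  fun_prop

lemma integrable_multLambda_integrand [MeasurableSpace Ω] (hB : Measurable (Function.uncurry B))
    (hb : Measurable (Function.uncurry b)) (hM : ∀ s y, |b s y| ≤ M) {φ : ℝ → ℝ}
    (hφ : Measurable φ) (hφi : Integrable fun u => u * φ u) (t : ℝ) (ω : Ω) (y : ℝ) :
    Integrable (fun z : ℝ × ℝ => (b z.2 y : ℂ) * (Complex.I * (z.1 : ℂ)) * (φ z.1 : ℂ) *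
      Complex.exp (-(Complex.I * (z.1 : ℂ) * ((B z.2 ω : ℂ) - (y : ℂ)))))
      (volume.prod (volume.restrict (Ioc 0 t))) := by
  refine ((hφi.norm.const_mul M).comp_fst _).mono' ?_
    (Eventually.of_forall fun z => norm_multLambda_integrand_le hM φ ω y z)
  exact ((measurable_multLambda_integrand hB hb hφ).comp
    (measurable_const.prodMk measurable_id : Measurable fun z : ℝ × ℝ =>
      ((ω, y), z))).aestronglyMeasurable

lemma measurable_multLambda [MeasurableSpace Ω] (hB : Measurable (Function.uncurry B))
    (hb : Measurable (Function.uncurry b)) {φ : ℝ → ℝ} (hφ : Measurable φ) (t : ℝ) :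
    Measurable (Function.uncurry (multLambda B b t φ)) :=
  ((measurable_multLambda_integrand hB hb hφ).stronglyMeasurable.integral_prod_right
    (ν := volume.prod (volume.restrict (Ioc 0 t)))).measurable.const_mul _

lemma multLambda_sub [MeasurableSpace Ω] (hB : Measurable (Function.uncurry B))
    (hb : Measurable (Function.uncurry b)) (hM : ∀ s y, |b s y| ≤ M) {φ ψ : ℝ → ℝ}
    (hφ : Measurable φ) (hφi : Integrable fun u => u * φ u) (hψ : Measurable ψ)
    (hψi : Integrable fun u => u * ψ u) (t : ℝ) (ω : Ω) (y : ℝ) :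
    multLambda B b t φ ω y - multLambda B b t ψ ω y =
      multLambda B b t (fun u => φ u - ψ u) ω y := by
  unfold multLambda
  rw [← mul_sub, ← integral_sub (integrable_multLambda_integrand hB hb hM hφ hφi t ω y)
    (integrable_multLambda_integrand hB hb hM hψ hψi t ω y)]
  congr 1
  refine integral_congr_ae (Eventually.of_forall fun z => ?_)
  simp only
  push_cast
  ring

lemma integrable_mul_indicator_Ioc (a b : ℝ) :
    Integrable fun u => u * (Ioc a b).indicator (1 : ℝ → ℝ) u := by
  have h : (fun u => u * (Ioc a b).indicator (1 : ℝ → ℝ) u) =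
      (Ioc a b).indicator fun u => u := by
    ext u; by_cases hu : u ∈ Ioc a b <;> simp [hu]
  rw [h]
  exact (integrable_indicator_iff measurableSet_Ioc).2
    (continuous_id.continuousOn.integrableOn_Icc.mono_set Ioc_subset_Icc_self)

lemma truncLambda_eq_multLambda [MeasurableSpace Ω] (hB : Measurable (Function.uncurry B))
    (hb : Measurable (Function.uncurry b)) (hM : ∀ s y, |b s y| ≤ M) {t K : ℝ} (ht : 0 ≤ t)
    (hK : 0 ≤ K) (ω : Ω) (y : ℝ) :
    truncLambda B b t K ω y = multLambda B b t ((Ioc (-K) K).indicator 1) ω y := by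
  have hφ : Measurable ((Ioc (-K) K).indicator (1 : ℝ → ℝ)) :=
    measurable_one.indicator measurableSet_Ioc
  have hφi := integrable_mul_indicator_Ioc (-K) K
  unfold truncLambda multLambda
  rw [integral_prod _ (integrable_multLambda_integrand hB hb hM hφ hφi t ω y),
    intervalIntegral.integral_of_le (by linarith), ← integral_indicator measurableSet_Ioc]
  congr 1
  refine integral_congr_ae (Eventually.of_forall fun u => ?_)
  by_cases hu : u ∈ Ioc (-K) K
  · simp only [indicator_of_mem hu, Pi.one_apply, Complex.ofReal_one, mul_one]
    rw [intervalIntegral.integral_of_le ht]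
  · simp [indicator_of_notMem hu]

lemma mollLambda_eq_multLambda [MeasurableSpace Ω] (hB : Measurable (Function.uncurry B))
    (hb : Measurable (Function.uncurry b)) (hM : ∀ s y, |b s y| ≤ M) (t : ℝ) {ε : ℝ}
    (hε : 0 < ε) (ω : Ω) (y : ℝ) :
    (mollLambda B b t ε ω y : ℂ) =
      multLambda B b t (fun u => Real.exp (-(ε * u ^ 2 / 2))) ω y := by
  have h2pi : (2 * (Real.pi : ℂ)) ≠ 0 := by
    exact_mod_cast (by positivity : (2 * Real.pi : ℝ) ≠ 0)
  unfold mollLambda multLambda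
  rw [integral_prod_symm _ (integrable_multLambda_integrand hB hb hM (by fun_prop)
    (integrable_id_mul_exp_neg_sq hε) t ω y), eq_inv_mul_iff_mul_eq₀ h2pi,
    ← integral_complex_ofReal, ← integral_const_mul]
  refine integral_congr_ae (Eventually.of_forall fun s => ?_)
  have h := integral_fourier_gaussDeriv hε (B s ω - y)
  simp only
  push_cast at h ⊢
  rw [mul_left_comm, ← h, ← integral_const_mul]
  refine integral_congr_ae (Eventually.of_forall fun u => ?_)
  simp only
  ring

/-- The two-point function of the integrand of `multLambda`, from the characteristic function of
`(B_s, B_r)`. -/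
lemma enorm_integral_pair_le [MeasurableSpace Ω] {P : Measure Ω} [IsProbabilityMeasure P]
    {H T : ℝ} (hlaw : HasFbmMarginals H T B P) (hM : ∀ s y, |b s y| ≤ M) (φ : ℝ → ℝ) (y : ℝ)
    {u s v r : ℝ} (hs : s ∈ Icc 0 T) (hr : r ∈ Icc 0 T) :
    ‖∫ ω, ((b s y : ℂ) * (Complex.I * (u : ℂ)) * (φ u : ℂ) *
      Complex.exp (-(Complex.I * (u : ℂ) * ((B s ω : ℂ) - (y : ℂ))))) *
      (starRingEnd ℂ) ((b r y : ℂ) * (Complex.I * (v : ℂ)) * (φ v : ℂ) *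
      Complex.exp (-(Complex.I * (v : ℂ) * ((B r ω : ℂ) - (y : ℂ))))) ∂P‖ₑ ≤
    ENNReal.ofReal (M ^ 2) * (‖φ u * φ v‖ₑ * pairKernel H ((u, s), (v, r))) := by
  have hM0 : 0 ≤ M := (abs_nonneg _).trans (hM 0 0)
  have hl := hlaw (Fin 2) ![s, r] ![-u, v] (by
    intro j
    fin_cases j
    · exact hs
    · exact hr)
  have halg : ∀ a c d a' c' d' E E' : ℂ, (a * (Complex.I * c) * d * E) *
      (a' * (-Complex.I * c') * d' * E') = (a * a' * (c * c') * (d * d')) * (E * E') := by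
    intro a c d a' c' d' E E'
    linear_combination (-(a * c * d * a' * c' * d') * E * E') * Complex.I_sq
  have h2 : ∀ ω, ((b s y : ℂ) * (Complex.I * (u : ℂ)) * (φ u : ℂ) *
      Complex.exp (-(Complex.I * (u : ℂ) * ((B s ω : ℂ) - (y : ℂ))))) *
      (starRingEnd ℂ) ((b r y : ℂ) * (Complex.I * (v : ℂ)) * (φ v : ℂ) *
      Complex.exp (-(Complex.I * (v : ℂ) * ((B r ω : ℂ) - (y : ℂ))))) =
      ((b s y * b r y * (u * v) * (φ u * φ v) : ℝ) : ℂ) *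
        Complex.exp (Complex.I * (((u - v) * y : ℝ) : ℂ)) *
      Complex.exp (Complex.I * ((∑ j, (![-u, v] : Fin 2 → ℝ) j * B ((![s, r] : Fin 2 → ℝ) j) ω
        : ℝ) : ℂ)) := by
    intro ω
    have h3 : (starRingEnd ℂ) (Complex.exp (-(Complex.I * (v : ℂ) * ((B r ω : ℂ) - (y : ℂ))))) =
        Complex.exp (Complex.I * (v : ℂ) * ((B r ω : ℂ) - (y : ℂ))) := by
      rw [← Complex.exp_conj]; simp
    rw [map_mul, map_mul, map_mul, map_mul, Complex.conj_ofReal, Complex.conj_ofReal,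
      Complex.conj_ofReal, Complex.conj_I, h3, halg, Fin.sum_univ_two,
      ← Complex.exp_add, mul_assoc (((b s y * b r y * (u * v) * (φ u * φ v) : ℝ) : ℂ)),
      ← Complex.exp_add]
    simp only [Matrix.cons_val_zero, Matrix.cons_val_one]
    push_cast
    congr 2
    ring
  rw [integral_congr_ae (Eventually.of_forall h2), integral_const_mul, hl, enorm_mul, enorm_mul]
  have h6 : ‖Complex.exp (Complex.I * (((u - v) * y : ℝ) : ℂ))‖ₑ = 1 := by
    rw [← ofReal_norm, mul_comm, Complex.norm_exp_ofReal_mul_I, ENNReal.ofReal_one]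
  rw [h6, mul_one, ← ofReal_norm, ← ofReal_norm, ← ofReal_norm, Complex.norm_real,
    Complex.norm_real, pairKernel, ← ENNReal.ofReal_mul (by positivity),
    ← ENNReal.ofReal_mul (by positivity), ← ENNReal.ofReal_mul (by positivity)]
  refine ENNReal.ofReal_le_ofReal ?_
  rw [Real.norm_of_nonneg (Real.exp_pos _).le, norm_mul (_ * _) (φ u * φ v), norm_mul _ (u * v),
    norm_mul (b s y)]
  simp only [Real.norm_eq_abs]
  have h7 : |b s y| * |b r y| ≤ M ^ 2 := by
    rw [sq]; exact mul_le_mul (hM _ _) (hM _ _) (abs_nonneg _) hM0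
  calc |b s y| * |b r y| * |u * v| * |φ u * φ v| *
        Real.exp (-(fbmVar H ![s, r] ![-u, v] / 2))
      ≤ M ^ 2 * |u * v| * |φ u * φ v| *
        Real.exp (-(fbmVar H ![s, r] ![-u, v] / 2)) := by gcongr
    _ = _ := by rw [abs_mul u v]; ring

/-- The second moment of the field with multiplier `φ`, bounded uniformly in `y`. -/
lemma lintegral_multLambda_sq_le [MeasurableSpace Ω] {P : Measure Ω} [IsProbabilityMeasure P]
    {H T : ℝ} (hB : Measurable (Function.uncurry B)) (hlaw : HasFbmMarginals H T B P)
    (hb : Measurable (Function.uncurry b)) (hM : ∀ s y, |b s y| ≤ M) {φ : ℝ → ℝ}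
    (hφ : Measurable φ) (hφi : Integrable fun u => u * φ u) {t : ℝ} (htT : t ≤ T) (y : ℝ) :
    ∫⁻ ω, ‖multLambda B b t φ ω y‖ₑ ^ 2 ∂P ≤ ENNReal.ofReal (M ^ 2) *
      multEnergy H T φ := by
  set f : Ω → ℝ × ℝ → ℂ := fun ω z => (b z.2 y : ℂ) * (Complex.I * (z.1 : ℂ)) * (φ z.1 : ℂ) *
    Complex.exp (-(Complex.I * (z.1 : ℂ) * ((B z.2 ω : ℂ) - (y : ℂ)))) with hf
  have hfm : Measurable fun q : Ω × (ℝ × ℝ) => f q.1 q.2 := by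
    have h0 : Measurable fun q : Ω × (ℝ × ℝ) => ((q.1, y), q.2) :=
      (measurable_fst.prodMk measurable_const).prodMk measurable_snd
    have h1 := (measurable_multLambda_integrand hB hb hφ).comp h0
    simp only [Function.comp_def] at h1
    exact h1
  have h1 := lintegral_enorm_integral_sq_le (P := P) (ζ := volume.prod (volume.restrict (Ioc 0 t)))
    hfm ((hφi.norm.const_mul M).comp_fst _)
    fun ω z => norm_multLambda_integrand_le hM φ ω y z
  have hpt : ∀ p : (ℝ × ℝ) × (ℝ × ℝ), p.1.2 ∈ Ioc 0 t → p.2.2 ∈ Ioc 0 t →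
      ‖∫ ω, f ω p.1 * (starRingEnd ℂ) (f ω p.2) ∂P‖ₑ ≤
        ENNReal.ofReal (M ^ 2) * (‖φ p.1.1 * φ p.2.1‖ₑ * pairKernel H p) := fun p hs hr =>
    enorm_integral_pair_le hlaw hM φ y ⟨hs.1.le, hs.2.trans htT⟩ ⟨hr.1.le, hr.2.trans htT⟩
  have hmono : (volume.prod (volume.restrict (Ioc 0 t)) : Measure (ℝ × ℝ)) =
      (volume.prod (volume.restrict (Ioc 0 T))).restrict (univ ×ˢ Ioc 0 t) := by
    rw [← Measure.prod_restrict, Measure.restrict_univ, Measure.restrict_restrict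
      measurableSet_Ioc, inter_eq_left.2 (Ioc_subset_Ioc_right htT)]
  calc ∫⁻ ω, ‖multLambda B b t φ ω y‖ₑ ^ 2 ∂P
      ≤ ∫⁻ ω, ‖∫ z, f ω z ∂(volume.prod (volume.restrict (Ioc 0 t)))‖ₑ ^ 2 ∂P := by
        refine lintegral_mono fun ω => pow_le_pow_left' ?_ 2
        rw [multLambda, enorm_mul]
        refine mul_le_of_le_one_left' ?_
        rw [← ofReal_norm, ENNReal.ofReal_le_one, norm_inv, norm_mul, Complex.norm_real,
          Complex.norm_two, Real.norm_of_nonneg Real.pi_pos.le]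
        exact inv_le_one_of_one_le₀ (by linarith [Real.pi_gt_three])
    _ ≤ _ := h1
    _ ≤ ∫⁻ p, ENNReal.ofReal (M ^ 2) * (‖φ p.1.1 * φ p.2.1‖ₑ * pairKernel H p)
        ∂((volume.prod (volume.restrict (Ioc 0 T))).prod
          (volume.prod (volume.restrict (Ioc 0 T)))) := by
        rw [hmono, Measure.prod_restrict]
        refine le_trans (setLIntegral_mono' ((MeasurableSet.univ.prod measurableSet_Ioc).prod
          (MeasurableSet.univ.prod measurableSet_Ioc)) fun p hp => hpt p hp.1.2 hp.2.2)
          (setLIntegral_le_lintegral _ _)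
    _ = _ := lintegral_const_mul' _ _ ENNReal.ofReal_ne_top

end Multiplier

/-! ### Integrability of the two-point kernel -/

lemma rpow_add_le_add_rpow_of_le_one {x y p : ℝ} (hx : 0 ≤ x) (hy : 0 ≤ y) (hp0 : 0 ≤ p)
    (hp1 : p ≤ 1) : (x + y) ^ p ≤ x ^ p + y ^ p := by
  have := NNReal.rpow_add_le_add_rpow ⟨x, hx⟩ ⟨y, hy⟩ hp0 hp1
  exact_mod_cast this

lemma fbmVar_pair (H s r p q : ℝ) (hH : 0 < H) : fbmVar H ![s, r] ![p, q] =
    p ^ 2 * s ^ (2 * H) + p * q * (s ^ (2 * H) + r ^ (2 * H) - |r - s| ^ (2 * H)) +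
      q ^ 2 * r ^ (2 * H) := by
  simp only [fbmVar, Fin.sum_univ_two, Matrix.cons_val_zero, Matrix.cons_val_one, fbmCov_self hH]
  rw [fbmCov_comm H s r, fbmCov]
  ring

/-- Two-point lower bound, by the almost orthogonality of `B_s` and `B_r - B_s`. -/
lemma fbmVar_pair_lower_bound {H s r : ℝ} (hH0 : 0 < H) (hH1 : 2 * H < 1) (hs : 0 < s)
    (hsr : s < r) (p q : ℝ) :
    ((p + q) ^ 2 * s ^ (2 * H) + q ^ 2 * (r - s) ^ (2 * H)) / 2 ≤ fbmVar H ![s, r] ![p, q] := by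
  rw [fbmVar_pair H s r p q hH0, abs_of_pos (by linarith)]
  have hsub := rpow_add_le_add_rpow_of_le_one hs.le (by linarith : 0 ≤ r - s)
    (by positivity : 0 ≤ 2 * H) hH1.le
  rw [add_sub_cancel] at hsub
  have h1 := Real.rpow_le_rpow hs.le hsr.le (by positivity : 0 ≤ 2 * H)
  have h2 := Real.rpow_le_rpow (by linarith : 0 ≤ r - s) (by linarith : r - s ≤ r)
    (by positivity : 0 ≤ 2 * H)
  generalize s ^ (2 * H) = α at *
  generalize (r - s) ^ (2 * H) = β at *
  generalize r ^ (2 * H) = γ at *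
  -- the cross term is `-(p + q) q δ` with `0 ≤ δ ≤ min α β`
  obtain ⟨δ, hδ⟩ : ∃ δ, δ = α + β - γ := ⟨_, rfl⟩
  have hδ0 : 0 ≤ δ := by linarith
  have hδα : 0 ≤ α - δ := by linarith
  have hδβ : 0 ≤ β - δ := by linarith
  obtain rfl : γ = α + β - δ := by linarith
  nlinarith [mul_nonneg hδα (sq_nonneg (p + q)), mul_nonneg hδβ (sq_nonneg q),
    mul_nonneg hδ0 (sq_nonneg (p + q - q))]

lemma sq_mul_exp_neg_le {c : ℝ} (hc : 0 < c) (x : ℝ) : x ^ 2 * Real.exp (-(c * x ^ 2)) ≤ c⁻¹ := by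
  have h := mul_exp_neg_le_one (c * x ^ 2)
  rw [← mul_le_mul_iff_right₀ hc, mul_inv_cancel₀ hc.ne', ← mul_assoc]
  exact h

lemma abs_mul_exp_neg_le {c : ℝ} (hc : 0 < c) (x : ℝ) :
    |x| * Real.exp (-(c * x ^ 2)) ≤ (√c)⁻¹ := by
  have h := sq_mul_exp_neg_le (c := 2 * c) (by positivity) x
  refine abs_le_of_sq_le_sq' ?_ (by positivity) |>.2
  rw [mul_pow, sq_abs, ← Real.exp_nat_mul, inv_pow, Real.sq_sqrt hc.le]
  push_cast
  rw [show (2 : ℝ) * -(c * x ^ 2) = -(2 * c * x ^ 2) by ring]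
  exact h.trans (inv_anti₀ hc (by linarith))

lemma lintegral_exp_neg_mul_sq {c : ℝ} (hc : 0 < c) :
    ∫⁻ x : ℝ, ENNReal.ofReal (Real.exp (-(c * x ^ 2))) = ENNReal.ofReal √(Real.pi / c) := by
  rw [← integral_gaussian, ofReal_integral_eq_lintegral_ofReal (integrable_exp_neg_mul_sq hc)
    (Eventually.of_forall fun _ => (Real.exp_pos _).le)]
  simp only [neg_mul]

/-- The integral of the two-point function over the frequencies. The two summands of the bound
`|u| |v| ≤ |u + v| |v| + v ^ 2` lead to the orders `s ^ (-2H) (r - s) ^ (-2H)` and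
`s ^ (-H) (r - s) ^ (-3H)`; the second singularity is integrable because `3H < 1`. -/
lemma lintegral_pair_le {H T : ℝ} (hH0 : 0 < H) (hH1 : 2 * H < 1) {s r : ℝ} (hs : 0 < s)
    (hsr : s < r) (hrT : r ≤ T) :
    ∫⁻ u : ℝ, ∫⁻ v : ℝ, ENNReal.ofReal (|u| * |v| *
        Real.exp (-(fbmVar H ![s, r] ![u, v] / 2))) ≤
      ENNReal.ofReal (128 * Real.pi * T ^ H) *
        (ENNReal.ofReal (s ^ (-(2 * H))) * ENNReal.ofReal ((r - s) ^ (-(3 * H)))) := by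
  have hrs : 0 < r - s := by linarith
  have hT : 0 < T := by linarith
  set α := s ^ (2 * H) with hα
  set β := (r - s) ^ (2 * H) with hβ
  have hα0 : 0 < α := Real.rpow_pos_of_pos hs _
  have hβ0 : 0 < β := Real.rpow_pos_of_pos hrs _
  set D := (√(α / 8))⁻¹ * (√(β / 8))⁻¹ + (β / 8)⁻¹ with hD
  have hD0 : 0 ≤ D := by positivity
  have hpt : ∀ u v : ℝ, |u| * |v| * Real.exp (-(fbmVar H ![s, r] ![u, v] / 2)) ≤
      D * (Real.exp (-(α / 8 * (u + v) ^ 2)) * Real.exp (-(β / 8 * v ^ 2))) := by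
    intro u v
    have h1 := fbmVar_pair_lower_bound hH0 hH1 hs hsr u v
    have h2 : |u| ≤ |u + v| + |v| := by
      have := abs_add_le (u + v) (-v)
      rwa [add_neg_cancel_right, abs_neg] at this
    have h3 : Real.exp (-(fbmVar H ![s, r] ![u, v] / 2)) ≤
        (Real.exp (-(α / 8 * (u + v) ^ 2)) * Real.exp (-(β / 8 * v ^ 2))) *
        (Real.exp (-(α / 8 * (u + v) ^ 2)) * Real.exp (-(β / 8 * v ^ 2))) := by
      rw [← Real.exp_add, ← Real.exp_add]
      apply Real.exp_le_exp.2
      rw [← hα, ← hβ] at h1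
      linarith
    have h4 := abs_mul_exp_neg_le (c := α / 8) (by positivity) (u + v)
    have h5 := abs_mul_exp_neg_le (c := β / 8) (by positivity) v
    have h6 := sq_mul_exp_neg_le (c := β / 8) (by positivity) v
    have h7 : Real.exp (-(α / 8 * (u + v) ^ 2)) ≤ 1 := by
      rw [Real.exp_le_one_iff, neg_nonpos]; positivity
    set e₁ := Real.exp (-(α / 8 * (u + v) ^ 2))
    set e₂ := Real.exp (-(β / 8 * v ^ 2))
    have he₁ : 0 ≤ e₁ := (Real.exp_pos _).le
    have he₂ : 0 ≤ e₂ := (Real.exp_pos _).le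
    calc |u| * |v| * Real.exp (-(fbmVar H ![s, r] ![u, v] / 2))
        ≤ (|u + v| + |v|) * |v| * ((e₁ * e₂) * (e₁ * e₂)) := by gcongr
      _ = ((|u + v| * e₁) * (|v| * e₂) + e₁ * (v ^ 2 * e₂)) * (e₁ * e₂) := by
          rw [← sq_abs v]; ring
      _ ≤ D * (e₁ * e₂) := by
          refine mul_le_mul_of_nonneg_right ?_ (by positivity)
          refine add_le_add (mul_le_mul h4 h5 (by positivity) (by positivity)) ?_
          exact (mul_le_of_le_one_left (by positivity) h7).trans h6
  have hfin : D * (√(Real.pi / (α / 8)) * √(Real.pi / (β / 8))) ≤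
      128 * Real.pi * T ^ H * (s ^ (-(2 * H)) * (r - s) ^ (-(3 * H))) := by
    set x := s ^ H with hx
    set z := (r - s) ^ H with hz
    have hx0 : 0 < x := Real.rpow_pos_of_pos hs _
    have hz0 : 0 < z := Real.rpow_pos_of_pos hrs _
    have hxT : x ≤ T ^ H := Real.rpow_le_rpow hs.le (by linarith) hH0.le
    have hzT : z ≤ T ^ H := Real.rpow_le_rpow hrs.le (by linarith) hH0.le
    have hαx : α = x ^ 2 := by
      rw [hα, hx, ← Real.rpow_natCast, ← Real.rpow_mul hs.le]; congr 1; push_cast; ring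
    have hβz : β = z ^ 2 := by
      rw [hβ, hz, ← Real.rpow_natCast, ← Real.rpow_mul hrs.le]; congr 1; push_cast; ring
    have h1 : s ^ (-(2 * H)) = (x ^ 2)⁻¹ := by rw [Real.rpow_neg hs.le, ← hα, hαx]
    have h2 : (r - s) ^ (-(3 * H)) = (z ^ 3)⁻¹ := by
      rw [Real.rpow_neg hrs.le, hz, ← Real.rpow_natCast, ← Real.rpow_mul hrs.le]
      congr 2; push_cast; ring
    have hsq : ∀ a : ℝ, 0 < a → √(a ^ 2 / 8) = a / √8 := fun a ha => by
      rw [Real.sqrt_div (sq_nonneg a), Real.sqrt_sq ha.le]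
    have hsq' : ∀ a : ℝ, 0 < a → √(Real.pi / (a ^ 2 / 8)) = √(8 * Real.pi) / a := fun a ha => by
      rw [show Real.pi / (a ^ 2 / 8) = 8 * Real.pi / a ^ 2 by field_simp,
        Real.sqrt_div (by positivity), Real.sqrt_sq ha.le]
    have h8 : √8 * √8 = (8 : ℝ) := Real.mul_self_sqrt (by norm_num)
    have h8p : √(8 * Real.pi) * √(8 * Real.pi) = 8 * Real.pi := Real.mul_self_sqrt (by positivity)
    rw [hD, hαx, hβz, hsq x hx0, hsq z hz0, hsq' x hx0, hsq' z hz0, h1, h2]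
    have e : ((x / √8)⁻¹ * (z / √8)⁻¹ + (z ^ 2 / 8)⁻¹) *
        (√(8 * Real.pi) / x * (√(8 * Real.pi) / z)) =
        64 * Real.pi * ((z + x) * ((x ^ 2)⁻¹ * (z ^ 3)⁻¹)) := by
      have e1 : (x / √8)⁻¹ * (z / √8)⁻¹ = 8 / (x * z) := by
        rw [inv_div, inv_div, div_mul_div_comm, h8]
      have e2 : √(8 * Real.pi) / x * (√(8 * Real.pi) / z) = 8 * Real.pi / (x * z) := by
        rw [div_mul_div_comm, h8p]
      rw [e1, e2]
      field_simp
      ring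
    rw [e]
    have h9 : z + x ≤ 2 * T ^ H := by linarith
    calc 64 * Real.pi * ((z + x) * ((x ^ 2)⁻¹ * (z ^ 3)⁻¹))
        ≤ 64 * Real.pi * ((2 * T ^ H) * ((x ^ 2)⁻¹ * (z ^ 3)⁻¹)) := by gcongr
      _ = _ := by ring
  have hm : Measurable (Function.uncurry fun (u v : ℝ) => ENNReal.ofReal D *
      (ENNReal.ofReal (Real.exp (-(α / 8 * (u + v) ^ 2))) *
        ENNReal.ofReal (Real.exp (-(β / 8 * v ^ 2))))) := by
    unfold Function.uncurry; fun_prop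
  calc ∫⁻ u : ℝ, ∫⁻ v : ℝ, ENNReal.ofReal (|u| * |v| *
        Real.exp (-(fbmVar H ![s, r] ![u, v] / 2)))
      ≤ ∫⁻ u : ℝ, ∫⁻ v : ℝ, ENNReal.ofReal D *
      (ENNReal.ofReal (Real.exp (-(α / 8 * (u + v) ^ 2))) *
        ENNReal.ofReal (Real.exp (-(β / 8 * v ^ 2)))) := by
        refine lintegral_mono fun u => lintegral_mono fun v => ?_
        rw [← ENNReal.ofReal_mul (Real.exp_pos _).le, ← ENNReal.ofReal_mul hD0]
        exact ENNReal.ofReal_le_ofReal (hpt u v)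
    _ = ∫⁻ v : ℝ, ∫⁻ u : ℝ, ENNReal.ofReal D *
      (ENNReal.ofReal (Real.exp (-(α / 8 * (u + v) ^ 2))) *
        ENNReal.ofReal (Real.exp (-(β / 8 * v ^ 2)))) :=
        lintegral_lintegral_swap hm.aemeasurable
    _ = ENNReal.ofReal D * (ENNReal.ofReal √(Real.pi / (α / 8)) *
          ENNReal.ofReal √(Real.pi / (β / 8))) := by
        have h1 : ∀ v : ℝ, ∫⁻ u : ℝ, ENNReal.ofReal D *
            (ENNReal.ofReal (Real.exp (-(α / 8 * (u + v) ^ 2))) *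
              ENNReal.ofReal (Real.exp (-(β / 8 * v ^ 2)))) =
            ENNReal.ofReal D * (ENNReal.ofReal √(Real.pi / (α / 8)) *
              ENNReal.ofReal (Real.exp (-(β / 8 * v ^ 2)))) := by
          intro v
          rw [lintegral_const_mul' _ _ ENNReal.ofReal_ne_top,
            lintegral_mul_const' _ _ ENNReal.ofReal_ne_top,
            lintegral_add_right_eq_self
              (fun a => ENNReal.ofReal (Real.exp (-(α / 8 * a ^ 2)))) v,
            lintegral_exp_neg_mul_sq (by positivity)]
        simp only [h1]
        rw [lintegral_const_mul' _ _ ENNReal.ofReal_ne_top,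
          lintegral_const_mul' _ _ ENNReal.ofReal_ne_top,
          lintegral_exp_neg_mul_sq (by positivity)]
    _ ≤ _ := by
        rw [← ENNReal.ofReal_mul (by positivity), ← ENNReal.ofReal_mul hD0,
          ← ENNReal.ofReal_mul (by positivity), ← ENNReal.ofReal_mul (by positivity)]
        exact ENNReal.ofReal_le_ofReal hfin

lemma lintegral_ofReal_rpow_lt_top {p : ℝ} (hp : -1 < p) {T : ℝ} (hT : 0 ≤ T) :
    ∫⁻ x in Ioc 0 T, ENNReal.ofReal (x ^ p) < ⊤ := by
  have h := intervalIntegral.intervalIntegrable_rpow' (a := 0) (b := T) hp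
  rw [intervalIntegrable_iff_integrableOn_Ioc_of_le hT] at h
  rw [← ofReal_integral_eq_lintegral_ofReal h
    ((ae_restrict_mem measurableSet_Ioc).mono fun x hx => Real.rpow_nonneg hx.1.le p)]
  exact ENNReal.ofReal_lt_top

/-- The singularities in time that are left by the integral over the frequencies are integrable, by
comparison with a convolution of two functions integrable on `(0, T]`. -/
lemma lintegral_pair_time_lt_top {H T : ℝ} (hH0 : 0 < H) (hH1 : 3 * H < 1) (hT : 0 ≤ T) :
    ∫⁻ s in Ioc 0 T, ∫⁻ r in Ioc 0 T,
      (ENNReal.ofReal (s ^ (-(2 * H))) + ENNReal.ofReal (r ^ (-(2 * H)))) *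
        ENNReal.ofReal (|r - s| ^ (-(3 * H))) < ⊤ := by
  set f : ℝ → ENNReal := (Ioc 0 T).indicator fun z => ENNReal.ofReal (z ^ (-(3 * H))) with hf
  have hfm : Measurable f := Measurable.indicator (by fun_prop) measurableSet_Ioc
  set D := ∫⁻ z, f z with hD
  have hDlt : D < ⊤ := by
    rw [hD, hf, lintegral_indicator measurableSet_Ioc]
    exact lintegral_ofReal_rpow_lt_top (by linarith) hT
  set E := ∫⁻ s in Ioc 0 T, ENNReal.ofReal (s ^ (-(2 * H))) with hE
  have hElt : E < ⊤ := lintegral_ofReal_rpow_lt_top (by linarith) hT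
  have hpt : ∀ s ∈ Ioc 0 T, ∀ r ∈ Ioc 0 T, ENNReal.ofReal (|r - s| ^ (-(3 * H))) ≤
      f (r - s) + f (s - r) := by
    intro s hs r hr
    rcases lt_trichotomy r s with h | h | h
    · rw [abs_of_neg (by linarith), neg_sub]
      refine le_trans ?_ le_add_self
      rw [hf, indicator_of_mem
        (mem_Ioc.2 ⟨by linarith, by linarith [hr.1, hs.2]⟩ : s - r ∈ Ioc 0 T)]
    · rw [h, sub_self, abs_zero, Real.zero_rpow (by linarith), ENNReal.ofReal_zero]
      exact bot_le
    · rw [abs_of_pos (by linarith)]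
      refine le_trans ?_ le_self_add
      rw [hf, indicator_of_mem
        (mem_Ioc.2 ⟨by linarith, by linarith [hs.1, hr.2]⟩ : r - s ∈ Ioc 0 T)]
  have hone : ∀ s ∈ Ioc 0 T, ∫⁻ r in Ioc 0 T, ENNReal.ofReal (|r - s| ^ (-(3 * H))) ≤ D + D := by
    intro s hs
    calc _ ≤ ∫⁻ r in Ioc 0 T, (f (r - s) + f (s - r)) :=
          setLIntegral_mono' measurableSet_Ioc fun r hr => hpt s hs r hr
      _ ≤ ∫⁻ r, (f (r - s) + f (s - r)) := setLIntegral_le_lintegral _ _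
      _ = D + D := by
          rw [lintegral_add_left (by fun_prop), lintegral_sub_right_eq_self f s,
            lintegral_sub_left_eq_self f s]
  have hhalf : ∫⁻ s in Ioc 0 T, ∫⁻ r in Ioc 0 T, ENNReal.ofReal (s ^ (-(2 * H))) *
      ENNReal.ofReal (|r - s| ^ (-(3 * H))) ≤ E * (D + D) := by
    rw [hE, ← lintegral_mul_const _ (by fun_prop)]
    refine setLIntegral_mono' measurableSet_Ioc fun s hs => ?_
    rw [lintegral_const_mul' _ _ ENNReal.ofReal_ne_top]
    gcongr
    exact hone s hs
  have hswap : ∫⁻ s in Ioc 0 T, ∫⁻ r in Ioc 0 T, ENNReal.ofReal (r ^ (-(2 * H))) *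
      ENNReal.ofReal (|r - s| ^ (-(3 * H))) ≤ E * (D + D) := by
    rw [lintegral_lintegral_swap (by unfold Function.uncurry; fun_prop)]
    simp only [abs_sub_comm] at hhalf ⊢
    exact hhalf
  have hadd : ∫⁻ s in Ioc 0 T, ∫⁻ r in Ioc 0 T,
      (ENNReal.ofReal (s ^ (-(2 * H))) + ENNReal.ofReal (r ^ (-(2 * H)))) *
        ENNReal.ofReal (|r - s| ^ (-(3 * H))) ≤ E * (D + D) + E * (D + D) := by
    refine le_trans (le_of_eq ?_) (add_le_add hhalf hswap)
    rw [← lintegral_add_left]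
    · refine lintegral_congr fun s => ?_
      rw [← lintegral_add_left (by fun_prop)]
      simp only [add_mul]
    · have h : Measurable fun p : ℝ × ℝ =>
          ENNReal.ofReal (p.1 ^ (-(2 * H))) * ENNReal.ofReal (|p.2 - p.1| ^ (-(3 * H))) := by
        fun_prop
      exact h.lintegral_prod_right'
  refine hadd.trans_lt ?_
  have : E * (D + D) < ⊤ := ENNReal.mul_lt_top hElt (ENNReal.add_lt_top.2 ⟨hDlt, hDlt⟩)
  exact ENNReal.add_lt_top.2 ⟨this, this⟩

lemma measurable_pairKernel {H : ℝ} (hH : 0 < H) : Measurable (pairKernel H) := by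
  unfold pairKernel
  simp only [fbmVar_pair _ _ _ _ _ hH]
  fun_prop

/-- The two-point kernel is integrable, and so dominates all multipliers bounded by one. -/
lemma lintegral_pairKernel_lt_top {H T : ℝ} (hH0 : 0 < H) (hH1 : 3 * H < 1) (hT : 0 ≤ T) :
    ∫⁻ p, pairKernel H p ∂((volume.prod (volume.restrict (Ioc 0 T))).prod
      (volume.prod (volume.restrict (Ioc 0 T)))) < ⊤ := by
  have hm := measurable_pairKernel hH0
  have hH2 : 2 * H < 1 := by linarith
  set J : ℝ → ℝ → ENNReal := fun s r => ∫⁻ u : ℝ, ∫⁻ v : ℝ, ENNReal.ofReal (|u| * |v| *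
    Real.exp (-(fbmVar H ![s, r] ![u, v] / 2))) with hJ
  have hJs : ∀ s r, J s r = J r s := by
    intro s r
    simp only [hJ]
    rw [lintegral_lintegral_swap (by
      simp only [fbmVar_pair _ _ _ _ _ hH0]; unfold Function.uncurry; fun_prop)]
    refine lintegral_congr fun v => lintegral_congr fun u => ?_
    rw [fbmVar_pair _ _ _ _ _ hH0, fbmVar_pair _ _ _ _ _ hH0, abs_sub_comm, mul_comm |u|]
    congr 4
    ring
  have hJle : ∀ s ∈ Ioc 0 T, ∀ r ∈ Ioc 0 T, s ≠ r → J s r ≤ ENNReal.ofReal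
      (128 * Real.pi * T ^ H) * ((ENNReal.ofReal (s ^ (-(2 * H))) +
        ENNReal.ofReal (r ^ (-(2 * H)))) * ENNReal.ofReal (|r - s| ^ (-(3 * H)))) := by
    intro s hs r hr hsr
    rcases lt_or_gt_of_ne hsr with h | h
    · rw [abs_of_pos (by linarith)]
      refine (lintegral_pair_le hH0 hH2 hs.1 h hr.2).trans ?_
      gcongr
      exact le_self_add
    · rw [hJs, abs_of_neg (by linarith), neg_sub]
      refine (lintegral_pair_le hH0 hH2 hr.1 h hs.2).trans ?_
      gcongr
      exact le_add_self
  have hre : ∫⁻ p, pairKernel H p ∂((volume.prod (volume.restrict (Ioc 0 T))).prod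
      (volume.prod (volume.restrict (Ioc 0 T)))) = ∫⁻ s in Ioc 0 T, ∫⁻ r in Ioc 0 T, J s r := by
    rw [lintegral_prod _ hm.aemeasurable, lintegral_prod_symm _ (hm.lintegral_prod_right'
      (ν := volume.prod (volume.restrict (Ioc 0 T)))).aemeasurable]
    refine lintegral_congr fun s => ?_
    have h1 : ∀ u : ℝ, ∫⁻ y, pairKernel H ((u, s), y) ∂(volume.prod (volume.restrict (Ioc 0 T))) =
        ∫⁻ r in Ioc 0 T, ∫⁻ v : ℝ, pairKernel H ((u, s), (v, r)) := fun u =>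
      lintegral_prod_symm _ (hm.comp (measurable_const.prodMk measurable_id)).aemeasurable
    simp only [h1]
    rw [lintegral_lintegral_swap]
    · refine lintegral_congr fun r => ?_
      simp only [hJ, pairKernel]
      rw [← lintegral_neg_eq_self]
      simp only [abs_neg, neg_neg]
    · have h2 : Measurable fun q : (ℝ × ℝ) × ℝ => pairKernel H ((q.1.1, s), (q.2, q.1.2)) :=
        hm.comp (by fun_prop)
      exact h2.lintegral_prod_right'.aemeasurable
  rw [hre]
  have hfin := lintegral_pair_time_lt_top hH0 hH1 hT
  refine lt_of_le_of_lt ?_ (ENNReal.mul_lt_top (ENNReal.ofReal_lt_top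
    (r := 128 * Real.pi * T ^ H)) hfin)
  rw [← lintegral_const_mul' _ _ ENNReal.ofReal_ne_top]
  refine setLIntegral_mono' measurableSet_Ioc fun s hs => ?_
  rw [← lintegral_const_mul' _ _ ENNReal.ofReal_ne_top]
  refine setLIntegral_mono_ae' measurableSet_Ioc ?_
  filter_upwards [Measure.ae_ne volume s] with r hr hr'
  exact hJle s hs r hr' hr.symm

/-- Multipliers that are bounded by one and tend to zero pointwise give fields that tend to zero
in `L²(Ω)`, uniformly in `y`. -/
lemma tendsto_multEnergy {H T : ℝ} (hH0 : 0 < H) (hH1 : 3 * H < 1) (hT : 0 ≤ T)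
    {κ : Type*} {l : Filter κ} [l.IsCountablyGenerated] {φ : κ → ℝ → ℝ}
    (hφm : ∀ k, Measurable (φ k)) (hφ1 : ∀ k u, |φ k u| ≤ 1) {ψ : ℝ → ℝ}
    (hφ : ∀ u, Tendsto (fun k => φ k u) l (𝓝 (ψ u))) :
    Tendsto (fun k => multEnergy H T (φ k)) l
      (𝓝 (multEnergy H T ψ)) := by
  have hm := measurable_pairKernel hH0
  unfold multEnergy
  refine tendsto_lintegral_filter_of_dominated_convergence (pairKernel H)
    (Eventually.of_forall fun k => ?_) (Eventually.of_forall fun k => Eventually.of_forall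
      fun p => ?_) (lintegral_pairKernel_lt_top hH0 hH1 hT).ne (Eventually.of_forall fun p => ?_)
  · exact ((((hφm k).comp (by fun_prop)).mul ((hφm k).comp (by fun_prop))).enorm).mul hm
  · refine mul_le_of_le_one_left' ?_
    rw [← ofReal_norm, ENNReal.ofReal_le_one, norm_mul]
    exact mul_le_one₀ (hφ1 k _) (norm_nonneg _) (hφ1 k _)
  · refine ENNReal.Tendsto.mul_const ?_ (Or.inr ENNReal.ofReal_ne_top)
    exact (continuous_enorm.tendsto _).comp ((hφ _).mul (hφ _))

/-! ### Convergence of the truncated and of the mollified fields -/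

lemma eLpNorm_multLambda_le {Ω : Type*} [MeasurableSpace Ω] {P : Measure Ω}
    [IsProbabilityMeasure P] {H T : ℝ} {B : ℝ → Ω → ℝ} {b : ℝ → ℝ → ℝ} {M : ℝ}
    (hB : Measurable (Function.uncurry B)) (hlaw : HasFbmMarginals H T B P)
    (hb : Measurable (Function.uncurry b)) (hM : ∀ s y, |b s y| ≤ M) {φ : ℝ → ℝ}
    (hφ : Measurable φ) (hφi : Integrable fun u => u * φ u) {t : ℝ} (htT : t ≤ T) (y : ℝ) :
    eLpNorm (fun ω => multLambda B b t φ ω y) 2 P ≤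
      ENNReal.ofReal M * multEnergy H T φ ^ (1 / 2 : ℝ) := by
  have hM0 : 0 ≤ M := (abs_nonneg _).trans (hM 0 0)
  rw [eLpNorm_eq_lintegral_rpow_enorm_toReal two_ne_zero ENNReal.ofNat_ne_top]
  simp only [ENNReal.toReal_ofNat, ENNReal.rpow_two]
  calc _ ≤ (ENNReal.ofReal (M ^ 2) * multEnergy H T φ) ^ (1 / 2 : ℝ) :=
        ENNReal.rpow_le_rpow (lintegral_multLambda_sq_le hB hlaw hb hM hφ hφi htT y) (by norm_num)
    _ = _ := by
        rw [ENNReal.mul_rpow_of_nonneg _ _ (by norm_num), ENNReal.ofReal_pow hM0,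
          ← ENNReal.rpow_two, ← ENNReal.rpow_mul]
        norm_num

lemma abs_sub_le_one_of_mem_Icc {a b : ℝ} (ha : a ∈ Icc (0 : ℝ) 1) (hb : b ∈ Icc (0 : ℝ) 1) :
    |a - b| ≤ 1 := abs_le.2 ⟨by linarith [ha.1, hb.2], by linarith [ha.2, hb.1]⟩

lemma exp_neg_mul_sq_mem_Icc {ε : ℝ} (hε : 0 ≤ ε) (u : ℝ) :
    Real.exp (-(ε * u ^ 2 / 2)) ∈ Icc (0 : ℝ) 1 :=
  ⟨(Real.exp_pos _).le, Real.exp_le_one_iff.2 (by have : 0 ≤ ε * u ^ 2 := by positivity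
                                                  linarith)⟩

lemma indicator_one_mem_Icc (s : Set ℝ) (u : ℝ) :
    s.indicator (1 : ℝ → ℝ) u ∈ Icc (0 : ℝ) 1 := by
  by_cases hu : u ∈ s <;> simp [hu]

lemma multEnergy_zero (H T : ℝ) : multEnergy H T (fun _ => 0) = 0 := by
  simp [multEnergy]

lemma tendsto_exp_neg_mul_sq {ε : ℕ → ℝ} (hε : Tendsto ε atTop (𝓝 0)) (u : ℝ) :
    Tendsto (fun i => Real.exp (-(ε i * u ^ 2 / 2))) atTop (𝓝 1) := by
  have : Continuous fun x : ℝ => Real.exp (-(x * u ^ 2 / 2)) := by fun_prop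
  have h2 := (this.tendsto 0).comp hε
  simp only [Function.comp_def, zero_mul, zero_div, neg_zero, Real.exp_zero] at h2
  exact h2

/-- Mollification parameters along which the mollified fields are a fast Cauchy sequence in
`L²(Ω)`, uniformly in `y`. -/
lemma exists_seq_multEnergy_lt {H T : ℝ} (hH0 : 0 < H) (hH1 : 3 * H < 1) (hT : 0 ≤ T) :
    ∃ ε : ℕ → ℝ, (∀ i, 0 < ε i) ∧ (∀ i, ε i ≤ 1) ∧ Tendsto ε atTop (𝓝 0) ∧
      ∀ N i j, N ≤ i → N ≤ j → multEnergy H T (fun u => Real.exp (-(ε i * u ^ 2 / 2)) -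
        Real.exp (-(ε j * u ^ 2 / 2))) ^ (1 / 2 : ℝ) < 2⁻¹ ^ N := by
  set δ : ℕ → ℝ := fun n => 1 / ((n : ℝ) + 1) with hδ
  have hδ0 : ∀ n, 0 < δ n := fun n => by simp only [hδ]; positivity
  have hδt : Tendsto δ atTop (𝓝 0) := tendsto_one_div_add_atTop_nhds_zero_nat
  have hlim : Tendsto (fun k : ℕ × ℕ => multEnergy H T (fun u =>
      Real.exp (-(δ k.1 * u ^ 2 / 2)) - Real.exp (-(δ k.2 * u ^ 2 / 2))) ^ (1 / 2 : ℝ)) atTop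
      (𝓝 0) := by
    have h := (tendsto_multEnergy (κ := ℕ × ℕ) (l := atTop) hH0 hH1 hT
      (φ := fun k u => Real.exp (-(δ k.1 * u ^ 2 / 2)) - Real.exp (-(δ k.2 * u ^ 2 / 2)))
      (ψ := fun _ => 0) (fun k => by fun_prop) (fun k u => abs_sub_le_one_of_mem_Icc
        (exp_neg_mul_sq_mem_Icc (hδ0 _).le u) (exp_neg_mul_sq_mem_Icc (hδ0 _).le u)) fun u => ?_)
    · rw [multEnergy_zero] at h
      have h2 := (ENNReal.continuous_rpow_const (y := (1 / 2 : ℝ))).tendsto 0 |>.comp h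
      rwa [ENNReal.zero_rpow_of_pos (by norm_num)] at h2
    · have h1 := tendsto_exp_neg_mul_sq hδt u
      rw [← prod_atTop_atTop_eq]
      have h2 := (h1.comp tendsto_fst).sub
        (h1.comp (tendsto_snd (f := (atTop : Filter ℕ)) (g := (atTop : Filter ℕ))))
      rw [sub_self] at h2
      exact h2
  obtain ⟨g, hg, hgP⟩ := extraction_forall_of_eventually' (P := fun N k => ∀ i ≥ k, ∀ j ≥ k,
      multEnergy H T (fun u => Real.exp (-(δ i * u ^ 2 / 2)) -
        Real.exp (-(δ j * u ^ 2 / 2))) ^ (1 / 2 : ℝ) < 2⁻¹ ^ N) fun N => by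
    have h2 : (0 : ENNReal) < 2⁻¹ ^ N := ENNReal.pow_pos (by norm_num) N
    have h := hlim.eventually_lt_const h2
    obtain ⟨k, hk⟩ := eventually_atTop_prod_self'.1 h
    exact ⟨k, fun k' hk' i hi j hj => hk i (hk'.trans hi) j (hk'.trans hj)⟩
  refine ⟨fun i => δ (g i), fun i => hδ0 _, fun i => ?_, hδt.comp hg.tendsto_atTop,
    fun N i j hi hj => hgP N _ (hg.monotone hi) _ (hg.monotone hj)⟩
  simp only [hδ]
  rw [div_le_one (by positivity)]
  linarith [(Nat.cast_nonneg (g i) : (0 : ℝ) ≤ g i)]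

section Field

variable {Ω : Type*} [MeasurableSpace Ω] {P : Measure Ω} [IsProbabilityMeasure P] {H T : ℝ}
  {B : ℝ → Ω → ℝ} {b : ℝ → ℝ → ℝ} {M t : ℝ}

lemma measurable_multLambda_apply (hB : Measurable (Function.uncurry B))
    (hb : Measurable (Function.uncurry b)) {φ : ℝ → ℝ} (hφ : Measurable φ) (t y : ℝ) :
    Measurable fun ω => multLambda B b t φ ω y := by
  have h0 : Measurable fun ω : Ω => (ω, y) := measurable_id.prodMk measurable_const
  have h1 := measurable_multLambda hB hb hφ t
  generalize multLambda B b t φ = f at *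
  exact h1.comp h0

lemma eLpNorm_multLambda_sub_multLambda_le (hB : Measurable (Function.uncurry B))
    (hlaw : HasFbmMarginals H T B P) (hb : Measurable (Function.uncurry b))
    (hM : ∀ s y, |b s y| ≤ M) {φ ψ : ℝ → ℝ}
    (hφ : Measurable φ) (hφi : Integrable fun u => u * φ u) (hψ : Measurable ψ)
    (hψi : Integrable fun u => u * ψ u) (htT : t ≤ T) (y : ℝ) :
    eLpNorm ((fun ω => multLambda B b t φ ω y) - fun ω => multLambda B b t ψ ω y) 2 P ≤
      ENNReal.ofReal M * multEnergy H T (fun u => φ u - ψ u) ^ (1 / 2 : ℝ) := by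
  have h1 : ((fun ω => multLambda B b t φ ω y) - fun ω => multLambda B b t ψ ω y) =
      fun ω => multLambda B b t (fun u => φ u - ψ u) ω y := by
    ext ω
    exact multLambda_sub hB hb hM hφ hφi hψ hψi t ω y
  rw [h1]
  refine eLpNorm_multLambda_le hB hlaw hb hM (hφ.sub hψ) ?_ htT y
  have h2 := hφi.sub hψi
  refine h2.congr (Eventually.of_forall fun u => ?_)
  simp only [Pi.sub_apply]
  ring

/-- Multipliers that form a fast Cauchy sequence in energy give fields that converge almost
surely and in `L²(Ω)`, for every `y`, to a jointly measurable field. -/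
lemma exists_tendsto_multLambda (hB : Measurable (Function.uncurry B))
    (hlaw : HasFbmMarginals H T B P) (hb : Measurable (Function.uncurry b))
    (hM : ∀ s y, |b s y| ≤ M) {ψ : ℕ → ℝ → ℝ} (hψ : ∀ i, Measurable (ψ i))
    (hψi : ∀ i, Integrable fun u => u * ψ i u)
    (hcau : ∀ N i j, N ≤ i → N ≤ j →
      multEnergy H T (fun u => ψ i u - ψ j u) ^ (1 / 2 : ℝ) < 2⁻¹ ^ N) (htT : t ≤ T) :
    ∃ L : Ω → ℝ → ℂ, Measurable (Function.uncurry L) ∧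
      (∀ y, ∀ᵐ ω ∂P, Tendsto (fun i => multLambda B b t (ψ i) ω y) atTop (𝓝 (L ω y))) ∧
      ∀ y, Tendsto (fun i => eLpNorm ((fun ω => multLambda B b t (ψ i) ω y) - fun ω => L ω y) 2 P)
        atTop (𝓝 0) := by
  set S : ENNReal := ENNReal.ofReal M + 1 with hS
  have hcau2 : ∀ y, ∀ N i j : ℕ, N ≤ i → N ≤ j →
      eLpNorm ((fun ω => multLambda B b t (ψ i) ω y) - fun ω => multLambda B b t (ψ j) ω y) 2 P <
        S * 2⁻¹ ^ N := by
    intro y N i j hi hj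
    refine (eLpNorm_multLambda_sub_multLambda_le hB hlaw hb hM (hψ i) (hψi i) (hψ j) (hψi j)
      htT y).trans_lt ?_
    calc _ ≤ S * multEnergy H T (fun u => ψ i u - ψ j u) ^ (1 / 2 : ℝ) := by
          gcongr; exact le_self_add
      _ < _ := ENNReal.mul_lt_mul_right (by simp [hS]) (by simp [hS]) (hcau N i j hi hj)
  have hsum : ∑' N : ℕ, S * 2⁻¹ ^ N ≠ ⊤ := by
    rw [ENNReal.tsum_mul_left, ENNReal.tsum_geometric]
    refine ENNReal.mul_ne_top (by simp [hS]) ?_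
    rw [ENNReal.inv_ne_top, ENNReal.one_sub_inv_two]
    simp
  have hmeas : ∀ y i, AEStronglyMeasurable (fun ω => multLambda B b t (ψ i) ω y) P := fun y i =>
    (measurable_multLambda_apply hB hb (hψ i) t y).aestronglyMeasurable
  have hae : ∀ y, ∀ᵐ ω ∂P, Tendsto (fun i => multLambda B b t (ψ i) ω y) atTop
      (𝓝 (limUnder atTop fun i => multLambda B b t (ψ i) ω y)) := by
    intro y
    filter_upwards [Lp.ae_tendsto_of_cauchy_eLpNorm (hmeas y) one_le_two hsum (hcau2 y)] with ω hω
    exact tendsto_nhds_limUnder hω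
  refine ⟨fun ω y => limUnder atTop fun i => multLambda B b t (ψ i) ω y, ?_, hae, fun y => ?_⟩
  · exact (StronglyMeasurable.limUnder fun i =>
      (measurable_multLambda hB hb (hψ i) t).stronglyMeasurable).measurable
  · exact Lp.cauchy_tendsto_of_tendsto (hmeas y) _ hsum (hcau2 y) (hae y)

lemma tendsto_multEnergy_indicator_sub_one (hH0 : 0 < H) (hH1 : 3 * H < 1) (hT : 0 ≤ T) :
    Tendsto (fun K : ℝ => multEnergy H T
      (fun u => (Ioc (-K) K).indicator 1 u - 1) ^ (1 / 2 : ℝ)) atTop (𝓝 0) := by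
  have h3 := tendsto_multEnergy (κ := ℝ) (l := atTop) hH0 hH1 hT
    (φ := fun K u => (Ioc (-K) K).indicator 1 u - 1)
    (ψ := fun _ => 0) (fun K => (measurable_one.indicator measurableSet_Ioc).sub measurable_const)
    (fun K u => abs_sub_le_one_of_mem_Icc (indicator_one_mem_Icc _ u) ⟨zero_le_one, le_rfl⟩)
    fun u => by
      refine tendsto_const_nhds.congr' ?_
      filter_upwards [eventually_gt_atTop |u|] with K hK
      rw [indicator_of_mem (mem_Ioc.2 ⟨(abs_lt.1 hK).1, (abs_lt.1 hK).2.le⟩), Pi.one_apply,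
        sub_self]
  rw [multEnergy_zero] at h3
  have h4 := ((ENNReal.continuous_rpow_const (y := (1 / 2 : ℝ))).tendsto 0).comp h3
  rw [ENNReal.zero_rpow_of_pos (by norm_num)] at h4
  exact h4

/-- The truncated fields converge in `L²(Ω)`, and for a sequence of parameters that tends to
zero the mollified fields converge almost surely to the same limit. -/
lemma exists_isLambda_tendsto_mollLambda (hH0 : 0 < H) (hH1 : 3 * H < 1) (hT : 0 ≤ T)
    (hB : Measurable (Function.uncurry B)) (hlaw : HasFbmMarginals H T B P)
    (hb : Measurable (Function.uncurry b)) (hM : ∀ s y, |b s y| ≤ M)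
    (ht0 : 0 ≤ t) (htT : t ≤ T) :
    ∃ L : Ω → ℝ → ℂ, IsLambda P B b t L ∧ ∃ ε : ℕ → ℝ, (∀ i, 0 < ε i) ∧ (∀ i, ε i ≤ 1) ∧
      ∀ y, ∀ᵐ ω ∂P, Tendsto (fun i => (mollLambda B b t (ε i) ω y : ℂ)) atTop (𝓝 (L ω y)) := by
  obtain ⟨ε, hε0, hε1, hεt, hεE⟩ := exists_seq_multEnergy_lt hH0 hH1 hT
  have hψm : ∀ i, Measurable fun u : ℝ => Real.exp (-(ε i * u ^ 2 / 2)) := fun i => by fun_prop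
  have hψi := fun i => integrable_id_mul_exp_neg_sq (hε0 i)
  obtain ⟨L, hLm, hae, hL2⟩ := exists_tendsto_multLambda (t := t) hB hlaw hb hM hψm hψi hεE htT
  have hLy : ∀ y, Measurable fun ω => L ω y := fun y => by
    have h0 : Measurable fun ω : Ω => (ω, y) := measurable_id.prodMk measurable_const
    exact hLm.comp h0
  refine ⟨L, ⟨hLm, fun y => ?_⟩, ε, hε0, hε1, fun y => ?_⟩
  · have hχm : ∀ K : ℝ, Measurable ((Ioc (-K) K).indicator (1 : ℝ → ℝ)) := fun K =>
      measurable_one.indicator measurableSet_Ioc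
    -- the distance to the limit is bounded through the multiplier `1_{(-K, K]} - 1`
    have hle : ∀ K, 0 ≤ K → eLpNorm (fun ω => truncLambda B b t K ω y - L ω y) 2 P ≤
        ENNReal.ofReal M *
          multEnergy H T (fun u => (Ioc (-K) K).indicator 1 u - 1) ^ (1 / 2 : ℝ) := by
      intro K hK
      have h1 : Tendsto (fun i => ENNReal.ofReal M * multEnergy H T (fun u =>
            (Ioc (-K) K).indicator 1 u - Real.exp (-(ε i * u ^ 2 / 2))) ^ (1 / 2 : ℝ) +
          eLpNorm ((fun ω => multLambda B b t (fun u => Real.exp (-(ε i * u ^ 2 / 2))) ω y) -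
            fun ω => L ω y) 2 P) atTop
          (𝓝 (ENNReal.ofReal M * multEnergy H T
            (fun u => (Ioc (-K) K).indicator 1 u - 1) ^ (1 / 2 : ℝ) + 0)) := by
        refine (ENNReal.Tendsto.const_mul ?_ (Or.inr ENNReal.ofReal_ne_top)).add (hL2 y)
        refine (ENNReal.continuous_rpow_const.tendsto _).comp (tendsto_multEnergy hH0 hH1 hT
          (fun i => (hχm K).sub (hψm i)) (fun i u => ?_)
          fun u => (tendsto_exp_neg_mul_sq hεt u).const_sub _)
        exact abs_sub_le_one_of_mem_Icc (indicator_one_mem_Icc _ u)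
          (exp_neg_mul_sq_mem_Icc (hε0 i).le u)
      rw [add_zero] at h1
      refine ge_of_tendsto' h1 fun i => ?_
      set ψ : ℝ → ℝ := fun u => Real.exp (-(ε i * u ^ 2 / 2)) with hψ
      have h2 : (fun ω => truncLambda B b t K ω y - L ω y) =
          ((fun ω => multLambda B b t ((Ioc (-K) K).indicator 1) ω y) -
            fun ω => multLambda B b t ψ ω y) +
            ((fun ω => multLambda B b t ψ ω y) - fun ω => L ω y) := by
        ext ω
        simp only [Pi.add_apply, Pi.sub_apply]
        rw [truncLambda_eq_multLambda hB hb hM ht0 hK]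
        ring
      have hm1 := measurable_multLambda_apply hB hb (hχm K) t y
      have hm2 := measurable_multLambda_apply hB hb (hψm i) t y
      rw [h2]
      refine (eLpNorm_add_le (hm1.sub hm2).aestronglyMeasurable
        (hm2.sub (hLy y)).aestronglyMeasurable one_le_two).trans ?_
      gcongr
      exact eLpNorm_multLambda_sub_multLambda_le hB hlaw hb hM (hχm K)
        (integrable_mul_indicator_Ioc _ _) (hψm i) (hψi i) htT y
    have h0 := ENNReal.Tendsto.const_mul (tendsto_multEnergy_indicator_sub_one hH0 hH1 hT)
      (Or.inr (ENNReal.ofReal_ne_top (r := M)))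
    rw [mul_zero] at h0
    refine tendsto_of_tendsto_of_tendsto_of_le_of_le' tendsto_const_nhds h0
      (Eventually.of_forall fun _ => bot_le) ?_
    filter_upwards [eventually_ge_atTop 0] with K hK using hle K hK
  · filter_upwards [hae y] with ω hω
    simpa only [mollLambda_eq_multLambda hB hb hM t (hε0 _)] using hω

end Field

/-! ### Measurable modification of the process and of the drift -/

lemma truncLambda_congr {Ω : Type*} {T : ℝ} {B B' : ℝ → Ω → ℝ} {b b' : ℝ → ℝ → ℝ}
    {t : ℝ} (ht : t ∈ Icc 0 T) {ω : Ω} (hB : ∀ s ∈ Icc 0 T, B' s ω = B s ω)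
    (hb : ∀ᵐ s ∂(volume.restrict (Icc 0 T)), ∀ y, b' s y = b s y) (K y : ℝ) :
    truncLambda B' b' t K ω y = truncLambda B b t K ω y := by
  unfold truncLambda
  congr 1
  refine intervalIntegral.integral_congr fun u _ => ?_
  refine intervalIntegral.integral_congr_ae ?_
  rw [uIoc_of_le ht.1]
  filter_upwards [(ae_restrict_iff' measurableSet_Icc).1 hb] with s hs hst
  have hsT : s ∈ Icc 0 T := ⟨hst.1.le, hst.2.trans ht.2⟩
  rw [hs hsT y, hB s hsT]

section Data

variable {Ω : Type*} [MeasurableSpace Ω] {P : Measure Ω} {H T : ℝ} {B B' : ℝ → Ω → ℝ}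
  {b b' : ℝ → ℝ → ℝ}

lemma IsFractionalBM.integral_linearCombination_sq (h : IsFractionalBM H T B P) {ι : Type*}
    [Fintype ι] (s u : ι → ℝ) (hs : ∀ j, s j ∈ Icc 0 T) :
    ∫ ω, (∑ j, u j * B (s j) ω) ^ 2 ∂P = fbmVar H s u := by
  have hmem : ∀ j, MemLp (B (s j)) 2 P := fun j =>
    (h.gaussian.hasGaussianLaw_eval ⟨s j, hs j⟩).memLp_two
  have hint : ∀ j k, Integrable (fun ω => u j * B (s j) ω * (u k * B (s k) ω)) P := fun j k =>
    ((hmem j).const_mul (u j)).integrable_mul ((hmem k).const_mul (u k))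
  simp only [sq, Finset.sum_mul_sum]
  rw [integral_finsetSum _ fun j _ => integrable_finsetSum _ fun k _ => hint j k, fbmVar]
  refine Finset.sum_congr rfl fun j _ => ?_
  rw [integral_finsetSum _ fun k _ => hint j k]
  refine Finset.sum_congr rfl fun k _ => ?_
  have h1 : ∀ ω, u j * B (s j) ω * (u k * B (s k) ω) = u j * u k * (B (s j) ω * B (s k) ω) :=
    fun ω => by ring
  simp only [h1]
  rw [integral_const_mul, h.covariance _ (hs j) _ (hs k), fbmCov]

lemma IsFractionalBM.hasFbmMarginals (h : IsFractionalBM H T B P) : HasFbmMarginals H T B P := by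
  classical
  intro ι _ s u hs
  set X : Ω → ℝ := fun ω => ∑ j, u j * B (s j) ω with hX
  have hmem : ∀ j, Integrable (B (s j)) P := fun j =>
    (h.gaussian.hasGaussianLaw_eval ⟨s j, hs j⟩).integrable
  have hG : HasGaussianLaw X P := by
    set σ : ι → Icc (0 : ℝ) T := fun j => ⟨s j, hs j⟩ with hσ
    have hI : ∀ j, σ j ∈ Finset.univ.image σ := fun j =>
      Finset.mem_image_of_mem σ (Finset.mem_univ j)
    have h1 := (h.gaussian.hasGaussianLaw (Finset.univ.image σ)).map_fun
      (∑ j, u j • ContinuousLinearMap.proj (R := ℝ) (φ := fun _ => ℝ) ⟨σ j, hI j⟩)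
    refine h1.congr (Eventually.of_forall fun ω => ?_)
    simp [hX, hσ]
  have hmean : ∫ ω, X ω ∂P = 0 := by
    rw [hX, integral_finsetSum _ fun j _ => (hmem j).const_mul (u j)]
    simp only [integral_const_mul, h.centered _ (hs _), mul_zero, Finset.sum_const_zero]
  have hvar : Var[X; P] = fbmVar H s u := by
    rw [variance_of_integral_eq_zero hG.aemeasurable hmean]
    exact h.integral_linearCombination_sq s u hs
  have hc : charFun (P.map X) 1 = ∫ ω, Complex.exp (Complex.I * (X ω : ℂ)) ∂P := by
    rw [charFun_apply_real, integral_map hG.aemeasurable (by fun_prop)]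
    refine integral_congr_ae (Eventually.of_forall fun ω => ?_)
    simp only [Complex.ofReal_one, one_mul, mul_comm]
  have hnn : 0 ≤ fbmVar H s u := hvar ▸ variance_nonneg _ _
  rw [← hc, hG.map_eq_gaussianReal, charFun_gaussianReal, hvar, hmean, Real.coe_toNNReal _ hnn]
  push_cast
  congr 1
  ring

lemma HasFbmMarginals.congr (h : HasFbmMarginals H T B P)
    (hBB' : ∀ᵐ ω ∂P, ∀ s ∈ Icc 0 T, B' s ω = B s ω) : HasFbmMarginals H T B' P := by
  intro ι _ s u hs
  rw [← h ι s u hs]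
  refine integral_congr_ae ?_
  filter_upwards [hBB'] with ω hω
  simp only [fun j => hω (s j) (hs j)]

/-- Fractional Brownian motion agrees almost surely, at all times in `[0, T]`, with a jointly
measurable process: a limit of step processes in time. -/
lemma IsFractionalBM.exists_measurable_modification (h : IsFractionalBM H T B P) :
    ∃ B' : ℝ → Ω → ℝ, Measurable (Function.uncurry B') ∧
      ∀ᵐ ω ∂P, ∀ s ∈ Icc 0 T, B' s ω = B s ω := by
  classical
  set C : ℝ → Ω → ℝ := fun q => if hq : q ∈ Icc 0 T then
    (h.gaussian.aemeasurable ⟨q, hq⟩).mk _ else 0 with hC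
  have hCm : ∀ q, Measurable (C q) := fun q => by
    simp only [hC]
    split_ifs with hq
    · exact AEMeasurable.measurable_mk _
    · exact measurable_zero
  have hCB : ∀ q ∈ Icc 0 T, ∀ᵐ ω ∂P, C q ω = B q ω := fun q hq => by
    simp only [hC, dif_pos hq]
    exact (AEMeasurable.ae_eq_mk _).symm
  set g : ℕ → ℝ → ℝ := fun n s => (⌊((n : ℝ) + 1) * s⌋₊ : ℝ) / ((n : ℝ) + 1) with hg
  set F : ℕ → ℝ × Ω → ℝ := fun n p => C (g n p.1) p.2 with hF
  have hFm : ∀ n, Measurable (F n) := fun n => by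
    have h1 : Measurable fun q : ℕ × Ω => C ((q.1 : ℝ) / ((n : ℝ) + 1)) q.2 :=
      measurable_from_prod_countable_right fun k => hCm ((k : ℝ) / ((n : ℝ) + 1))
    have h2 : Measurable fun p : ℝ × Ω => (⌊((n : ℝ) + 1) * p.1⌋₊, p.2) :=
      (Nat.measurable_floor.comp (by fun_prop)).prodMk measurable_snd
    exact h1.comp h2
  refine ⟨fun s ω => limUnder atTop fun n => F n (s, ω), ?_, ?_⟩
  · exact (StronglyMeasurable.limUnder fun n => (hFm n).stronglyMeasurable).measurable
  · have hgrid : ∀ᵐ ω ∂P, ∀ n k : ℕ, (k : ℝ) / ((n : ℝ) + 1) ∈ Icc 0 T →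
        C ((k : ℝ) / ((n : ℝ) + 1)) ω = B ((k : ℝ) / ((n : ℝ) + 1)) ω :=
      ae_all_iff.2 fun n => ae_all_iff.2 fun k => by
        by_cases hk : (k : ℝ) / ((n : ℝ) + 1) ∈ Icc 0 T
        · filter_upwards [hCB _ hk] with ω hω _ using hω
        · exact Eventually.of_forall fun ω hk' => absurd hk' hk
    filter_upwards [hgrid, h.continuous_paths] with ω hω hcont s hs
    have hgle : ∀ n : ℕ, g n s ≤ s := fun n => by
      simp only [hg]
      rw [div_le_iff₀ (by positivity), mul_comm s]
      exact Nat.floor_le (mul_nonneg (by positivity) hs.1)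
    have hgge : ∀ n : ℕ, s - 1 / ((n : ℝ) + 1) ≤ g n s := fun n => by
      have hn : (0 : ℝ) < (n : ℝ) + 1 := by positivity
      simp only [hg]
      rw [le_div_iff₀ hn, sub_mul, div_mul_cancel₀ _ hn.ne', mul_comm s]
      linarith [Nat.lt_floor_add_one (((n : ℝ) + 1) * s)]
    have hgmem : ∀ n : ℕ, g n s ∈ Icc 0 T := fun n =>
      ⟨by simp only [hg]; positivity, (hgle n).trans hs.2⟩
    have hgt : Tendsto (fun n => g n s) atTop (𝓝 s) := by
      refine tendsto_of_tendsto_of_tendsto_of_le_of_le ?_ tendsto_const_nhds hgge hgle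
      simpa using tendsto_const_nhds.sub (tendsto_one_div_add_atTop_nhds_zero_nat (𝕜 := ℝ))
    refine Tendsto.limUnder_eq ?_
    have h1 : ∀ n, F n (s, ω) = B (g n s) ω := fun n => hω n _ (hgmem n)
    simp only [h1]
    exact (hcont s hs).tendsto.comp (tendsto_nhdsWithin_iff.2
      ⟨hgt, Eventually.of_forall hgmem⟩)

/-- The infimum that defines the norm of the drift is attained: the exceptional null sets of a
sequence of bounds are united. -/
lemma isDriftBound_driftNorm (hb : IsBoundedDrift b T) : IsDriftBound b T (driftNorm b T) := by
  have hne : {M | IsDriftBound b T M}.Nonempty := hb.2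
  refine ⟨Real.sInf_nonneg fun M hM => hM.1, ?_⟩
  have h : ∀ n : ℕ, ∀ᵐ s ∂(volume.restrict (Icc 0 T)), ∀ y,
      |b s y| ≤ driftNorm b T + 1 / ((n : ℝ) + 1) := fun n => by
    obtain ⟨M, hM, hlt⟩ := exists_lt_of_csInf_lt hne
      (lt_add_of_pos_right (driftNorm b T) (by positivity : (0 : ℝ) < 1 / ((n : ℝ) + 1)))
    filter_upwards [hM.2] with s hs y using (hs y).trans hlt.le
  filter_upwards [ae_all_iff.2 h] with s hs y
  refine ge_of_tendsto' (x := atTop) ?_ fun n : ℕ => hs n y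
  simpa using tendsto_const_nhds.add (tendsto_one_div_add_atTop_nhds_zero_nat (𝕜 := ℝ))

/-- A bounded drift agrees at almost all times with one that is bounded everywhere by its norm. -/
lemma IsBoundedDrift.exists_forall_abs_le (hb : IsBoundedDrift b T) :
    ∃ b' : ℝ → ℝ → ℝ, Measurable (Function.uncurry b') ∧ (∀ s y, |b' s y| ≤ driftNorm b T) ∧
      ∀ᵐ s ∂(volume.restrict (Icc 0 T)), ∀ y, b' s y = b s y := by
  have hM := isDriftBound_driftNorm hb
  refine ⟨fun s y => max (-driftNorm b T) (min (driftNorm b T) (b s y)), ?_, fun s y => ?_, ?_⟩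
  · exact measurable_const.max (measurable_const.min hb.1)
  · exact abs_le.2 ⟨le_max_left _ _, max_le (by linarith [hM.1]) (min_le_left _ _)⟩
  · filter_upwards [hM.2] with s hs y
    rw [min_eq_right (abs_le.1 (hs y)).2, max_eq_right (abs_le.1 (hs y)).1]

lemma IsLambda.congr {t : ℝ} (ht : t ∈ Icc 0 T) (hB : ∀ᵐ ω ∂P, ∀ s ∈ Icc 0 T, B' s ω = B s ω)
    (hb : ∀ᵐ s ∂(volume.restrict (Icc 0 T)), ∀ y, b' s y = b s y) {L : Ω → ℝ → ℂ}
    (h : IsLambda P B b t L) : IsLambda P B' b' t L := by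
  refine ⟨h.measurable, fun y => (h.tendsto y).congr fun K => eLpNorm_congr_ae ?_⟩
  filter_upwards [hB] with ω hω
  rw [truncLambda_congr ht hω hb]

end Data

/-! ### Moments of the integral of the field -/

lemma sq_lintegral_mul_le {α : Type*} [MeasurableSpace α] {μ : Measure α} {f g : α → ENNReal}
    (hf : AEMeasurable f μ) (hg : AEMeasurable g μ) :
    (∫⁻ a, f a * g a ∂μ) ^ 2 ≤ (∫⁻ a, f a ^ 2 ∂μ) * ∫⁻ a, g a ^ 2 ∂μ := by
  have h := ENNReal.lintegral_mul_le_Lp_mul_Lq μ Real.HolderConjugate.two_two hf hg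
  simp only [Pi.mul_apply, ENNReal.rpow_two] at h
  refine (pow_le_pow_left' h 2).trans (le_of_eq ?_)
  rw [mul_pow, ← ENNReal.rpow_two, ← ENNReal.rpow_two, ← ENNReal.rpow_mul, ← ENNReal.rpow_mul]
  norm_num

/-- Cauchy's inequality with the weight `1 + y ^ 2`, whose reciprocal has integral `π`. -/
lemma sq_lintegral_le_weighted {f : ℝ → ENNReal} (hf : Measurable f) :
    (∫⁻ y, f y) ^ 2 ≤ ENNReal.ofReal Real.pi * ∫⁻ y, ENNReal.ofReal (1 + y ^ 2) * f y ^ 2 := by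
  have hpos : ∀ y : ℝ, 0 < 1 + y ^ 2 := fun y => by positivity
  have h := sq_lintegral_mul_le (μ := volume) (f := fun y : ℝ => ENNReal.ofReal (√((1 + y ^ 2)⁻¹)))
    (g := fun y => ENNReal.ofReal (√(1 + y ^ 2)) * f y) (by fun_prop) (by fun_prop)
  have h1 : ∀ y : ℝ, ENNReal.ofReal (√((1 + y ^ 2)⁻¹)) * (ENNReal.ofReal (√(1 + y ^ 2)) * f y) =
      f y := fun y => by
    rw [← mul_assoc, ← ENNReal.ofReal_mul (by positivity), ← Real.sqrt_mul (by positivity),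
      inv_mul_cancel₀ (hpos y).ne', Real.sqrt_one, ENNReal.ofReal_one, one_mul]
  have h2 : ∀ y : ℝ, ENNReal.ofReal (√((1 + y ^ 2)⁻¹)) ^ 2 = ENNReal.ofReal ((1 + y ^ 2)⁻¹) :=
    fun y => by rw [← ENNReal.ofReal_pow (by positivity), Real.sq_sqrt (by positivity)]
  have h3 : ∀ y : ℝ, (ENNReal.ofReal (√(1 + y ^ 2)) * f y) ^ 2 =
      ENNReal.ofReal (1 + y ^ 2) * f y ^ 2 := fun y => by
    rw [mul_pow, ← ENNReal.ofReal_pow (by positivity), Real.sq_sqrt (by positivity)]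
  simp only [h1, h2, h3] at h
  rwa [← ofReal_integral_eq_lintegral_ofReal integrable_inv_one_add_sq
    (Eventually.of_forall fun y => by positivity), integral_univ_inv_one_add_sq] at h

section Bound

variable {Ω : Type*} [MeasurableSpace Ω] {P : Measure Ω}
  {B : ℝ → Ω → ℝ} {b : ℝ → ℝ → ℝ} {M t : ℝ}

lemma measurable_truncLambda_apply (hB : Measurable (Function.uncurry B))
    (hb : Measurable (Function.uncurry b)) (hM : ∀ s y, |b s y| ≤ M) (ht : 0 ≤ t) {K : ℝ}
    (hK : 0 ≤ K) (y : ℝ) : Measurable fun ω => truncLambda B b t K ω y := by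
  simp only [truncLambda_eq_multLambda hB hb hM ht hK]
  exact measurable_multLambda_apply hB hb (measurable_one.indicator measurableSet_Ioc) t y

/-- The limit of the truncated fields in `L²(Ω)` is unique up to a null set, for every `y`. -/
lemma IsLambda.ae_eq (hB : Measurable (Function.uncurry B)) (hb : Measurable (Function.uncurry b))
    (hM : ∀ s y, |b s y| ≤ M) (ht : 0 ≤ t) {L L' : Ω → ℝ → ℂ} (hL : IsLambda P B b t L)
    (hL' : IsLambda P B b t L') (y : ℝ) : ∀ᵐ ω ∂P, L ω y = L' ω y := by
  have h0 : Measurable fun ω : Ω => (ω, y) := measurable_id.prodMk measurable_const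
  have hm : Measurable fun ω => L ω y := hL.measurable.comp h0
  have hm' : Measurable fun ω => L' ω y := hL'.measurable.comp h0
  have hle : ∀ᶠ K : ℝ in atTop, eLpNorm (fun ω => L ω y - L' ω y) 2 P ≤
      eLpNorm (fun ω => truncLambda B b t K ω y - L' ω y) 2 P +
        eLpNorm (fun ω => truncLambda B b t K ω y - L ω y) 2 P := by
    filter_upwards [eventually_ge_atTop 0] with K hK
    have hK' := measurable_truncLambda_apply hB hb hM ht hK y
    have h1 : (fun ω => L ω y - L' ω y) = (fun ω => truncLambda B b t K ω y - L' ω y) -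
        fun ω => truncLambda B b t K ω y - L ω y := by
      ext ω
      simp only [Pi.sub_apply]
      ring
    rw [h1]
    exact eLpNorm_sub_le (hK'.sub hm').aestronglyMeasurable (hK'.sub hm).aestronglyMeasurable
      one_le_two
  have hlim := (hL'.tendsto y).add (hL.tendsto y)
  rw [add_zero] at hlim
  have hz := le_antisymm (ge_of_tendsto hlim hle) bot_le
  filter_upwards [(eLpNorm_eq_zero_iff (hm.sub hm').aestronglyMeasurable two_ne_zero).1 hz]
    with ω hω
  exact sub_eq_zero.1 hω

variable [IsProbabilityMeasure P]

/-- The moment bound for the field passes from the weighted square integrals of its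
mollifications to the integral of its absolute value. -/
lemma sq_lintegral_pow_le_of_tendsto (hB : Measurable (Function.uncurry B))
    (hb : Measurable (Function.uncurry b)) {L : Ω → ℝ → ℂ} (hL : Measurable (Function.uncurry L))
    {ε : ℕ → ℝ} (hae : ∀ y, ∀ᵐ ω ∂P,
      Tendsto (fun i => (mollLambda B b t (ε i) ω y : ℂ)) atTop (𝓝 (L ω y))) {m : ℕ} {c : ENNReal}
    (hc : ∀ i, ∫⁻ ω, (∫⁻ y, ENNReal.ofReal ((1 + y ^ 2) * mollLambda B b t (ε i) ω y ^ 2)) ^ m ∂P ≤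
      c) :
    (∫⁻ ω, (∫⁻ y, ‖L ω y‖ₑ) ^ m ∂P) ^ 2 ≤ ENNReal.ofReal Real.pi ^ m * c := by
  have hmm : ∀ i, Measurable fun p : Ω × ℝ => mollLambda B b t (ε i) p.1 p.2 := fun i =>
    measurable_mollLambda hB hb t (ε i)
  have hLp : Measurable fun p : Ω × ℝ => L p.1 p.2 := hL
  have hset : MeasurableSet {p : Ω × ℝ |
      Tendsto (fun i => (mollLambda B b t (ε i) p.1 p.2 : ℂ) - L p.1 p.2) atTop (𝓝 0)} :=
    measurableSet_tendsto _ fun i => (Complex.measurable_ofReal.comp (hmm i)).sub hLp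
  have hae2 : ∀ᵐ ω ∂P, ∀ᵐ y,
      Tendsto (fun i => (mollLambda B b t (ε i) ω y : ℂ) - L ω y) atTop (𝓝 0) := by
    refine (Measure.ae_ae_comm hset).2 (Eventually.of_forall fun y => ?_)
    filter_upwards [hae y] with ω hω
    simpa using hω.sub_const (L ω y)
  have hFatou : ∫⁻ ω, (∫⁻ y, ENNReal.ofReal (1 + y ^ 2) * ‖L ω y‖ₑ ^ 2) ^ m ∂P ≤ c := by
    refine lintegral_lintegral_pow_le_of_le_liminf (F := fun i ω y =>
      ENNReal.ofReal ((1 + y ^ 2) * mollLambda B b t (ε i) ω y ^ 2)) (fun i => ?_) ?_ hc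
    · have h2 := hmm i
      have h3 : Measurable fun p : Ω × ℝ =>
          ENNReal.ofReal ((1 + p.2 ^ 2) * mollLambda B b t (ε i) p.1 p.2 ^ 2) := by fun_prop
      exact h3
    · filter_upwards [hae2] with ω hω
      filter_upwards [hω] with y hy
      have h2 : Tendsto (fun i => (mollLambda B b t (ε i) ω y : ℂ)) atTop (𝓝 (L ω y)) := by
        simpa using hy.add_const (L ω y)
      have h3 : ∀ i, ENNReal.ofReal ((1 + y ^ 2) * mollLambda B b t (ε i) ω y ^ 2) =
          ENNReal.ofReal (1 + y ^ 2) * ‖(mollLambda B b t (ε i) ω y : ℂ)‖ₑ ^ 2 := fun i => by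
        rw [ENNReal.ofReal_mul (by positivity), ← ofReal_norm, Complex.norm_real,
          ← ENNReal.ofReal_pow (norm_nonneg _), Real.norm_eq_abs, sq_abs]
      simp only [h3]
      refine le_of_eq (Tendsto.liminf_eq ?_).symm
      refine ENNReal.Tendsto.const_mul ?_ (Or.inr ENNReal.ofReal_ne_top)
      exact ((ENNReal.continuous_pow 2).tendsto _).comp ((continuous_enorm.tendsto _).comp h2)
  have hXm : Measurable fun ω => (∫⁻ y, ‖L ω y‖ₑ) ^ m := by
    have h2 : Measurable fun p : Ω × ℝ => ‖L p.1 p.2‖ₑ := hLp.enorm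
    exact h2.lintegral_prod_right'.pow_const m
  have hLω : ∀ ω, Measurable fun y => ‖L ω y‖ₑ := fun ω => by
    have h0 : Measurable fun y : ℝ => (ω, y) := measurable_const.prodMk measurable_id
    exact (hLp.comp h0).enorm
  calc (∫⁻ ω, (∫⁻ y, ‖L ω y‖ₑ) ^ m ∂P) ^ 2
      ≤ ∫⁻ ω, ((∫⁻ y, ‖L ω y‖ₑ) ^ m) ^ 2 ∂P := by
        have h := sq_lintegral_mul_le (μ := P) (f := fun _ => 1) aemeasurable_const
          hXm.aemeasurable
        simpa using h
    _ ≤ ∫⁻ ω, ENNReal.ofReal Real.pi ^ m *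
          (∫⁻ y, ENNReal.ofReal (1 + y ^ 2) * ‖L ω y‖ₑ ^ 2) ^ m ∂P := by
        refine lintegral_mono fun ω => ?_
        rw [← pow_mul, mul_comm m, pow_mul, ← mul_pow]
        exact pow_le_pow_left' (sq_lintegral_le_weighted (hLω ω)) m
    _ = ENNReal.ofReal Real.pi ^ m *
          ∫⁻ ω, (∫⁻ y, ENNReal.ofReal (1 + y ^ 2) * ‖L ω y‖ₑ ^ 2) ^ m ∂P :=
        lintegral_const_mul' _ _ (ENNReal.pow_ne_top ENNReal.ofReal_ne_top)
    _ ≤ _ := by gcongr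

end Bound

theorem mainTheorem4 (H : ℝ) (hH : H ∈ Ioo (0 : ℝ) (1 / 3)) (T : ℝ) (hT : 0 < T) :
    ∃ C : ℝ, 0 < C ∧
      ∀ (Ω : Type*) [MeasurableSpace Ω] (P : Measure Ω) [IsProbabilityMeasure P]
        (B : ℝ → Ω → ℝ), IsFractionalBM H T B P →
      ∀ b : ℝ → ℝ → ℝ, IsBoundedDrift b T →
      ∀ t ∈ Icc (0 : ℝ) T,
        (∃ L : Ω → ℝ → ℂ, IsLambda P B b t L) ∧
        ∀ L : Ω → ℝ → ℂ, IsLambda P B b t L →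
          ∀ m : ℕ,
            ∫⁻ ω, (∫⁻ y, ‖L ω y‖ₑ) ^ m ∂P ≤
              ENNReal.ofReal (C ^ m * driftNorm b T ^ m * √((2 * m).factorial : ℝ) /
                √(Real.Gamma (m * (1 - 3 * H) + 1))) := by
  have hH1 : 3 * H < 1 := by linarith [hH.2]
  obtain ⟨A, hA, hAle⟩ := exists_lintegral_mollLambda_sq_pow_le hH.1 hH1 hT.le
  -- `π` is the integral of `(1 + y ^ 2)⁻¹`, and the square root is that of
  -- `E[X ^ m] ≤ E[X ^ (2m)] ^ (1 / 2)`
  refine ⟨√(Real.pi * A), by positivity, fun Ω _ P _ B hfbm b hb t ht => ?_⟩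
  obtain ⟨B', hB'm, hBB'⟩ := hfbm.exists_measurable_modification
  obtain ⟨b', hb'm, hb'M, hbb'⟩ := hb.exists_forall_abs_le
  have hlaw := hfbm.hasFbmMarginals.congr hBB'
  obtain ⟨L₀, hL₀, ε, hε0, hε1, hae⟩ := exists_isLambda_tendsto_mollLambda hH.1 hH1 hT.le hB'm
    hlaw hb'm hb'M ht.1 ht.2
  have hM0 : 0 ≤ driftNorm b T := (isDriftBound_driftNorm hb).1
  refine ⟨⟨L₀, hL₀.congr ht (hBB'.mono fun ω hω s hs => (hω s hs).symm)
    (hbb'.mono fun s hs y => (hs y).symm)⟩, fun L hL m => ?_⟩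
  rcases Nat.eq_zero_or_pos m with rfl | hm
  · simp
  have haeL : ∀ y, ∀ᵐ ω ∂P,
      Tendsto (fun i => (mollLambda B' b' t (ε i) ω y : ℂ)) atTop (𝓝 (L ω y)) := fun y => by
    filter_upwards [hae y, IsLambda.ae_eq hB'm hb'm hb'M ht.1 (hL.congr ht hBB' hbb') hL₀ y]
      with ω hω hω'
    rwa [hω']
  have hG : 0 < Real.Gamma (m * (1 - 3 * H) + 1) :=
    Real.Gamma_pos_of_pos (by have : 0 ≤ (m : ℝ) * (1 - 3 * H) := by
                                have : 0 ≤ 1 - 3 * H := by linarith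
                                positivity
                              linarith)
  have hsq := sq_lintegral_pow_le_of_tendsto hB'm hb'm hL.measurable haeL (m := m) fun i =>
    hAle Ω P B' hB'm hlaw b' hb'm _ hM0 hb'M t ht.2 (ε i) (hε0 i) (hε1 i) m hm
  refine (ENNReal.pow_right_strictMono two_ne_zero).le_iff_le.1 (hsq.trans (le_of_eq ?_))
  have hC : (√(Real.pi * A) ^ m) ^ 2 = Real.pi ^ m * A ^ m := by
    rw [pow_right_comm, Real.sq_sqrt (by positivity), mul_pow]
  rw [← ENNReal.ofReal_pow Real.pi_pos.le, ← ENNReal.ofReal_mul (by positivity),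
    ← ENNReal.ofReal_pow (by positivity), div_pow, mul_pow, mul_pow, hC,
    Real.sq_sqrt (by positivity), Real.sq_sqrt hG.le]
  congr 1
  ring
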